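/- For a locally integrable $g:\mathbb R\to\mathbb R$ let $$Hg(x)=\frac1\pi\,\mathrm{PV}\!\!\int_{-\infty}^{\infty}\frac{g(y)}{y-x}\,dy =\frac1\pi\lim_{\varepsilon\to0^+,\,a\to-\infty,\,b\to\infty}\left(\int_a^{x-\varepsilon}+\int_{x+\varepsilon}^{b}\right)\frac{g(y)}{y-x}\,dy$$ be the Hilbert transform at $x$, whenever the limit exists (with $\varepsilon,a,b$ varying independently). Let $F>0$ and $f(x)=\dfrac{1}{\pi(x^2+1)}$. Then: 1. $Hf(t)$ and $Hf'(t)$ exist for every $t\in\mathbb R$, and $Hf(t)=-\dfrac{t}{\pi(t^2+1)}$. 2. For every $u\in C^2(\mathbb R)$, the function $u$ satisfies the integrodifferential equation $$u(x)+F^2\,Hu'(x)=f(x)\qquad\text{for all }x\in\mathbb R$$ (including the existence of $Hu'(x)$ for all $x$) if and only if it satisfies the ordinary differential equation $$F^4u''(x)+u(x)=f(x)-F^2\,Hf'(x)\qquad\text{for all }x\in\mathbb R.$$ 3. There is exactly one $u\in C^2(\mathbb R)$ that satisfies the integrodifferential equation and $\lim_{x\to-\infty}u(x)=0$. For every $x\in\mathbb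 R$ it is given by the convergent improper integrals $$u(x)=\frac1{F^2}\int_{-\infty}^{x}\left[\sin\!\Big(\frac{x-t}{F^2}\Big)f(t)-\cos\!\Big(\frac{x-t}{F^2}\Big)Hf(t)\right]dt$$ $$\phantom{u(x)}=\frac1{\pi F^2}\int_0^\infty\left[\sin\!\Big(\frac{s}{F^2}\Big)\frac{1}{(x-s)^2+1}+\cos\!\Big(\frac{s}{F^2}\Big)\frac{x-s}{(x-s)^2+1}\right]ds .$$ -/

import Mathlib

open Filter Topology MeasureTheory

noncomputable section

namespace SurfaceWave

/-- The truncation of `(1/π) ∫ g(y)/(y-x) dy` to `[a, x-ε] ∪ [x+ε, b]`. -/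
def truncatedHilbert (g : ℝ → ℝ) (x ε a b : ℝ) : ℝ :=
  (1 / Real.pi) * ((∫ y in a..(x - ε), g y / (y - x)) + ∫ y in (x + ε)..b, g y / (y - x))

/-- `ε → 0+`, `a → -∞`, `b → +∞`, independently of each other. -/
def truncationFilter : Filter (ℝ × ℝ × ℝ) := 𝓝[>] (0 : ℝ) ×ˢ ((atBot : Filter ℝ) ×ˢ (atTop : Filter ℝ))

/-- The Hilbert transform `Hg(x) = (1/π) PV ∫ g(y)/(y-x) dy` exists at `x` and equals `L`:
Cauchy principal value at `y = x`, improper integral at `±∞`. -/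
def HasHilbertTransformAt (g : ℝ → ℝ) (x L : ℝ) : Prop :=
  LocallyIntegrable g volume ∧
    Tendsto (fun p : ℝ × ℝ × ℝ => truncatedHilbert g x p.1 p.2.1 p.2.2) truncationFilter (𝓝 L)

/-- The value `Hg(x)`; meaningful where `HasHilbertTransformAt g x L` holds for some `L`. -/
def hilbertTransform (g : ℝ → ℝ) (x : ℝ) : ℝ :=
  limUnder truncationFilter (fun p : ℝ × ℝ × ℝ => truncatedHilbert g x p.1 p.2.1 p.2.2)

/-- `f(x) = 1/(π(x²+1))`. -/
def forcing (x : ℝ) : ℝ := 1 / (Real.pi * (x ^ 2 + 1))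

/-- `u + F² H u' = f` on the whole line, including the existence of `H u'` at every point. -/
def SolvesIntegrodifferential (F : ℝ) (u : ℝ → ℝ) : Prop :=
  ∀ x : ℝ, (∃ L : ℝ, HasHilbertTransformAt (deriv u) x L) ∧
    u x + F ^ 2 * hilbertTransform (deriv u) x = forcing x

/-- `F⁴ u'' + u = f - F² H f'` on the whole line. -/
def SolvesODE (F : ℝ) (u : ℝ → ℝ) : Prop :=
  ∀ x : ℝ, F ^ 4 * deriv (deriv u) x + u x
    = forcing x - F ^ 2 * hilbertTransform (deriv forcing) x

end SurfaceWave

end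

noncomputable section

namespace SurfaceWave

/-! Put `c = 1/F²`. The mechanism is that `H` acts on boundary values from the upper half-plane as
multiplication by `i`: if `U` is holomorphic near the closed half-plane and `o(|z|)` there, and `Re
U` is bounded on the line, then `H(Re U') = -Im U'` (`hasHilbertTransformAt_re_deriv`). With `Φ(z) =
(i/π)/(z+i)`, whose real part on the line is `f`, any bounded holomorphic `U` with `U' = ic(U - Φ)`
therefore gives a solution `u = Re U` of the integrodifferential equation; taking the real part of
one more derivative gives the differential equation. The solutions of this complex equation are a
particular one, `particularExt`, built from `∫₀^∞ e^{ics}/(s-z)² ds`, plus `A e^{icz}`. It remains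
to see that neither real equation has other `C²` solutions, and that only `A = 0` decays at `-∞`.

For the differential equation this is elementary. For the integrodifferential one, a difference `w`
of two solutions satisfies `H w' = -c w`, with no growth assumption on `w`, so `H` cannot simply be
applied again. The existence of `H w'` at one point already makes `∫ w'(±s)/s ds` converge at
infinity, and hence `w(x) = o(|x|)` (Kronecker's lemma). So `B(z) = ∫ w(x)(x-z)⁻³ dx` is holomorphic
and sublinear in the upper half-plane. Integrating the equation twice in `x` and pairing it with
`(x-z)⁻⁵` transfers it to `B`: the symmetric integral of `B'` about `z` tends to `-πcB(z)`, while
Cauchy's theorem says that it tends to `iπB'(z)`. Thus `B' = icB`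
(`hasDerivAt_cauchyPow_of_hilbert`) and `B = A e^{icz}`.

Finally `2 Im (y-iη)⁻³` is the second derivative of the Poisson kernel, so `2 Im B(x+iη) → πw''(x)`
as `η → 0⁺`. Hence `w''` is sinusoidal, `w` is sinusoidal up to an affine function, sublinearity
removes the slope, and the equation itself removes the constant (`exists_eq_trig_of_hilbert`). -/

/-! ### Cauchy's theorem and principal values in the upper half-plane -/

/-- Points of the closed upper half-plane going to infinity. -/
def upperInfinity : Filter ℂ := Bornology.cobounded ℂ ⊓ 𝓟 {z : ℂ | 0 ≤ z.im}

/-- The open half-plane above height `-η`. -/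
def halfPlane (η : ℝ) : Set ℂ := {z : ℂ | -η < z.im}

lemma isOpen_halfPlane (η : ℝ) : IsOpen (halfPlane η) :=
  isOpen_lt continuous_const Complex.continuous_im

lemma ofReal_mem_halfPlane {η : ℝ} (hη : 0 < η) (x : ℝ) : (x : ℂ) ∈ halfPlane η := by
  simp [halfPlane, hη]

lemma halfPlane_mem_nhds {η : ℝ} {z : ℂ} (hz : z ∈ halfPlane η) : halfPlane η ∈ 𝓝 z :=
  (isOpen_halfPlane η).mem_nhds hz

lemma continuous_comp_ofReal {η : ℝ} (hη : 0 < η) {h : ℂ → ℂ}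
    (hd : DifferentiableOn ℂ h (halfPlane η)) : Continuous fun y : ℝ => h y :=
  hd.continuousOn.comp_continuous Complex.continuous_ofReal (ofReal_mem_halfPlane hη)

lemma tendsto_ofReal_upperInfinity : Tendsto (fun S : ℝ => (S : ℂ)) atTop upperInfinity := by
  refine tendsto_inf.2 ⟨?_, tendsto_principal.2 (Eventually.of_forall fun S => by simp)⟩
  rw [← tendsto_norm_atTop_iff_cobounded]
  simpa using tendsto_abs_atTop_atTop

lemma tendsto_neg_ofReal_upperInfinity :
    Tendsto (fun S : ℝ => (-S : ℂ)) atTop upperInfinity := by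
  refine tendsto_inf.2 ⟨?_, tendsto_principal.2 (Eventually.of_forall fun S => by simp)⟩
  rw [← tendsto_norm_atTop_iff_cobounded]
  simpa using tendsto_abs_atTop_atTop

/-- Cauchy's theorem on the upper half-plane for functions that are `o(1/|z|)` at infinity. -/
lemma tendsto_integral_zero_of_decay {η : ℝ} (hη : 0 < η) {h : ℂ → ℂ}
    (hd : DifferentiableOn ℂ h (halfPlane η))
    (hdec : Tendsto (fun z => z * h z) upperInfinity (𝓝 0)) :
    Tendsto (fun S : ℝ => ∫ y in (-S)..S, h y) atTop (𝓝 0) := by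
  rw [Metric.tendsto_nhds]
  intro ε hε
  have h1 : ∀ᶠ z in upperInfinity, ‖z * h z‖ < ε / 8 := by
    have := (Metric.tendsto_nhds.1 hdec) (ε / 8) (by positivity)
    simpa [dist_eq_norm] using this
  rw [upperInfinity, eventually_inf_principal,
    (hasBasis_cobounded_norm (E := ℂ)).eventually_iff] at h1
  obtain ⟨R, -, hR⟩ := h1
  filter_upwards [eventually_ge_atTop (max R 1)] with S hS
  have hSR : R ≤ S := (le_max_left _ _).trans hS
  have hS1 : 1 ≤ S := (le_max_right _ _).trans hS
  have hS0 : 0 < S := by linarith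
  have key : ∀ z : ℂ, 0 ≤ z.im → S ≤ ‖z‖ → ‖h z‖ ≤ ε / 8 / S := by
    intro z hz hn
    have := hR (show z ∈ {x : ℂ | R ≤ ‖x‖} from hSR.trans hn) hz
    rw [norm_mul] at this
    rw [le_div_iff₀ hS0]
    nlinarith [norm_nonneg (h z)]
  -- The contour is the rectangle `[-S, S] × [0, S]`. On its other three sides, of total length
  -- `4S`, the integrand is at most `ε/(8S)`.
  have hrect := Complex.integral_boundary_rect_eq_zero_of_differentiableOn h (-S : ℂ) (S + S * Complex.I)
    (hd.mono (by
      intro z hz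
      rw [Complex.mem_reProdIm] at hz
      have h2 := hz.2
      simp only [Complex.neg_im, Complex.ofReal_im, neg_zero, Complex.add_im, Complex.mul_im,
        Complex.ofReal_re, Complex.I_im, mul_one, Complex.I_re, mul_zero, add_zero, zero_add,
        Set.uIcc_of_le hS0.le, Set.mem_Icc] at h2
      simp only [halfPlane, Set.mem_ofPred_eq]
      linarith [h2.1]))
  simp only [Complex.neg_im, Complex.ofReal_im, neg_zero, Complex.add_im, Complex.mul_im,
    Complex.ofReal_re, Complex.I_im, mul_one, Complex.I_re, mul_zero, add_zero, zero_add,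
    Complex.neg_re, Complex.add_re, Complex.mul_re, Complex.ofReal_zero,
    zero_mul, sub_self] at hrect
  have b1 : ‖∫ x in (-S)..S, h (x + S * Complex.I)‖ ≤ ε / 8 / S * |S - -S| := by
    refine intervalIntegral.norm_integral_le_of_norm_le_const fun x _ => key _ (by simp [hS0.le]) ?_
    calc S = |(x + S * Complex.I : ℂ).im| := by simp [abs_of_pos hS0]
      _ ≤ _ := Complex.abs_im_le_norm _
  have b2 : ∀ r : ℝ, |r| = S → ‖∫ y in (0 : ℝ)..S, h (r + y * Complex.I)‖ ≤ ε / 8 / S * |S - 0| := by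
    intro r hr
    refine intervalIntegral.norm_integral_le_of_norm_le_const fun y hy => key _ ?_ ?_
    · rw [Set.uIoc_of_le hS0.le] at hy
      simp [hy.1.le]
    · calc S = |(r + y * Complex.I : ℂ).re| := by simp [hr]
        _ ≤ _ := Complex.abs_re_le_norm _
  have b3 := b2 S (abs_of_pos hS0)
  have b4 := b2 (-S) (by rw [abs_neg, abs_of_pos hS0])
  have e1 : ε / 8 / S * |S - -S| = ε / 4 := by
    rw [abs_of_pos (by linarith)]; field_simp; norm_num
  have e2 : ε / 8 / S * |S - 0| = ε / 8 := by
    rw [sub_zero, abs_of_pos hS0]; field_simp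
  rw [e1] at b1; rw [e2] at b3 b4
  have : (∫ y in (-S)..S, h y) = (∫ x in (-S)..S, h (x + S * Complex.I))
      - Complex.I • (∫ y in (0 : ℝ)..S, h (S + y * Complex.I))
      + Complex.I • (∫ y in (0 : ℝ)..S, h ((-S : ℝ) + y * Complex.I)) := by
    linear_combination hrect
  rw [dist_zero_right, this]
  calc _ ≤ ‖∫ x in (-S)..S, h (x + S * Complex.I)‖
      + ‖Complex.I • (∫ y in (0 : ℝ)..S, h (S + y * Complex.I))‖
      + ‖Complex.I • (∫ y in (0 : ℝ)..S, h ((-S : ℝ) + y * Complex.I))‖ := by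
        refine (norm_add_le _ _).trans (add_le_add (norm_sub_le _ _) le_rfl)
    _ ≤ ε / 4 + ε / 8 + ε / 8 := by
        rw [norm_smul, norm_smul, Complex.norm_I, one_mul, one_mul]
        exact add_le_add (add_le_add b1 b3) b4
    _ < ε := by linarith

lemma ofReal_add_I_ne_zero (y : ℝ) : (y : ℂ) + Complex.I ≠ 0 := fun h => by
  simpa using congrArg Complex.im h

lemma integral_inv_add_I (S : ℝ) :
    ∫ y in (-S)..S, ((y : ℂ) + Complex.I)⁻¹ = -Complex.I * ((2 * Real.arctan S : ℝ) : ℂ) := by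
  -- This antiderivative is `log(y + i)` up to a constant. Its real part is even and drops out on a
  -- symmetric interval.
  have hder : ∀ y : ℝ, HasDerivAt (fun y : ℝ => ((Real.log (y ^ 2 + 1) / 2 : ℝ) : ℂ)
      - Complex.I * (Real.arctan y : ℝ)) (((y : ℂ) + Complex.I)⁻¹) y := by
    intro y
    have hy : (y ^ 2 + 1 : ℝ) ≠ 0 := by positivity
    have h1 : HasDerivAt (fun y : ℝ => Real.log (y ^ 2 + 1) / 2) (y / (y ^ 2 + 1)) y := by
      have := ((((hasDerivAt_id y).pow 2).add_const 1).log hy).div_const 2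
      refine this.congr_deriv ?_
      simp; field_simp
    have h2 := (Real.hasDerivAt_arctan y).ofReal_comp.const_mul Complex.I
    refine (h1.ofReal_comp.sub h2).congr_deriv ?_
    have hc : ((y : ℂ) ^ 2 + 1) ≠ 0 := by exact_mod_cast hy
    have hc' : (1 + (y : ℂ) ^ 2) ≠ 0 := by rwa [add_comm]
    have hI := ofReal_add_I_ne_zero y
    push_cast
    field_simp
    ring_nf
    simp
    ring
  rw [intervalIntegral.integral_eq_sub_of_hasDerivAt (fun y _ => hder y)]
  · rw [Real.arctan_neg]
    push_cast
    rw [neg_sq]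
    ring
  · exact (Continuous.inv₀ (by fun_prop) ofReal_add_I_ne_zero).intervalIntegrable _ _

/-- Differentiate `U(z) = U(0) + z q(z)`. The point is to trade `U'`, about whose growth nothing is
assumed, for the slope `q`, which tends to `0` when `U` is sublinear. -/
lemma deriv_eq_dslope_add {U : ℂ → ℂ} {η : ℝ} (hη : 0 < η)
    (hU : DifferentiableOn ℂ U (halfPlane η)) {z : ℂ} (hz : z ∈ halfPlane η) :
    deriv U z = dslope U 0 z + z * deriv (dslope U 0) z := by
  have h0 : halfPlane η ∈ 𝓝 (0 : ℂ) := halfPlane_mem_nhds (by simpa using ofReal_mem_halfPlane hη 0)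
  have hq := (Complex.differentiableOn_dslope h0).2 hU
  have hqz : HasDerivAt (dslope U 0) (deriv (dslope U 0) z) z :=
    (hq.differentiableAt (halfPlane_mem_nhds hz)).hasDerivAt
  have h1 : HasDerivAt (fun w => U 0 + w * dslope U 0 w)
      (1 * dslope U 0 z + z * deriv (dslope U 0) z) z :=
    ((hasDerivAt_id z).mul hqz).const_add _
  have h2 : (fun w => U 0 + w * dslope U 0 w) = U := by
    ext w
    have := sub_smul_dslope U 0 w
    simp only [sub_zero, smul_eq_mul] at this
    rw [this]; ring
  rw [h2] at h1
  rw [h1.deriv, one_mul]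

/-- The symmetric principal value of `U'` at `0` for `U` holomorphic near the closed upper
half-plane with sublinear growth. -/
lemma tendsto_integral_dslope_deriv {η : ℝ} (hη : 0 < η) {U : ℂ → ℂ}
    (hU : DifferentiableOn ℂ U (halfPlane η))
    (hsub : Tendsto (fun z => U z / z) upperInfinity (𝓝 0)) :
    Tendsto (fun S : ℝ => ∫ y in (-S)..S, dslope (deriv U) 0 y) atTop
      (𝓝 (Complex.I * Real.pi * deriv U 0)) := by
  have h0 : ∀ {η : ℝ}, 0 < η → halfPlane η ∈ 𝓝 (0 : ℂ) := fun hη =>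
    halfPlane_mem_nhds (by simpa using ofReal_mem_halfPlane hη 0)
  set q := dslope U 0 with hq
  set D := dslope q 0 with hD
  have hqd : DifferentiableOn ℂ q (halfPlane η) := (Complex.differentiableOn_dslope (h0 hη)).2 hU
  have hDd : DifferentiableOn ℂ D (halfPlane η) := (Complex.differentiableOn_dslope (h0 hη)).2 hqd
  have hq0 : q 0 = deriv U 0 := dslope_same _ _
  have hinf : Tendsto (fun z : ℂ => z) upperInfinity (Bornology.cobounded ℂ) :=
    tendsto_id.mono_left inf_le_left
  have hne : ∀ᶠ z in upperInfinity, z ≠ 0 := hinf.eventually (Bornology.eventually_ne_cobounded 0)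
  have hq_lim : Tendsto q upperInfinity (𝓝 0) := by
    have h1 : Tendsto (fun z : ℂ => U z / z - U 0 * z⁻¹) upperInfinity (𝓝 (0 - U 0 * 0)) :=
      hsub.sub ((tendsto_inv₀_cobounded.comp hinf).const_mul _)
    rw [mul_zero, sub_zero] at h1
    refine h1.congr' ?_
    filter_upwards [hne] with z hz
    rw [hq, dslope_of_ne _ hz, slope_def_field, sub_zero]
    ring
  -- Since `q → 0`, `D(z) = (q(z) - q(0))/z` behaves like `-U'(0)/z`. Adding `U'(0)/(z+i)` makes it
  -- `o(1/|z|)`, and the added term is integrated explicitly; it is the source of `iπU'(0)`.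
  set h : ℂ → ℂ := fun z => D z + deriv U 0 * (z + Complex.I)⁻¹ with hh
  -- The correction term has a pole at `-i`, so the strip must stay above it.
  have hηm : 0 < min η 1 := lt_min hη one_pos
  have hhd : DifferentiableOn ℂ h (halfPlane (min η 1)) := by
    refine (hDd.mono fun z hz => ?_).add (((differentiableOn_id.add_const _).inv ?_).const_mul _)
    · exact lt_of_le_of_lt (neg_le_neg (min_le_left η 1)) (show -min η 1 < z.im from hz)
    · intro z hz h0
      have h1 := congrArg Complex.im h0
      have h2 : -min η 1 < z.im := hz
      have := min_le_right η 1
      simp at h1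
      linarith
  have hdec : Tendsto (fun z => z * h z) upperInfinity (𝓝 0) := by
    have hI : Tendsto (fun z : ℂ => (z + Complex.I)⁻¹) upperInfinity (𝓝 0) :=
      tendsto_inv₀_cobounded.comp ((tendsto_add_const_cobounded Complex.I).comp hinf)
    have h1 : Tendsto (fun z : ℂ => q z - deriv U 0 * Complex.I * (z + Complex.I)⁻¹) upperInfinity
        (𝓝 (0 - deriv U 0 * Complex.I * 0)) := hq_lim.sub (hI.const_mul _)
    rw [mul_zero, sub_zero] at h1
    refine h1.congr' ?_
    filter_upwards [hne, hinf.eventually (Bornology.eventually_ne_cobounded (-Complex.I))] with z hz hz'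
    have hzI : z + Complex.I ≠ 0 := fun h => hz' (eq_neg_of_add_eq_zero_left h)
    simp only [hh]
    rw [hD, dslope_of_ne _ hz, slope_def_field, hq0, sub_zero]
    field_simp
    ring
  have hK := tendsto_integral_zero_of_decay hηm hhd hdec
  have hatan : Tendsto (fun S : ℝ => deriv U 0 * (-Complex.I * ((2 * Real.arctan S : ℝ) : ℂ))) atTop
      (𝓝 (deriv U 0 * (-Complex.I * ((2 * (Real.pi / 2) : ℝ) : ℂ)))) := by
    refine Tendsto.const_mul _ (Tendsto.const_mul _ ?_)
    exact (Complex.continuous_ofReal.tendsto _).comp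
      ((Real.tendsto_arctan_atTop.mono_right nhdsWithin_le_nhds).const_mul 2)
  have hlim := ((hK.sub hatan).add (hq_lim.comp tendsto_ofReal_upperInfinity)).sub
    (hq_lim.comp tendsto_neg_ofReal_upperInfinity)
  have hval : (0 - deriv U 0 * (-Complex.I * ((2 * (Real.pi / 2) : ℝ) : ℂ)) + 0 - 0 : ℂ)
      = Complex.I * Real.pi * deriv U 0 := by
    push_cast; ring
  rw [hval] at hlim
  refine hlim.congr fun S => ?_
  have hDc : Continuous fun y : ℝ => D y := continuous_comp_ofReal hη hDd
  have hq'c : Continuous fun y : ℝ => deriv q y :=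
    continuous_comp_ofReal hη (hqd.deriv (isOpen_halfPlane η))
  have hIc : Continuous fun y : ℝ => deriv U 0 * ((y : ℂ) + Complex.I)⁻¹ :=
    continuous_const.mul (Continuous.inv₀ (by fun_prop) ofReal_add_I_ne_zero)
  -- Pointwise, `(U'(y) - U'(0))/y = D(y) + q'(y)`; the second summand contributes only `q(S) -
  -- q(-S) → 0`.
  have e1 : ∫ y in (-S)..S, dslope (deriv U) 0 y
      = ∫ y in (-S)..S, (h y - deriv U 0 * ((y : ℂ) + Complex.I)⁻¹ + deriv q y) := by
    refine intervalIntegral.integral_congr_ae ?_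
    filter_upwards [Measure.ae_ne volume (0 : ℝ)] with y hy _
    have hy' : (y : ℂ) ≠ 0 := by exact_mod_cast hy
    rw [dslope_of_ne _ hy', slope_def_field, deriv_eq_dslope_add hη hU (ofReal_mem_halfPlane hη y),
      ← hq]
    simp only [hh]
    rw [hD, dslope_of_ne _ hy', slope_def_field, hq0, sub_zero]
    field_simp
    ring
  have e2 : ∫ y in (-S)..S, deriv q y = q S - q (-S : ℝ) := by
    refine intervalIntegral.integral_eq_sub_of_hasDerivAt (f := fun y : ℝ => q y) (fun y _ => ?_)
      (hq'c.intervalIntegrable _ _)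
    exact ((hqd.differentiableAt
      (halfPlane_mem_nhds (ofReal_mem_halfPlane hη y))).hasDerivAt).comp_ofReal
  have hhc : Continuous fun y : ℝ => h y := hDc.add hIc
  rw [e1, intervalIntegral.integral_add (Continuous.intervalIntegrable (by exact hhc.sub hIc) _ _)
    (hq'c.intervalIntegrable _ _), intervalIntegral.integral_sub (hhc.intervalIntegrable _ _)
    (hIc.intervalIntegrable _ _), e2, intervalIntegral.integral_const_mul, integral_inv_add_I]
  simp only [Function.comp_apply]
  push_cast
  ring

/-- The same principal value, folded onto the half-line. -/
lemma tendsto_integral_symm_deriv {η : ℝ} (hη : 0 < η) {U : ℂ → ℂ}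
    (hU : DifferentiableOn ℂ U (halfPlane η))
    (hsub : Tendsto (fun z => U z / z) upperInfinity (𝓝 0)) :
    Tendsto (fun S : ℝ => ∫ s in (0 : ℝ)..S, (deriv U s - deriv U (-s)) / s) atTop
      (𝓝 (Complex.I * Real.pi * deriv U 0)) := by
  refine (tendsto_integral_dslope_deriv hη hU hsub).congr fun S => ?_
  have h0 : halfPlane η ∈ 𝓝 (0 : ℂ) := halfPlane_mem_nhds (by simpa using ofReal_mem_halfPlane hη 0)
  have hc : Continuous fun y : ℝ => dslope (deriv U) 0 y := continuous_comp_ofReal hη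
    ((Complex.differentiableOn_dslope h0).2 (hU.deriv (isOpen_halfPlane η)))
  have hcn : Continuous fun s : ℝ => dslope (deriv U) 0 (-s : ℝ) := hc.comp continuous_neg
  have e : ∫ y in (-S)..0, dslope (deriv U) 0 y = ∫ s in (0 : ℝ)..S, dslope (deriv U) 0 (-s : ℝ) := by
    rw [intervalIntegral.integral_comp_neg (fun y : ℝ => dslope (deriv U) 0 y), neg_zero]
  rw [← intervalIntegral.integral_add_adjacent_intervals (hc.intervalIntegrable _ 0)
    (hc.intervalIntegrable _ _), e, ← intervalIntegral.integral_add
    (hcn.intervalIntegrable _ _) (hc.intervalIntegrable _ _)]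
  refine intervalIntegral.integral_congr_ae ?_
  filter_upwards [Measure.ae_ne volume (0 : ℝ)] with s hs _
  have hs' : (s : ℂ) ≠ 0 := by exact_mod_cast hs
  rw [dslope_of_ne _ hs', dslope_of_ne _ (by push_cast; exact neg_ne_zero.2 hs'), slope_def_field,
    slope_def_field]
  push_cast
  rw [sub_zero, sub_zero, div_neg, ← sub_eq_neg_add, ← sub_div]
  congr 1
  ring

/-! ### Symmetric means -/

section Mean

variable {E : Type*} [NormedAddCommGroup E] [NormedSpace ℝ E]

/-- Twice the average of `p` over `[x - s, x + s]`. -/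
def mean (p : ℝ → E) (x s : ℝ) : E := ∫ τ in (-1 : ℝ)..1, p (x + s * τ)

lemma continuous_mean {p : ℝ → E} (hp : Continuous p) :
    Continuous fun q : ℝ × ℝ => mean p q.1 q.2 :=
  intervalIntegral.continuous_parametric_intervalIntegral_of_continuous'
    (f := fun (q : ℝ × ℝ) τ => p (q.1 + q.2 * τ)) (by fun_prop) _ _

/-- The symmetrised principal value integrand is thus an average of `g'`, jointly continuous in `(x,
s)` even at `s = 0`. This removes the singularity and makes Fubini and differentiation in `x`
harmless. -/
lemma mean_eq_slope [CompleteSpace E] {g g' : ℝ → E} (hg : ∀ y, HasDerivAt g (g' y) y)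
    (hg' : Continuous g') (x : ℝ) {s : ℝ} (hs : s ≠ 0) :
    mean g' x s = s⁻¹ • (g (x + s) - g (x - s)) := by
  have h : ∀ τ ∈ Set.uIcc (-1 : ℝ) 1,
      HasDerivAt (fun τ => s⁻¹ • g (x + s * τ)) (g' (x + s * τ)) τ := by
    intro τ _
    have h1 : HasDerivAt (fun τ : ℝ => x + s * τ) s τ := by
      simpa using ((hasDerivAt_id τ).const_mul s).const_add x
    have h2 := ((hg (x + s * τ)).scomp τ h1).const_smul s⁻¹
    rwa [smul_smul, inv_mul_cancel₀ hs, one_smul] at h2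
  rw [mean, intervalIntegral.integral_eq_sub_of_hasDerivAt h
    (Continuous.intervalIntegrable (by fun_prop) _ _), smul_sub]
  simp [sub_eq_add_neg]

lemma integral_mean [CompleteSpace E] {g g' : ℝ → E} (hg : ∀ y, HasDerivAt g (g' y) y)
    (hg' : Continuous g') (x a b : ℝ) :
    ∫ s in a..b, mean g' x s = ∫ s in a..b, s⁻¹ • (g (x + s) - g (x - s)) := by
  refine intervalIntegral.integral_congr_ae ?_
  filter_upwards [Measure.ae_ne volume (0 : ℝ)] with s hs _ using mean_eq_slope hg hg' x hs

lemma intervalIntegrable_symm [CompleteSpace E] {g g' : ℝ → E} (hg : ∀ y, HasDerivAt g (g' y) y)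
    (hg' : Continuous g') (x a b : ℝ) :
    IntervalIntegrable (fun s => s⁻¹ • (g (x + s) - g (x - s))) volume a b := by
  have hc : Continuous fun s => mean g' x s := (continuous_mean hg').comp (by fun_prop :
    Continuous fun s : ℝ => (x, s))
  refine (hc.intervalIntegrable a b).congr_ae (ae_restrict_of_ae ?_)
  filter_upwards [Measure.ae_ne volume (0 : ℝ)] with s hs using mean_eq_slope hg hg' x hs

end Mean

/-! ### Decomposition of the truncated Hilbert transform and convergence of its tails -/

instance truncationFilter_neBot : truncationFilter.NeBot := by
  unfold truncationFilter; infer_instance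

lemma HasHilbertTransformAt.hilbertTransform_eq {g : ℝ → ℝ} {x L : ℝ}
    (h : HasHilbertTransformAt g x L) : hilbertTransform g x = L := h.2.limUnder_eq

lemma intervalIntegrable_comp_div {g φ : ℝ → ℝ} (hg : Continuous g) (hφ : Continuous φ) {a b : ℝ}
    (ha : 0 < a) (hb : 0 < b) : IntervalIntegrable (fun s => g (φ s) / s) volume a b := by
  refine ContinuousOn.intervalIntegrable ((hg.comp hφ).continuousOn.div continuousOn_id ?_)
  intro s hs
  exact (lt_of_lt_of_le (lt_min ha hb) hs.1).ne'

lemma intervalIntegrable_div_sub {g : ℝ → ℝ} (hg : Continuous g) {x a b : ℝ}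
    (h : x ∉ Set.uIcc a b) : IntervalIntegrable (fun y => g y / (y - x)) volume a b := by
  refine ContinuousOn.intervalIntegrable (hg.continuousOn.div (by fun_prop) ?_)
  intro s hs h0
  exact h (sub_eq_zero.1 h0 ▸ hs)

/-- Cutting at distance `1` from `x` decouples the three parameters: each summand depends on only
one of `ε`, `a`, `b`. -/
lemma pi_mul_truncatedHilbert {g : ℝ → ℝ} (hg : Continuous g) {x ε a b : ℝ} (hε : 0 < ε)
    (ha : a ≤ x - 1) (hb : x + 1 ≤ b) :
    Real.pi * truncatedHilbert g x ε a b = (∫ s in ε..1, (g (x + s) - g (x - s)) / s)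
      - (∫ s in (1 : ℝ)..(x - a), g (x - s) / s) + ∫ s in (1 : ℝ)..(b - x), g (x + s) / s := by
  have e1 : ∫ y in (x + ε)..b, g y / (y - x) = ∫ s in ε..(b - x), g (x + s) / s := by
    have := intervalIntegral.integral_comp_add_left (a := ε) (b := b - x)
      (fun y => g y / (y - x)) x
    simpa using this.symm
  have e2 : ∫ y in a..(x - ε), g y / (y - x) = -∫ s in ε..(x - a), g (x - s) / s := by
    have := intervalIntegral.integral_comp_sub_left (a := ε) (b := x - a)
      (fun y => g y / (y - x)) x
    rw [← intervalIntegral.integral_neg]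
    simp only [sub_sub_cancel, sub_sub_cancel_left] at this
    rw [← this]
    refine intervalIntegral.integral_congr fun s _ => ?_
    rw [div_neg]
  have i1 : ∀ {a b : ℝ}, 0 < a → 0 < b → IntervalIntegrable (fun s => g (x + s) / s) volume a b :=
    fun ha hb => intervalIntegrable_comp_div hg (by fun_prop) ha hb
  have i2 : ∀ {a b : ℝ}, 0 < a → 0 < b → IntervalIntegrable (fun s => g (x - s) / s) volume a b :=
    fun ha hb => intervalIntegrable_comp_div hg (by fun_prop) ha hb
  rw [truncatedHilbert, e1, e2, ← mul_assoc, mul_one_div_cancel Real.pi_ne_zero, one_mul,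
    ← intervalIntegral.integral_add_adjacent_intervals (i1 hε one_pos) (i1 one_pos (by linarith)),
    ← intervalIntegral.integral_add_adjacent_intervals (i2 hε one_pos) (i2 one_pos (by linarith))]
  simp only [sub_div]
  rw [intervalIntegral.integral_sub (i1 hε one_pos) (i2 hε one_pos)]
  ring

lemma eventually_truncationFilter (x : ℝ) : ∀ᶠ p in truncationFilter,
    0 < p.1 ∧ p.2.1 ≤ x - 1 ∧ x + 1 ≤ p.2.2 := by
  have h1 : ∀ᶠ ε in 𝓝[>] (0 : ℝ), 0 < ε := self_mem_nhdsWithin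
  exact h1.prod_mk ((eventually_le_atBot (x - 1)).prod_mk (eventually_ge_atTop (x + 1)))

/-- `S ↦ (1/S, x - S, x + S)` is an admissible one-parameter family of truncations. -/
lemma tendsto_symm_truncationFilter (x : ℝ) :
    Tendsto (fun S : ℝ => (S⁻¹, x - S, x + S)) atTop truncationFilter := by
  refine tendsto_inv_atTop_nhdsGT_zero.prodMk (Tendsto.prodMk ?_ ?_)
  · exact tendsto_atBot_add_const_left _ x tendsto_neg_atTop_atBot
  · exact tendsto_atTop_add_const_left _ x tendsto_id

section Decomposition

variable {g g' : ℝ → ℝ} (hg : ∀ y, HasDerivAt g (g' y) y) (hg' : Continuous g') (x : ℝ)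

include hg hg'

lemma tendsto_integral_near :
    Tendsto (fun ε => ∫ s in ε..1, (g (x + s) - g (x - s)) / s) (𝓝 0)
      (𝓝 (∫ s in (0 : ℝ)..1, (g (x + s) - g (x - s)) / s)) := by
  have hi := fun a b => intervalIntegrable_symm hg hg' x a b
  have hc : Continuous fun ε => ∫ s in (1 : ℝ)..ε, s⁻¹ • (g (x + s) - g (x - s)) :=
    intervalIntegral.continuous_primitive hi 1
  have h := (hc.tendsto 0).neg
  rw [← intervalIntegral.integral_symm] at h
  simpa only [div_eq_inv_mul, smul_eq_mul, ← intervalIntegral.integral_symm] using h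

lemma integral_symm_split {S : ℝ} (hS : 0 < S) :
    (∫ s in (0 : ℝ)..S, (g (x + s) - g (x - s)) / s) =
      (∫ s in (0 : ℝ)..1, (g (x + s) - g (x - s)) / s)
      - (∫ s in (1 : ℝ)..S, g (x - s) / s) + ∫ s in (1 : ℝ)..S, g (x + s) / s := by
  have hgc : Continuous g := continuous_iff_continuousAt.2 fun y => (hg y).continuousAt
  have hi := fun a b => intervalIntegrable_symm hg hg' x a b
  simp only [smul_eq_mul, ← div_eq_inv_mul] at hi
  rw [← intervalIntegral.integral_add_adjacent_intervals (hi 0 1) (hi 1 S)]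
  have : ∫ s in (1 : ℝ)..S, (g (x + s) - g (x - s)) / s
      = (∫ s in (1 : ℝ)..S, g (x + s) / s) - ∫ s in (1 : ℝ)..S, g (x - s) / s := by
    simp only [sub_div]
    exact intervalIntegral.integral_sub
      (intervalIntegrable_comp_div hgc (by fun_prop) one_pos hS)
      (intervalIntegrable_comp_div hgc (by fun_prop) one_pos hS)
  rw [this]; ring

/-- If the one-sided tails converge, the Hilbert transform is the symmetric limit. -/
lemma hasHilbertTransformAt_of_symm {L Rr Rl : ℝ}
    (hr : Tendsto (fun b => ∫ s in (1 : ℝ)..b, g (x + s) / s) atTop (𝓝 Rr))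
    (hl : Tendsto (fun b => ∫ s in (1 : ℝ)..b, g (x - s) / s) atTop (𝓝 Rl))
    (hs : Tendsto (fun S => ∫ s in (0 : ℝ)..S, (g (x + s) - g (x - s)) / s) atTop
      (𝓝 (Real.pi * L))) : HasHilbertTransformAt g x L := by
  have hgc : Continuous g := continuous_iff_continuousAt.2 fun y => (hg y).continuousAt
  refine ⟨hgc.locallyIntegrable, ?_⟩
  set N := ∫ s in (0 : ℝ)..1, (g (x + s) - g (x - s)) / s
  have hval : Real.pi * L = N - Rl + Rr := by
    refine tendsto_nhds_unique hs ?_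
    refine ((tendsto_const_nhds.sub hl).add hr).congr' ?_
    filter_upwards [eventually_gt_atTop 0] with S hS using (integral_symm_split hg hg' x hS).symm
  have t1 : Tendsto (fun p : ℝ × ℝ × ℝ => ∫ s in p.1..1, (g (x + s) - g (x - s)) / s)
      truncationFilter (𝓝 N) :=
    ((tendsto_integral_near hg hg' x).mono_left nhdsWithin_le_nhds).comp tendsto_fst
  have t2 : Tendsto (fun p : ℝ × ℝ × ℝ => ∫ s in (1 : ℝ)..(x - p.2.1), g (x - s) / s)
      truncationFilter (𝓝 Rl) := by
    refine hl.comp (Tendsto.comp ?_ (tendsto_fst.comp tendsto_snd))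
    exact tendsto_atTop_add_const_left _ x tendsto_neg_atBot_atTop
  have t3 : Tendsto (fun p : ℝ × ℝ × ℝ => ∫ s in (1 : ℝ)..(p.2.2 - x), g (x + s) / s)
      truncationFilter (𝓝 Rr) := by
    have h1 : Tendsto (fun b : ℝ => b - x) atTop atTop :=
      tendsto_atTop_add_const_right _ (-x) tendsto_id
    exact hr.comp (h1.comp (tendsto_snd.comp tendsto_snd))
  have t := ((t1.sub t2).add t3).const_mul Real.pi⁻¹
  rw [← hval, inv_mul_cancel_left₀ Real.pi_ne_zero] at t
  refine t.congr' ?_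
  filter_upwards [eventually_truncationFilter x] with p hp
  rw [← pi_mul_truncatedHilbert hgc hp.1 hp.2.1 hp.2.2, inv_mul_cancel_left₀ Real.pi_ne_zero]

/-- The Hilbert transform is in particular a symmetric limit. -/
lemma HasHilbertTransformAt.tendsto_symm {L : ℝ} (h : HasHilbertTransformAt g x L) :
    Tendsto (fun S => ∫ s in (0 : ℝ)..S, (g (x + s) - g (x - s)) / s) atTop
      (𝓝 (Real.pi * L)) := by
  have hgc : Continuous g := continuous_iff_continuousAt.2 fun y => (hg y).continuousAt
  have h1 := (h.2.comp (tendsto_symm_truncationFilter x)).const_mul Real.pi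
  have h2 := (tendsto_integral_near hg hg' x).comp tendsto_inv_atTop_zero
  have h3 := (h1.sub h2).add_const (∫ s in (0 : ℝ)..1, (g (x + s) - g (x - s)) / s)
  rw [sub_add_cancel] at h3
  refine h3.congr' ?_
  filter_upwards [eventually_ge_atTop 1] with S hS
  have hS0 : 0 < S := by linarith
  simp only [Function.comp_apply]
  rw [pi_mul_truncatedHilbert hgc (inv_pos.2 hS0) (by linarith) (by linarith),
    integral_symm_split hg hg' x hS0]
  simp only [sub_sub_cancel, add_sub_cancel_left]
  ring

end Decomposition

section Tails

variable {g : ℝ → ℝ} (hg : Continuous g) {x L : ℝ}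

include hg

/-- Here the independence of the three limits is used. With `ε` and `a` frozen, the difference of
two truncations is exactly a piece of the right tail, so the tail is Cauchy. -/
lemma HasHilbertTransformAt.exists_tendsto_right (h : HasHilbertTransformAt g x L) :
    ∃ R, Tendsto (fun b => ∫ s in (1 : ℝ)..b, g (x + s) / s) atTop (𝓝 R) := by
  refine cauchy_map_iff_exists_tendsto.1 ?_
  rw [Metric.cauchy_iff]
  refine ⟨inferInstance, fun δ hδ => ?_⟩
  have h1 := (Metric.tendsto_nhds.1 h.2) (δ / (2 * Real.pi)) (by positivity)
  have h2 := h1.and (eventually_truncationFilter x)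
  -- Currying the product filter twice fixes one good `ε` and one good `a`, leaving a statement
  -- about all large `b`.
  obtain ⟨ε, hε⟩ := (Filter.Eventually.curry h2).exists
  obtain ⟨a, ha⟩ := (Filter.Eventually.curry hε).exists
  refine ⟨(fun b => ∫ s in (1 : ℝ)..b, g (x + s) / s) '' {b | dist (truncatedHilbert g x ε a (x + b)) L
    < δ / (2 * Real.pi) ∧ 0 < ε ∧ a ≤ x - 1 ∧ x + 1 ≤ x + b}, ?_, ?_⟩
  · exact image_mem_map ((tendsto_atTop_add_const_left _ x tendsto_id).eventually ha)
  · rintro _ ⟨b, ⟨hb, h0, ha1, hb1⟩, rfl⟩ _ ⟨b', ⟨hb', -, -, hb1'⟩, rfl⟩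
    have e := pi_mul_truncatedHilbert hg h0 ha1 hb1
    have e' := pi_mul_truncatedHilbert hg h0 ha1 hb1'
    rw [add_sub_cancel_left] at e e'
    have hd : dist (truncatedHilbert g x ε a (x + b)) (truncatedHilbert g x ε a (x + b'))
        < δ / Real.pi := by
      calc _ ≤ _ := dist_triangle_right _ _ L
        _ < δ / (2 * Real.pi) + δ / (2 * Real.pi) := add_lt_add hb hb'
        _ = δ / Real.pi := by field_simp; ring
    rw [Real.dist_eq, lt_div_iff₀ Real.pi_pos, mul_comm] at hd
    rw [Real.dist_eq]
    calc _ = |Real.pi * (truncatedHilbert g x ε a (x + b) - truncatedHilbert g x ε a (x + b'))| := by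
          rw [mul_sub, e, e']; congr 1; ring
      _ < δ := by rwa [abs_mul, abs_of_pos Real.pi_pos]

/-- The reflection exchanges the two ends of the truncation, so facts about the right tail carry
over to the left one. -/
lemma HasHilbertTransformAt.comp_neg (h : HasHilbertTransformAt g x L) :
    HasHilbertTransformAt (fun y => g (-y)) (-x) (-L) := by
  refine ⟨(hg.comp continuous_neg).locallyIntegrable, ?_⟩
  have hm : Tendsto (fun p : ℝ × ℝ × ℝ => (p.1, -p.2.2, -p.2.1)) truncationFilter
      truncationFilter :=
    tendsto_fst.prodMk ((tendsto_neg_atTop_atBot.comp (tendsto_snd.comp tendsto_snd)).prodMk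
      (tendsto_neg_atBot_atTop.comp (tendsto_fst.comp tendsto_snd)))
  refine (h.2.comp hm).neg.congr fun p => ?_
  have e : ∀ a b : ℝ, ∫ y in a..b, g (-y) / (y - -x) = -∫ y in (-b)..(-a), g y / (y - x) := by
    intro a b
    rw [← intervalIntegral.integral_comp_neg (fun y => g y / (y - x)),
      ← intervalIntegral.integral_neg]
    refine intervalIntegral.integral_congr fun y _ => ?_
    rw [show -y - x = -(y - -x) by ring, div_neg, neg_neg]
  simp only [Function.comp_apply, truncatedHilbert]
  rw [e, e, show -(-x - p.1) = x + p.1 by ring, show -(-x + p.1) = x - p.1 by ring]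
  ring

lemma HasHilbertTransformAt.exists_tendsto_left (h : HasHilbertTransformAt g x L) :
    ∃ R, Tendsto (fun b => ∫ s in (1 : ℝ)..b, g (x - s) / s) atTop (𝓝 R) := by
  obtain ⟨R, hR⟩ := (h.comp_neg hg).exists_tendsto_right (hg.comp continuous_neg)
  refine ⟨R, hR.congr fun b => ?_⟩
  simp only [Function.comp_apply, neg_add, neg_neg, sub_eq_add_neg]

lemma HasHilbertTransformAt.sub {k : ℝ → ℝ} (hk : Continuous k) {M : ℝ}
    (h : HasHilbertTransformAt g x L) (h' : HasHilbertTransformAt k x M) :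
    HasHilbertTransformAt (fun y => g y - k y) x (L - M) := by
  refine ⟨(hg.sub hk).locallyIntegrable, (h.2.sub h'.2).congr' ?_⟩
  filter_upwards [eventually_truncationFilter x] with p hp
  obtain ⟨hε, ha, hb⟩ := hp
  have n1 : x ∉ Set.uIcc p.2.1 (x - p.1) := fun hx => by
    have := le_max_iff.1 hx.2; rcases this with h | h <;> linarith
  have n2 : x ∉ Set.uIcc (x + p.1) p.2.2 := fun hx => by
    have := min_le_iff.1 hx.1; rcases this with h | h <;> linarith
  simp only [truncatedHilbert, sub_div]
  rw [intervalIntegral.integral_sub (intervalIntegrable_div_sub hg n1)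
    (intervalIntegrable_div_sub hk n1), intervalIntegral.integral_sub
    (intervalIntegrable_div_sub hg n2) (intervalIntegrable_div_sub hk n2)]
  ring

end Tails

/-! ### Hilbert transforms of boundary values of holomorphic functions -/

/-- The tail of the Hilbert transform of a derivative of a bounded function converges. -/
lemma exists_tendsto_tail {w w' : ℝ → ℝ} (hw : ∀ y, HasDerivAt w (w' y) y) (hw' : Continuous w')
    {C : ℝ} (hC : ∀ y, |w y| ≤ C) (x : ℝ) :
    ∃ R, Tendsto (fun b => ∫ s in (1 : ℝ)..b, w' (x + s) / s) atTop (𝓝 R) := by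
  have hwc : Continuous w := continuous_iff_continuousAt.2 fun y => (hw y).continuousAt
  have hInt : IntegrableOn (fun s => w (x + s) / s ^ 2) (Set.Ioi 1) := by
    have h1 : IntegrableOn (fun s : ℝ => C * s ^ (-2 : ℝ)) (Set.Ioi 1) :=
      (integrableOn_Ioi_rpow_of_lt (by norm_num) one_pos).const_mul C
    refine h1.mono' ?_ ?_
    · exact (ContinuousOn.div (by fun_prop) (by fun_prop) fun s hs =>
        (pow_pos (one_pos.trans hs) 2).ne').aestronglyMeasurable measurableSet_Ioi
    · refine (ae_restrict_mem measurableSet_Ioi).mono fun s hs => ?_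
      have hs0 : (0 : ℝ) < s := one_pos.trans hs
      rw [Real.norm_eq_abs, abs_div, abs_of_pos (pow_pos hs0 2), Real.rpow_neg hs0.le,
        Real.rpow_two, div_eq_mul_inv]
      exact mul_le_mul_of_nonneg_right (hC _) (by positivity)
  have t1 := intervalIntegral_tendsto_integral_Ioi 1 hInt tendsto_id
  have t2 : Tendsto (fun b : ℝ => w (x + b) * b⁻¹) atTop (𝓝 0) := by
    refine squeeze_zero_norm' ?_ (by simpa using tendsto_inv_atTop_zero.const_mul C)
    filter_upwards [eventually_gt_atTop 0] with b hb
    rw [norm_mul, Real.norm_eq_abs, Real.norm_eq_abs, abs_of_pos (inv_pos.2 hb)]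
    exact mul_le_mul_of_nonneg_right (hC _) (by positivity)
  refine ⟨_, ((t2.sub_const (w (x + 1))).add t1).congr' ?_⟩
  filter_upwards [eventually_ge_atTop 1] with b hb
  have hpos : ∀ s ∈ Set.uIcc 1 b, (0 : ℝ) < s := fun s hs => by
    rw [Set.uIcc_of_le hb] at hs; linarith [hs.1]
  -- Integration by parts moves the derivative to `1/s`, leaving the absolutely convergent `∫
  -- w(x+s)/s² ds`.
  have hparts := intervalIntegral.integral_mul_deriv_eq_deriv_mul (a := 1) (b := b)
    (u := fun s : ℝ => s⁻¹) (v := fun s => w (x + s)) (u' := fun s => -(s ^ 2)⁻¹)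
    (v' := fun s => w' (x + s)) (fun s hs => hasDerivAt_inv (hpos s hs).ne')
    (fun s _ => (hw (x + s)).comp_const_add x s) ?_
    (Continuous.intervalIntegrable (by fun_prop) _ _)
  · have e1 : ∫ s in (1 : ℝ)..b, w' (x + s) / s = ∫ s in (1 : ℝ)..b, s⁻¹ * w' (x + s) := by
      simp only [div_eq_inv_mul]
    rw [e1, hparts, id]
    simp only [neg_mul, intervalIntegral.integral_neg, div_eq_inv_mul]
    ring
  · refine ContinuousOn.intervalIntegrable (ContinuousOn.neg (ContinuousOn.inv₀ (by fun_prop) ?_))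
    intro s hs
    exact (pow_pos (hpos s hs) 2).ne'

lemma tendsto_comp_add_div_upperInfinity {U : ℂ → ℂ}
    (hsub : Tendsto (fun z => U z / z) upperInfinity (𝓝 0)) (x : ℝ) :
    Tendsto (fun z => U (x + z) / z) upperInfinity (𝓝 0) := by
  have hinf : Tendsto (fun z : ℂ => z) upperInfinity (Bornology.cobounded ℂ) :=
    tendsto_id.mono_left inf_le_left
  have hadd : Tendsto (fun z : ℂ => x + z) upperInfinity (Bornology.cobounded ℂ) :=
    (tendsto_const_add_cobounded (x : ℂ)).comp hinf
  have hadd' : Tendsto (fun z : ℂ => x + z) upperInfinity upperInfinity := by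
    refine tendsto_inf.2 ⟨hadd, tendsto_principal.2 ?_⟩
    have : ∀ᶠ z in upperInfinity, z ∈ {z : ℂ | 0 ≤ z.im} :=
      eventually_inf_principal.2 (Eventually.of_forall fun _ h => h)
    filter_upwards [this] with z hz
    simpa using hz
  have h1 : Tendsto (fun z : ℂ => U (x + z) / (x + z) * (1 + x * z⁻¹)) upperInfinity
      (𝓝 (0 * (1 + x * 0))) :=
    (hsub.comp hadd').mul (((tendsto_inv₀_cobounded.comp hinf).const_mul _).const_add 1)
  rw [zero_mul] at h1
  refine h1.congr' ?_
  filter_upwards [hinf.eventually (Bornology.eventually_ne_cobounded 0),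
    hadd.eventually (Bornology.eventually_ne_cobounded 0)] with z hz hz'
  field_simp
  ring

/-- Boundary values of holomorphic functions are eigenfunctions of the Hilbert transform: if
`U` is holomorphic near the closed upper half-plane with sublinear growth, and `Re U` is bounded on
the real line, then `H (Re U') = Re (i U')`. -/
lemma hasHilbertTransformAt_re_deriv {η : ℝ} (hη : 0 < η) {U : ℂ → ℂ}
    (hU : DifferentiableOn ℂ U (halfPlane η))
    (hsub : Tendsto (fun z => U z / z) upperInfinity (𝓝 0)) {C : ℝ}
    (hC : ∀ y : ℝ, |(U y).re| ≤ C) (x : ℝ) :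
    HasHilbertTransformAt (fun y => (deriv U y).re) x (-(deriv U x).im) := by
  have hU' := hU.deriv (isOpen_halfPlane η)
  have hU'' := hU'.deriv (isOpen_halfPlane η)
  have hder : ∀ {V : ℂ → ℂ}, DifferentiableOn ℂ V (halfPlane η) → ∀ y : ℝ,
      HasDerivAt (fun y : ℝ => V y) (deriv V y) y := fun hV y =>
    (hV.differentiableAt (halfPlane_mem_nhds (ofReal_mem_halfPlane hη y))).hasDerivAt.comp_ofReal
  have hre : ∀ {V : ℂ → ℂ}, DifferentiableOn ℂ V (halfPlane η) → ∀ y : ℝ,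
      HasDerivAt (fun y : ℝ => (V y).re) (deriv V y).re y := fun hV y =>
    Complex.reCLM.hasFDerivAt.comp_hasDerivAt y (hder hV y)
  have hc1 : Continuous fun y : ℝ => (deriv U y).re :=
    Complex.continuous_re.comp (continuous_comp_ofReal hη hU')
  have hc2 : Continuous fun y : ℝ => (deriv (deriv U) y).re :=
    Complex.continuous_re.comp (continuous_comp_ofReal hη hU'')
  obtain ⟨Rr, hr⟩ := exists_tendsto_tail (hre hU) hc1 hC x
  -- The left tail at `x` is the right tail at `-x` of the reflected function.
  obtain ⟨Rl, hl⟩ := exists_tendsto_tail (w := fun y => -(U (-y : ℝ)).re)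
    (w' := fun y => (deriv U (-y : ℝ)).re) (fun y => by
      exact ((hre hU (-y)).scomp y (hasDerivAt_neg y)).neg.congr_deriv (by simp))
    (hc1.comp continuous_neg) (fun y => by rw [abs_neg]; exact hC _) (-x)
  refine hasHilbertTransformAt_of_symm (hre hU') hc2 x hr (Rl := Rl) (hl.congr fun b => ?_) ?_
  · simp only [neg_add, neg_neg, sub_eq_add_neg]
  -- Translate `x` to the origin, where the contour argument was carried out. The factor `iπ` then
  -- turns into `-π Im` on taking real parts.
  · set V : ℂ → ℂ := fun z => U (x + z) with hV
    have hVd : DifferentiableOn ℂ V (halfPlane η) := by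
      refine hU.comp (by fun_prop) fun z hz => ?_
      simpa [halfPlane] using hz
    have hV' : ∀ z, deriv V z = deriv U (x + z) := fun z => deriv_comp_const_add U (x : ℂ) z
    have h1 := tendsto_integral_symm_deriv hη hVd (tendsto_comp_add_div_upperInfinity hsub x)
    have h2 := (Complex.continuous_re.tendsto _).comp h1
    have hval : (Complex.I * Real.pi * deriv V 0).re = Real.pi * -(deriv U x).im := by
      rw [hV', add_zero]; simp [Complex.mul_re]
    rw [hval] at h2
    refine h2.congr fun S => ?_
    have hi := intervalIntegrable_symm (hder hU') (continuous_comp_ofReal hη hU'') x 0 S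
    have := Complex.reCLM.intervalIntegral_comp_comm hi
    simp only [Function.comp_apply]
    calc _ = (∫ s in (0 : ℝ)..S, s⁻¹ • (deriv U (x + s : ℝ) - deriv U (x - s : ℝ))).re := by
          congr 1
          refine intervalIntegral.integral_congr fun s _ => ?_
          simp only [hV', Complex.real_smul]
          push_cast
          rw [div_eq_inv_mul, sub_eq_add_neg (x : ℂ)]
      _ = _ := this.symm
      _ = _ := by
          refine intervalIntegral.integral_congr fun s _ => ?_
          simp only [Complex.reCLM_apply, Complex.smul_re, smul_eq_mul, Complex.sub_re,
            div_eq_inv_mul]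

/-! ### Cauchy-type integrals with power kernels -/

/-- The Cauchy-type integral `∫ w(x) (x - z)⁻ⁿ dx`. -/
def cauchyPow (w : ℝ → ℂ) (n : ℕ) (z : ℂ) : ℂ := ∫ x : ℝ, w x / ((x : ℂ) - z) ^ n

lemma ofReal_sub_ne_zero {z : ℂ} (hz : 0 < z.im) (x : ℝ) : (x : ℂ) - z ≠ 0 := fun h => by
  have := congrArg Complex.im h
  simp at this
  exact hz.ne' this

lemma im_le_norm_ofReal_sub (z : ℂ) (x : ℝ) : z.im ≤ ‖(x : ℂ) - z‖ := by
  refine le_trans ?_ (Complex.abs_im_le_norm _)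
  simpa using le_abs_self z.im

/-- Locally uniformly in the upper half-plane, `|x - z|` is at least a multiple of `1 + |x|`. -/
lemma exists_mul_le_norm_ofReal_sub {z : ℂ} (hz : 0 < z.im) :
    ∃ c > 0, ∀ z' ∈ Metric.ball z (z.im / 2), ∀ x : ℝ, c * (1 + |x|) ≤ ‖(x : ℂ) - z'‖ := by
  set η := z.im / 2 with hη
  have hη0 : 0 < η := by positivity
  set A := 1 + (1 + ‖z‖ + η) / η with hA
  have hA0 : 0 < A := by positivity
  refine ⟨A⁻¹, by positivity, fun z' hz' x => ?_⟩
  have hd : ‖z' - z‖ < η := by simpa [dist_eq_norm] using hz'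
  have him : η ≤ z'.im := by
    have h1 : |(z' - z).im| < η := (Complex.abs_im_le_norm _).trans_lt hd
    rw [Complex.sub_im, abs_lt] at h1
    linarith [h1.1]
  have hn : ‖z'‖ ≤ ‖z‖ + η := by
    have := norm_add_le (z' - z) z
    rw [sub_add_cancel] at this
    linarith
  have hx : |x| ≤ ‖(x : ℂ) - z'‖ + ‖z'‖ := by
    have := norm_add_le ((x : ℂ) - z') z'
    rwa [sub_add_cancel, Complex.norm_real, Real.norm_eq_abs] at this
  have hlow : η ≤ ‖(x : ℂ) - z'‖ := him.trans (im_le_norm_ofReal_sub z' x)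
  rw [inv_mul_le_iff₀ hA0, hA]
  have h3 : (1 + ‖z‖ + η) ≤ (1 + ‖z‖ + η) / η * ‖(x : ℂ) - z'‖ := by
    rw [div_mul_eq_mul_div, le_div_iff₀ hη0]
    exact mul_le_mul_of_nonneg_left hlow (by positivity)
  nlinarith

section CauchyPow

variable {w : ℝ → ℂ} {n : ℕ}

lemma integrable_weight_succ (hm : AEStronglyMeasurable w)
    (hw : Integrable fun x => ‖w x‖ / (1 + |x|) ^ n) :
    Integrable fun x => ‖w x‖ / (1 + |x|) ^ (n + 1) := by
  refine hw.mono' ?_ (Eventually.of_forall fun x => ?_)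
  · exact (hm.norm.aemeasurable.div (by fun_prop : Measurable fun x : ℝ =>
      (1 + |x|) ^ (n + 1)).aemeasurable).aestronglyMeasurable
  · rw [Real.norm_of_nonneg (by positivity)]
    have : (1 : ℝ) ≤ 1 + |x| := by linarith [abs_nonneg x]
    gcongr
    omega

lemma norm_kernel_le {c : ℝ} (hc : 0 < c) {z : ℂ} (n : ℕ) {x : ℝ}
    (h : c * (1 + |x|) ≤ ‖(x : ℂ) - z‖) :
    ‖w x / ((x : ℂ) - z) ^ n‖ ≤ (c ^ n)⁻¹ * (‖w x‖ / (1 + |x|) ^ n) := by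
  rw [norm_div, norm_pow, inv_mul_eq_div, div_div, mul_comm ((1 + |x|) ^ n), ← mul_pow]
  gcongr

lemma aestronglyMeasurable_kernel (hm : AEStronglyMeasurable w) (n : ℕ) (z : ℂ) :
    AEStronglyMeasurable fun x : ℝ => w x / ((x : ℂ) - z) ^ n :=
  (hm.aemeasurable.div (by fun_prop : Measurable fun x : ℝ =>
    ((x : ℂ) - z) ^ n).aemeasurable).aestronglyMeasurable

lemma integrable_kernel (hm : AEStronglyMeasurable w)
    (hw : Integrable fun x => ‖w x‖ / (1 + |x|) ^ n) {z : ℂ} (hz : 0 < z.im) :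
    Integrable fun x : ℝ => w x / ((x : ℂ) - z) ^ n := by
  obtain ⟨c, hc, h⟩ := exists_mul_le_norm_ofReal_sub hz
  exact (hw.const_mul (c ^ n)⁻¹).mono' (aestronglyMeasurable_kernel hm n z)
    (Eventually.of_forall fun x =>
      norm_kernel_le hc n (h z (Metric.mem_ball_self (by positivity)) x))

lemma hasDerivAt_kernel {z : ℂ} {x : ℝ} (hxz : (x : ℂ) - z ≠ 0) (a : ℂ) (n : ℕ) :
    HasDerivAt (fun z => a / ((x : ℂ) - z) ^ n) (n * (a / ((x : ℂ) - z) ^ (n + 1))) z := by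
  have h1 : HasDerivAt (fun z => (x : ℂ) - z) (-1) z := (hasDerivAt_id z).const_sub _
  have h2 := ((h1.pow n).inv (pow_ne_zero n hxz)).const_mul a
  refine (h2.congr_deriv ?_).congr_of_eventuallyEq (Eventually.of_forall fun z => ?_)
  · rcases n with _ | n
    · simp
    · simp only [Nat.add_sub_cancel, Pi.pow_apply]
      field_simp
      ring
  · simp [div_eq_mul_inv]

/-- Differentiation under the integral raises the exponent. The dominating function comes from the
locally uniform lower bound on `|x - z|`. -/
lemma hasDerivAt_cauchyPow (hm : AEStronglyMeasurable w)
    (hw : Integrable fun x => ‖w x‖ / (1 + |x|) ^ n) {z : ℂ} (hz : 0 < z.im) :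
    HasDerivAt (cauchyPow w n) (n * cauchyPow w (n + 1) z) z := by
  obtain ⟨c, hc, h⟩ := exists_mul_le_norm_ofReal_sub hz
  have hw' := integrable_weight_succ hm hw
  have := (hasDerivAt_integral_of_dominated_loc_of_deriv_le (μ := volume)
    (F := fun z x => w x / ((x : ℂ) - z) ^ n)
    (F' := fun z x => n * (w x / ((x : ℂ) - z) ^ (n + 1)))
    (bound := fun x => n * ((c ^ (n + 1))⁻¹ * (‖w x‖ / (1 + |x|) ^ (n + 1))))
    (Metric.ball_mem_nhds z (by positivity : 0 < z.im / 2))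
    (Eventually.of_forall fun z => aestronglyMeasurable_kernel hm n z)
    (integrable_kernel hm hw hz)
    ((aestronglyMeasurable_kernel hm (n + 1) z).const_mul _)
    (Eventually.of_forall fun x z' hz' => ?_)
    ((hw'.const_mul _).const_mul _)
    (Eventually.of_forall fun x z' hz' => ?_)).2
  · rwa [integral_const_mul] at this
  · rw [norm_mul, Complex.norm_natCast]
    exact mul_le_mul_of_nonneg_left (norm_kernel_le hc _ (h z' hz' x)) (by positivity)
  · refine hasDerivAt_kernel (norm_pos_iff.1 (lt_of_lt_of_le ?_ (h z' hz' x))) _ n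
    positivity

end CauchyPow

/-! ### Half-line wave integrals -/

/-- The wave `e^{ics}` on the right half-line. -/
def halfWave (c : ℝ) : ℝ → ℂ := (Set.Ioi (0 : ℝ)).indicator fun s => Complex.exp (Complex.I * c * s)

lemma norm_exp_I_mul (c s : ℝ) : ‖Complex.exp (Complex.I * c * s)‖ = 1 := by
  rw [show Complex.I * c * s = ((c * s : ℝ) : ℂ) * Complex.I by push_cast; ring]
  exact Complex.norm_exp_ofReal_mul_I _

lemma norm_halfWave_le (c s : ℝ) : ‖halfWave c s‖ ≤ 1 := by
  unfold halfWave
  refine (norm_indicator_le_norm_self _ _).trans ?_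
  rw [norm_exp_I_mul]

lemma measurable_halfWave (c : ℝ) : AEStronglyMeasurable (halfWave c) :=
  (Continuous.aestronglyMeasurable (by fun_prop)).indicator measurableSet_Ioi

lemma integrable_one_add_abs_pow {n : ℕ} (hn : 2 ≤ n) :
    Integrable fun x : ℝ => 1 / (1 + |x|) ^ n := by
  have := integrable_one_add_norm (E := ℝ) (μ := volume) (r := n) (by
    simp only [Module.finrank_self]; exact_mod_cast hn)
  refine this.congr (Eventually.of_forall fun x => ?_)
  simp only [Real.norm_eq_abs]
  rw [Real.rpow_neg (by positivity), Real.rpow_natCast, one_div]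

lemma integrable_halfWave (c : ℝ) {n : ℕ} (hn : 2 ≤ n) :
    Integrable fun x => ‖halfWave c x‖ / (1 + |x|) ^ n := by
  refine (integrable_one_add_abs_pow hn).mono' ?_ (Eventually.of_forall fun x => ?_)
  · exact ((measurable_halfWave c).norm.aemeasurable.div (by fun_prop : Measurable fun x : ℝ =>
      (1 + |x|) ^ n).aemeasurable).aestronglyMeasurable
  · rw [Real.norm_of_nonneg (by positivity)]
    gcongr
    exact norm_halfWave_le c x

lemma cauchyPow_halfWave (c : ℝ) (n : ℕ) (z : ℂ) : cauchyPow (halfWave c) n z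
    = ∫ s in Set.Ioi (0 : ℝ), Complex.exp (Complex.I * c * s) / ((s : ℂ) - z) ^ n := by
  rw [cauchyPow, ← integral_indicator measurableSet_Ioi]
  congr 1
  ext s
  by_cases hs : s ∈ Set.Ioi (0 : ℝ) <;> simp [halfWave, hs]

lemma integrableOn_wave_kernel (c : ℝ) {n : ℕ} (hn : 2 ≤ n) {z : ℂ} (hz : 0 < z.im) :
    IntegrableOn (fun s : ℝ => Complex.exp (Complex.I * c * s) / ((s : ℂ) - z) ^ n)
      (Set.Ioi 0) := by
  rw [← integrable_indicator_iff measurableSet_Ioi]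
  refine (integrable_kernel (measurable_halfWave c) (integrable_halfWave c hn) hz).congr
    (Eventually.of_forall fun s => ?_)
  by_cases hs : s ∈ Set.Ioi (0 : ℝ) <;> simp [halfWave, hs]

lemma hasDerivAt_wave_kernel (c : ℝ) (n : ℕ) {z : ℂ} (hz : 0 < z.im) (s : ℝ) :
    HasDerivAt (fun s : ℝ => Complex.exp (Complex.I * c * s) / ((s : ℂ) - z) ^ n)
      (Complex.I * c * (Complex.exp (Complex.I * c * s) / ((s : ℂ) - z) ^ n)
        - n * (Complex.exp (Complex.I * c * s) / ((s : ℂ) - z) ^ (n + 1))) s := by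
  have hne := ofReal_sub_ne_zero hz s
  have h1 : HasDerivAt (fun s : ℂ => Complex.exp (Complex.I * c * s))
      (Complex.exp (Complex.I * c * s) * (Complex.I * c)) s := by
    simpa using ((hasDerivAt_id (s : ℂ)).const_mul (Complex.I * c)).cexp
  have h2 : HasDerivAt (fun s : ℂ => (s - z) ^ n) (n * ((s : ℂ) - z) ^ (n - 1)) s := by
    exact (((hasDerivAt_id (s : ℂ)).sub_const z).pow n).congr_deriv (by simp)
  have h3 := (h1.div h2 (pow_ne_zero n hne)).comp_ofReal
  refine h3.congr_deriv ?_
  rcases n with _ | n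
  · simp; ring
  · simp only [Nat.add_sub_cancel]
    field_simp
    ring

lemma tendsto_wave_kernel (c : ℝ) {n : ℕ} (hn : n ≠ 0) (z : ℂ) :
    Tendsto (fun s : ℝ => Complex.exp (Complex.I * c * s) / ((s : ℂ) - z) ^ n) atTop (𝓝 0) := by
  have h1 : Tendsto (fun s : ℝ => ‖(s : ℂ) - z‖) atTop atTop := by
    refine tendsto_norm_atTop_iff_cobounded.2 ?_
    have := (tendsto_sub_const_cobounded z).comp
      (tendsto_ofReal_upperInfinity.mono_right inf_le_left)
    exact this
  rw [tendsto_zero_iff_norm_tendsto_zero]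
  refine (tendsto_inv_atTop_zero.comp ((tendsto_pow_atTop hn).comp h1)).congr fun s => ?_
  simp [norm_exp_I_mul]

/-- Integration by parts for the half-line integrals of the wave. -/
lemma cauchyPow_halfWave_succ (c : ℝ) {n : ℕ} (hn : 2 ≤ n) {z : ℂ} (hz : 0 < z.im) :
    n * cauchyPow (halfWave c) (n + 1) z
      = Complex.I * c * cauchyPow (halfWave c) n z + 1 / (-z) ^ n := by
  have i1 := (integrableOn_wave_kernel c hn hz).const_mul (Complex.I * c)
  have i2 := (integrableOn_wave_kernel c (hn.trans n.le_succ) hz).const_mul (n : ℂ)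
  have h := integral_Ioi_of_hasDerivAt_of_tendsto' (a := (0 : ℝ))
    (fun s _ => hasDerivAt_wave_kernel c n hz s) (i1.sub i2) (tendsto_wave_kernel c (by omega) z)
  rw [integral_sub i1 i2, integral_const_mul, integral_const_mul, ← cauchyPow_halfWave,
    ← cauchyPow_halfWave] at h
  simp only [Complex.ofReal_zero, mul_zero, Complex.exp_zero, zero_sub] at h
  linear_combination -h

/-- Bound the integrand by `1/(1 + (s - Re z)²)`. The explicit value serves twice: it is at most
`π`, giving boundedness of the solution in the half-plane, and it tends to `0` as `Re z → -∞`,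
giving decay upstream. -/
lemma norm_cauchyPow_halfWave_le (c : ℝ) {z : ℂ} (hz : 1 ≤ z.im) :
    ‖cauchyPow (halfWave c) 2 z‖ ≤ Real.pi / 2 + Real.arctan z.re := by
  have hb : ∫ s in Set.Ioi (0 : ℝ), (1 + (s - z.re) ^ 2)⁻¹ = Real.pi / 2 + Real.arctan z.re := by
    have h1 := (measurePreserving_sub_right volume z.re).setIntegral_preimage_emb
      (measurableEmbedding_subRight z.re) (fun s : ℝ => (1 + s ^ 2)⁻¹) (Set.Ioi (0 - z.re))
    rw [Set.preimage_sub_const_Ioi, sub_add_cancel] at h1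
    rw [h1, zero_sub, integral_Ioi_inv_one_add_sq, Real.arctan_neg, sub_neg_eq_add]
  rw [cauchyPow_halfWave, ← hb]
  refine norm_integral_le_of_norm_le ?_ (Eventually.of_forall fun s => ?_)
  · exact (integrable_inv_one_add_sq.comp_sub_right z.re).integrableOn
  · rw [norm_div, norm_exp_I_mul, norm_pow, one_div]
    refine inv_anti₀ (by positivity) ?_
    rw [← Complex.normSq_eq_norm_sq, Complex.normSq_apply]
    simp only [Complex.sub_re, Complex.ofReal_re, Complex.sub_im, Complex.ofReal_im]
    nlinarith

/-! ### Holomorphic extensions of the forcing and of the solutions -/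

/-- The holomorphic function `(i/π)/(z + i)` whose real part on the line is the forcing. -/
def forcingExt (z : ℂ) : ℂ := Complex.I / Real.pi / (z + Complex.I)

/-- The holomorphic extension of the solution without incoming waves. -/
def particularExt (c : ℝ) (z : ℂ) : ℂ :=
  Complex.I / Real.pi * (1 / (z + Complex.I) + cauchyPow (halfWave c) 2 (z + Complex.I))

lemma add_I_ne_zero {z : ℂ} (hz : z ∈ halfPlane 1) : z + Complex.I ≠ 0 := fun h => by
  have h1 := congrArg Complex.im h
  have h2 : -1 < z.im := hz
  simp at h1
  linarith

lemma add_I_im_pos {z : ℂ} (hz : z ∈ halfPlane 1) : 0 < (z + Complex.I).im := by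
  have h2 : -1 < z.im := hz
  simp
  linarith

/-- This is the integrodifferential equation in holomorphic form. By parts, `1/z + ∫₀^∞
e^{ics}/(s-z)² ds` is formally `ic ∫₀^∞ e^{ics}/(s-z) ds`; the squared kernel is used because it
converges absolutely. The derivative of `1/(z+i)` cancels the boundary term of
`cauchyPow_halfWave_succ`. -/
lemma hasDerivAt_particularExt (c : ℝ) {z : ℂ} (hz : z ∈ halfPlane 1) :
    HasDerivAt (particularExt c) (Complex.I * c * (particularExt c z - forcingExt z)) z := by
  have hne := add_I_ne_zero hz
  have h1 : HasDerivAt (fun z : ℂ => z + Complex.I) 1 z := (hasDerivAt_id z).add_const _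
  have h2 := (hasDerivAt_cauchyPow (measurable_halfWave c) (integrable_halfWave c le_rfl)
    (add_I_im_pos hz)).comp z h1
  have h3 := ((h1.inv hne).add h2).const_mul (Complex.I / Real.pi)
  refine (h3.congr_deriv ?_).congr_of_eventuallyEq (Eventually.of_forall fun z => ?_)
  · rw [cauchyPow_halfWave_succ c le_rfl (add_I_im_pos hz), particularExt, forcingExt]
    have : (Real.pi : ℂ) ≠ 0 := by exact_mod_cast Real.pi_ne_zero
    field_simp
    ring
  · simp [particularExt]

lemma hasDerivAt_forcingExt {z : ℂ} (hz : z ∈ halfPlane 1) :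
    HasDerivAt forcingExt (-(Complex.I / Real.pi) / (z + Complex.I) ^ 2) z := by
  have hne := add_I_ne_zero hz
  have h1 : HasDerivAt (fun z : ℂ => z + Complex.I) 1 z := (hasDerivAt_id z).add_const _
  have h3 := (h1.inv hne).const_mul (Complex.I / Real.pi)
  refine (h3.congr_deriv ?_).congr_of_eventuallyEq (Eventually.of_forall fun z => ?_)
  · ring
  · simp [forcingExt, div_eq_mul_inv]

lemma norm_add_I_ge {z : ℂ} (hz : 0 ≤ z.im) : 1 ≤ ‖z + Complex.I‖ := by
  refine le_trans ?_ (Complex.abs_im_le_norm _)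
  refine le_trans ?_ (le_abs_self _)
  simp [hz]

lemma norm_I_div_pi : ‖Complex.I / (Real.pi : ℂ)‖ = 1 / Real.pi := by
  simp [abs_of_pos Real.pi_pos]

lemma norm_forcingExt_le {z : ℂ} (hz : 0 ≤ z.im) : ‖forcingExt z‖ ≤ 1 / Real.pi := by
  rw [forcingExt, norm_div, norm_I_div_pi]
  exact div_le_self (by positivity) (norm_add_I_ge hz)

lemma norm_particularExt_le (c : ℝ) {z : ℂ} (hz : 0 ≤ z.im) :
    ‖particularExt c z‖ ≤ 1 / Real.pi * (‖z + Complex.I‖⁻¹ + (Real.pi / 2 + Real.arctan z.re)) := by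
  rw [particularExt, norm_mul, norm_I_div_pi]
  refine mul_le_mul_of_nonneg_left ((norm_add_le _ _).trans (add_le_add (by simp) ?_))
    (by positivity)
  simpa using norm_cauchyPow_halfWave_le c (z := z + Complex.I) (by simpa using hz)

lemma forcingExt_ofReal (x : ℝ) : forcingExt x = ((1 / (Real.pi * (x ^ 2 + 1)) : ℝ) : ℂ)
    + ((x / (Real.pi * (x ^ 2 + 1)) : ℝ) : ℂ) * Complex.I := by
  have hne := ofReal_add_I_ne_zero x
  have hp : (Real.pi : ℂ) ≠ 0 := by exact_mod_cast Real.pi_ne_zero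
  have hx : ((x : ℂ) ^ 2 + 1) ≠ 0 := by
    have : (x ^ 2 + 1 : ℝ) ≠ 0 := by positivity
    exact_mod_cast this
  rw [forcingExt]
  push_cast
  field_simp
  ring_nf
  simp

lemma re_forcingExt (x : ℝ) : (forcingExt x).re = forcing x := by
  rw [forcingExt_ofReal, Complex.add_re, Complex.re_ofReal_mul, Complex.ofReal_re, Complex.I_re,
    mul_zero, add_zero, forcing]

lemma im_forcingExt (x : ℝ) : (forcingExt x).im = x / (Real.pi * (x ^ 2 + 1)) := by
  rw [forcingExt_ofReal, Complex.add_im, Complex.im_ofReal_mul, Complex.ofReal_im, Complex.I_im,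
    mul_one, zero_add]

lemma tendsto_div_upperInfinity_of_bounded {U : ℂ → ℂ} {C : ℝ}
    (hC : ∀ z : ℂ, 0 ≤ z.im → ‖U z‖ ≤ C) :
    Tendsto (fun z => U z / z) upperInfinity (𝓝 0) := by
  have hinf : Tendsto (fun z : ℂ => z) upperInfinity (Bornology.cobounded ℂ) :=
    tendsto_id.mono_left inf_le_left
  have h1 : Tendsto (fun z : ℂ => C * ‖z⁻¹‖) upperInfinity (𝓝 0) := by
    simpa using ((tendsto_inv₀_cobounded.comp hinf).norm).const_mul C
  refine squeeze_zero_norm' ?_ h1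
  have : ∀ᶠ z in upperInfinity, z ∈ {z : ℂ | 0 ≤ z.im} :=
    eventually_inf_principal.2 (Eventually.of_forall fun _ h => h)
  filter_upwards [this] with z hz
  rw [div_eq_mul_inv, norm_mul]
  exact mul_le_mul_of_nonneg_right (hC z hz) (norm_nonneg _)

/-- Derivatives of bounded holomorphic functions on the closed upper half-plane. -/
lemma hasHilbertTransformAt_of_bounded {η : ℝ} (hη : 0 < η) {U : ℂ → ℂ}
    (hU : DifferentiableOn ℂ U (halfPlane η)) {C : ℝ} (hC : ∀ z : ℂ, 0 ≤ z.im → ‖U z‖ ≤ C) (x : ℝ) :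
    HasHilbertTransformAt (fun y => (deriv U y).re) x (-(deriv U x).im) :=
  hasHilbertTransformAt_re_deriv hη hU (tendsto_div_upperInfinity_of_bounded hC)
    (fun y => (Complex.abs_re_le_norm _).trans (hC y (by simp))) x

lemma hasDerivAt_re_ofReal {U : ℂ → ℂ} {U' : ℂ} {x : ℝ} (h : HasDerivAt U U' x) :
    HasDerivAt (fun y : ℝ => (U y).re) U'.re x :=
  Complex.reCLM.hasFDerivAt.comp_hasDerivAt x h.comp_ofReal

lemma hasDerivAt_im_ofReal {U : ℂ → ℂ} {U' : ℂ} {x : ℝ} (h : HasDerivAt U U' x) :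
    HasDerivAt (fun y : ℝ => (U y).im) U'.im x :=
  Complex.imCLM.hasFDerivAt.comp_hasDerivAt x h.comp_ofReal

lemma ofReal_mem_halfPlane_one (x : ℝ) : (x : ℂ) ∈ halfPlane 1 := ofReal_mem_halfPlane one_pos x

lemma differentiableOn_forcingExt : DifferentiableOn ℂ forcingExt (halfPlane 1) :=
  fun _ hz => (hasDerivAt_forcingExt hz).differentiableAt.differentiableWithinAt

lemma deriv_forcing : deriv forcing = fun y : ℝ => (deriv forcingExt y).re := by
  ext x
  have h := hasDerivAt_re_ofReal
    (hasDerivAt_forcingExt (ofReal_mem_halfPlane_one x)).differentiableAt.hasDerivAt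
  rw [show (fun y : ℝ => (forcingExt y).re) = forcing from funext re_forcingExt] at h
  exact h.deriv

lemma hasHilbertTransformAt_deriv_forcing (x : ℝ) :
    HasHilbertTransformAt (deriv forcing) x (-(deriv forcingExt x).im) := by
  rw [deriv_forcing]
  exact hasHilbertTransformAt_of_bounded one_pos differentiableOn_forcingExt
    (fun _ hz => norm_forcingExt_le hz) x

/-- A holomorphic primitive of `forcingExt`. -/
def forcingPrimitive (z : ℂ) : ℂ := Complex.I / Real.pi * Complex.log (z + Complex.I)

lemma hasDerivAt_forcingPrimitive {z : ℂ} (hz : z ∈ halfPlane 1) :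
    HasDerivAt forcingPrimitive (forcingExt z) z := by
  have h1 : HasDerivAt (fun z : ℂ => z + Complex.I) 1 z := (hasDerivAt_id z).add_const _
  have h2 := (h1.clog (Complex.mem_slitPlane_iff.2 (Or.inr (add_I_im_pos hz).ne'))).const_mul
    (Complex.I / Real.pi)
  exact h2.congr_deriv (by rw [forcingExt]; ring)

lemma tendsto_forcingPrimitive_div :
    Tendsto (fun z => forcingPrimitive z / z) upperInfinity (𝓝 0) := by
  have hinf : Tendsto (fun z : ℂ => z) upperInfinity (Bornology.cobounded ℂ) :=
    tendsto_id.mono_left inf_le_left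
  have hadd : Tendsto (fun z : ℂ => z + Complex.I) upperInfinity (Bornology.cobounded ℂ) :=
    (tendsto_add_const_cobounded Complex.I).comp hinf
  have hn := tendsto_norm_atTop_iff_cobounded.2 hadd
  have hlog : Tendsto (fun r : ℝ => (Real.log r + Real.pi) / r) atTop (𝓝 0) := by
    have h1 : Tendsto (fun r : ℝ => Real.log r / r) atTop (𝓝 0) :=
      Real.isLittleO_log_id_atTop.tendsto_div_nhds_zero
    have h2 := h1.add (tendsto_inv_atTop_zero.const_mul Real.pi)
    rw [mul_zero, add_zero] at h2
    exact h2.congr fun r => by ring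
  have h1 : Tendsto (fun z : ℂ => forcingPrimitive z / (z + Complex.I)) upperInfinity (𝓝 0) := by
    have h2 := (hlog.comp hn).const_mul (1 / Real.pi)
    rw [mul_zero] at h2
    refine squeeze_zero_norm' ?_ h2
    filter_upwards [hn.eventually (eventually_ge_atTop 1)] with z hz
    rw [forcingPrimitive, norm_div, norm_mul, norm_I_div_pi, Function.comp_apply, ← mul_div_assoc]
    gcongr
    refine (Complex.norm_le_abs_re_add_abs_im _).trans (add_le_add ?_ ?_)
    · rw [Complex.log_re, abs_of_nonneg (Real.log_nonneg hz)]
    · rw [Complex.log_im]; exact Complex.abs_arg_le_pi _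
  have h3 := h1.mul (((tendsto_inv₀_cobounded.comp hinf).const_mul Complex.I).const_add 1)
  rw [zero_mul] at h3
  refine h3.congr' ?_
  filter_upwards [hinf.eventually (Bornology.eventually_ne_cobounded 0),
    hadd.eventually (Bornology.eventually_ne_cobounded 0)] with z hz hz'
  simp only [Function.comp_apply]
  field_simp

/-- The forcing is the real part of the derivative of `(i/π) log(z+i)`. This primitive is unbounded,
but it is sublinear and its real part on the line, `-arg(x+i)/π`, is bounded by `1`. -/
lemma hasHilbertTransformAt_forcing (x : ℝ) :
    HasHilbertTransformAt forcing x (-x / (Real.pi * (x ^ 2 + 1))) := by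
  have hd : ∀ y : ℝ, deriv forcingPrimitive y = forcingExt y := fun y =>
    (hasDerivAt_forcingPrimitive (ofReal_mem_halfPlane_one y)).deriv
  have h := hasHilbertTransformAt_re_deriv one_pos
    (fun z hz => (hasDerivAt_forcingPrimitive hz).differentiableAt.differentiableWithinAt)
    tendsto_forcingPrimitive_div (C := 1) (fun y => ?_) x
  · simpa only [hd, re_forcingExt, im_forcingExt, neg_div] using h
  · have e : (forcingPrimitive y).re = -((y : ℂ) + Complex.I).arg / Real.pi := by
      rw [forcingPrimitive, show Complex.I / (Real.pi : ℂ) = ((1 / Real.pi : ℝ) : ℂ) * Complex.I by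
        push_cast; ring, mul_assoc, Complex.re_ofReal_mul, Complex.I_mul_re, Complex.log_im]
      ring
    rw [e, abs_div, abs_neg, abs_of_pos Real.pi_pos]
    exact div_le_one_of_le₀ (Complex.abs_arg_le_pi _) Real.pi_pos.le

/-- The holomorphic extension of the general solution. -/
def solutionExt (c : ℝ) (A z : ℂ) : ℂ := particularExt c z + A * Complex.exp (Complex.I * c * z)

/-- The general solution on the real line. -/
def solution (c : ℝ) (A : ℂ) (x : ℝ) : ℝ := (solutionExt c A x).re

section Solution

variable (c : ℝ) (A : ℂ)

lemma hasDerivAt_solutionExt {z : ℂ} (hz : z ∈ halfPlane 1) :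
    HasDerivAt (solutionExt c A) (Complex.I * c * (solutionExt c A z - forcingExt z)) z := by
  have h1 : HasDerivAt (fun z : ℂ => Complex.exp (Complex.I * c * z))
      (Complex.exp (Complex.I * c * z) * (Complex.I * c)) z := by
    simpa using ((hasDerivAt_id z).const_mul (Complex.I * c)).cexp
  refine ((hasDerivAt_particularExt c hz).add (h1.const_mul A)).congr_deriv ?_
  rw [solutionExt]
  ring

lemma differentiableOn_solutionExt : DifferentiableOn ℂ (solutionExt c A) (halfPlane 1) :=
  fun _ hz => (hasDerivAt_solutionExt c A hz).differentiableAt.differentiableWithinAt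

/-- The sign of `c` matters: `|e^{icz}| = e^{-c Im z}` is at most `1` in the upper half-plane. -/
lemma exists_norm_solutionExt_le {c : ℝ} (hc : 0 ≤ c) (A : ℂ) :
    ∃ C, ∀ z : ℂ, 0 ≤ z.im → ‖solutionExt c A z‖ ≤ C := by
  refine ⟨1 / Real.pi * (1 + (Real.pi / 2 + Real.pi / 2)) + ‖A‖ * 1, fun z hz => ?_⟩
  refine (norm_add_le _ _).trans (add_le_add ((norm_particularExt_le c hz).trans ?_) ?_)
  · gcongr
    · exact inv_le_one_of_one_le₀ (norm_add_I_ge hz)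
    · exact (Real.arctan_lt_pi_div_two _).le
  · rw [norm_mul, Complex.norm_exp]
    gcongr
    rw [Real.exp_le_one_iff]
    simp only [Complex.mul_re, Complex.I_re, Complex.ofReal_re, zero_mul, Complex.I_im,
      Complex.ofReal_im, mul_zero, sub_self, Complex.mul_im, one_mul, zero_add, zero_sub]
    nlinarith

lemma deriv_solutionExt (x : ℝ) :
    deriv (solutionExt c A) x = Complex.I * c * (solutionExt c A x - forcingExt x) :=
  (hasDerivAt_solutionExt c A (ofReal_mem_halfPlane_one x)).deriv

lemma hasDerivAt_solution (x : ℝ) :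
    HasDerivAt (solution c A) (deriv (solutionExt c A) x).re x :=
  hasDerivAt_re_ofReal
    (hasDerivAt_solutionExt c A (ofReal_mem_halfPlane_one x)).differentiableAt.hasDerivAt

lemma deriv_solution : deriv (solution c A) = fun x : ℝ => (deriv (solutionExt c A) x).re :=
  funext fun x => (hasDerivAt_solution c A x).deriv

lemma contDiff_solution : ContDiff ℝ 2 (solution c A) := by
  have h1 : ContDiffOn ℝ 2 (solutionExt c A) (halfPlane 1) :=
    ((differentiableOn_solutionExt c A).contDiffOn (isOpen_halfPlane 1)).restrict_scalars ℝ
  have h2 : ContDiff ℝ 2 fun x : ℝ => solutionExt c A x := by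
    rw [← contDiffOn_univ]
    exact h1.comp Complex.ofRealCLM.contDiff.contDiffOn fun x _ => ofReal_mem_halfPlane_one x
  exact Complex.reCLM.contDiff.comp h2

/-- From `U' = ic(U - Φ)` one has `u' = -c Im(U - Φ)`; differentiating once more brings back `Re(U -
Φ)`. The remaining `Im Φ'` is `-H f'`. -/
lemma hasDerivAt_deriv_solution (x : ℝ) : HasDerivAt (deriv (solution c A))
    (-c * (c * (solution c A x - forcing x) - (deriv forcingExt x).im)) x := by
  have h1 := hasDerivAt_im_ofReal
    (hasDerivAt_solutionExt c A (ofReal_mem_halfPlane_one x))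
  have h2 := hasDerivAt_im_ofReal
    (hasDerivAt_forcingExt (ofReal_mem_halfPlane_one x)).differentiableAt.hasDerivAt
  have h3 := (h1.sub h2).const_mul (-c)
  refine (h3.congr_deriv ?_).congr_of_eventuallyEq (Eventually.of_forall fun y => ?_)
  · simp [Complex.mul_im, solution, re_forcingExt]
  · simp [deriv_solution, deriv_solutionExt, Complex.mul_re]

lemma hasHilbertTransformAt_deriv_solution {c : ℝ} (hc : 0 ≤ c) (A : ℂ) (x : ℝ) :
    HasHilbertTransformAt (deriv (solution c A)) x (-c * (solution c A x - forcing x)) := by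
  obtain ⟨C, hC⟩ := exists_norm_solutionExt_le hc A
  have h := hasHilbertTransformAt_of_bounded one_pos (differentiableOn_solutionExt c A) hC x
  rw [← deriv_solution, deriv_solutionExt] at h
  convert h using 1
  simp [Complex.mul_im, solution, re_forcingExt]

end Solution

lemma solvesIntegrodifferential_solution {F : ℝ} (hF : 0 < F) (A : ℂ) :
    SolvesIntegrodifferential F (solution (1 / F ^ 2) A) := by
  intro x
  have h := hasHilbertTransformAt_deriv_solution (c := 1 / F ^ 2) (by positivity) A x
  refine ⟨⟨_, h⟩, ?_⟩
  rw [h.hilbertTransform_eq]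
  field_simp
  ring

lemma solvesODE_solution {F : ℝ} (hF : 0 < F) (A : ℂ) : SolvesODE F (solution (1 / F ^ 2) A) := by
  intro x
  rw [(hasDerivAt_deriv_solution _ A x).deriv,
    (hasHilbertTransformAt_deriv_forcing x).hilbertTransform_eq]
  field_simp
  ring

lemma re_mul_exp (c : ℝ) (A : ℂ) (x : ℝ) : (A * Complex.exp (Complex.I * c * x)).re
    = A.re * Real.cos (c * x) - A.im * Real.sin (c * x) := by
  rw [show Complex.I * c * x = ((c * x : ℝ) : ℂ) * Complex.I by push_cast; ring, Complex.mul_re,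
    Complex.exp_ofReal_mul_I_re, Complex.exp_ofReal_mul_I_im]

lemma solution_eq (c : ℝ) (A : ℂ) (x : ℝ) : solution c A x
    = solution c 0 x + (A.re * Real.cos (c * x) - A.im * Real.sin (c * x)) := by
  rw [← re_mul_exp]
  simp [solution, solutionExt]

/-! ### The differential equation and the condition at `-∞` -/

/-- Solutions of `w'' = -c² w` are trigonometric. -/
lemma exists_eq_trig {c : ℝ} (hc : c ≠ 0) {w w' : ℝ → ℝ} (hw : ∀ x, HasDerivAt w (w' x) x)
    (hw' : ∀ x, HasDerivAt w' (-c ^ 2 * w x) x) :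
    ∃ A : ℂ, ∀ x, w x = A.re * Real.cos (c * x) - A.im * Real.sin (c * x) := by
  have hcos : ∀ x, HasDerivAt (fun x => Real.cos (c * x)) (-Real.sin (c * x) * c) x := fun x => by
    simpa using ((hasDerivAt_id x).const_mul c).cos
  have hsin : ∀ x, HasDerivAt (fun x => Real.sin (c * x)) (Real.cos (c * x) * c) x := fun x => by
    simpa using ((hasDerivAt_id x).const_mul c).sin
  -- `p` and `q` are the coordinates of `(w, w'/c)` in the rotating frame, hence conserved;
  -- inverting the rotation recovers `w`.
  set p : ℝ → ℝ := fun x => w x * Real.cos (c * x) - w' x / c * Real.sin (c * x) with hp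
  set q : ℝ → ℝ := fun x => w x * Real.sin (c * x) + w' x / c * Real.cos (c * x) with hq
  have hp' : ∀ x, HasDerivAt p 0 x := fun x => by
    refine (((hw x).mul (hcos x)).sub (((hw' x).div_const c).mul (hsin x))).congr_deriv ?_
    field_simp
    ring
  have hq' : ∀ x, HasDerivAt q 0 x := fun x => by
    refine (((hw x).mul (hsin x)).add (((hw' x).div_const c).mul (hcos x))).congr_deriv ?_
    field_simp
    ring
  have hpc : ∀ x, p x = p 0 := fun x => is_const_of_deriv_eq_zero
    (fun x => (hp' x).differentiableAt) (fun x => (hp' x).deriv) x 0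
  have hqc : ∀ x, q x = q 0 := fun x => is_const_of_deriv_eq_zero
    (fun x => (hq' x).differentiableAt) (fun x => (hq' x).deriv) x 0
  refine ⟨⟨p 0, -q 0⟩, fun x => ?_⟩
  rw [← hpc x, ← hqc x]
  simp only [hp, hq]
  linear_combination (-w x) * Real.cos_sq_add_sin_sq (c * x)

lemma hasDerivAt_of_contDiff_two {u : ℝ → ℝ} (hu : ContDiff ℝ 2 u) :
    (∀ x, HasDerivAt u (deriv u x) x) ∧ (∀ x, HasDerivAt (deriv u) (deriv (deriv u) x) x) ∧
      Continuous (deriv (deriv u)) := by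
  have h1 : ContDiff ℝ (1 + 1) u := by simpa [one_add_one_eq_two] using hu
  have h2 := (contDiff_succ_iff_deriv.1 h1)
  have h3 : ContDiff ℝ 1 (deriv u) := h2.2.2
  exact ⟨fun x => (h2.1 x).hasDerivAt, fun x => (h3.differentiable one_ne_zero x).hasDerivAt,
    h3.continuous_deriv le_rfl⟩

lemma SolvesODE.exists_eq_solution {F : ℝ} (hF : 0 < F) {u : ℝ → ℝ} (hu : ContDiff ℝ 2 u)
    (h : SolvesODE F u) : ∃ A, u = solution (1 / F ^ 2) A := by
  set c := 1 / F ^ 2 with hc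
  have hc0 : c ≠ 0 := by positivity
  obtain ⟨d1, d2, -⟩ := hasDerivAt_of_contDiff_two hu
  obtain ⟨A, hA⟩ := exists_eq_trig hc0 (w := fun x => u x - solution c 0 x)
    (w' := fun x => deriv u x - deriv (solution c 0) x)
    (fun x => (d1 x).sub (hasDerivAt_solution c 0 x).differentiableAt.hasDerivAt) (fun x => by
      refine ((d2 x).sub (hasDerivAt_deriv_solution c 0 x)).congr_deriv ?_
      have e1 := h x
      have e2 := solvesODE_solution hF 0 x
      rw [(hasDerivAt_deriv_solution _ 0 x).deriv, ← hc] at e2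
      have hF4 : c ^ 2 * F ^ 4 = 1 := by rw [hc]; field_simp
      linear_combination c ^ 2 * (e1 - e2) - hF4 * (deriv (deriv u) x
        - (-c * (c * (solution c 0 x - forcing x) - (deriv forcingExt x).im))))
  refine ⟨A, funext fun x => ?_⟩
  rw [solution_eq, ← hA]
  ring

lemma tendsto_solution_zero_atBot (c : ℝ) : Tendsto (solution c 0) atBot (𝓝 0) := by
  have h1 : Tendsto (fun x : ℝ => ‖(x : ℂ) + Complex.I‖⁻¹) atBot (𝓝 0) := by
    refine tendsto_inv_atTop_zero.comp (tendsto_atTop_mono (fun x => ?_) tendsto_abs_atBot_atTop)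
    calc |x| = |((x : ℂ) + Complex.I).re| := by simp
      _ ≤ _ := Complex.abs_re_le_norm _
  have h2 : Tendsto (fun x : ℝ => Real.pi / 2 + Real.arctan x) atBot (𝓝 0) := by
    simpa using (Real.tendsto_arctan_atBot.mono_right nhdsWithin_le_nhds).const_add (Real.pi / 2)
  have h3 := (h1.add h2).const_mul (1 / Real.pi)
  rw [add_zero, mul_zero] at h3
  refine squeeze_zero_norm (fun x => ?_) h3
  have h4 := norm_particularExt_le c (z := (x : ℂ)) (by simp)
  rw [Complex.ofReal_re] at h4
  refine le_trans ?_ h4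
  simp only [solution, solutionExt, zero_mul, add_zero, Real.norm_eq_abs]
  exact Complex.abs_re_le_norm _

/-- A nonzero wave does not vanish at `-∞`. -/
lemma eq_zero_of_tendsto_solution {c : ℝ} (hc : 0 < c) {A : ℂ}
    (h : Tendsto (solution c A) atBot (𝓝 0)) : A = 0 := by
  have h1 : Tendsto (fun x => A.re * Real.cos (c * x) - A.im * Real.sin (c * x)) atBot (𝓝 0) := by
    have := h.sub (tendsto_solution_zero_atBot c)
    rw [sub_zero] at this
    refine this.congr fun x => ?_
    rw [solution_eq c A]
    ring
  -- Sampling at points one period apart makes the wave constant along a sequence going to `-∞`, so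
  -- its value at every phase `a` is `0`.
  have hx : ∀ a : ℝ, Tendsto (fun k : ℕ => (a - k * (2 * Real.pi)) / c) atTop atBot := by
    intro a
    refine Tendsto.atBot_div_const hc (tendsto_atBot_add_const_left _ a
      (tendsto_neg_atTop_atBot.comp ?_))
    exact tendsto_natCast_atTop_atTop.atTop_mul_const (by positivity)
  have hval : ∀ a : ℝ, A.re * Real.cos a - A.im * Real.sin a = 0 := by
    intro a
    refine tendsto_nhds_unique ?_ (h1.comp (hx a))
    refine tendsto_const_nhds.congr fun k => ?_
    simp only [Function.comp_apply]
    rw [mul_div_cancel₀ _ hc.ne', Real.cos_sub_nat_mul_two_pi, Real.sin_sub_nat_mul_two_pi]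
  apply Complex.ext
  · simpa using hval 0
  · simpa using hval (Real.pi / 2)

/-! ### Integral representations of the causal solution -/

/-- The kernel with exponent `1` is only conditionally integrable; one integration by parts
expresses the improper integral through the absolutely convergent one with exponent `2`. -/
lemma tendsto_wave_integral {c : ℝ} (hc : 0 < c) (x : ℝ) :
    Tendsto (fun b : ℝ => ∫ s in (0 : ℝ)..b,
      Complex.exp (Complex.I * c * s) / ((s : ℂ) - (x + Complex.I)) ^ 1) atTop
      (𝓝 ((Complex.I * c)⁻¹ * (cauchyPow (halfWave c) 2 (x + Complex.I)
        + 1 / (x + Complex.I)))) := by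
  set z : ℂ := x + Complex.I with hzdef
  have hz : 0 < z.im := by simp [hzdef]
  have hne : z ≠ 0 := ofReal_add_I_ne_zero x
  have t1 := intervalIntegral_tendsto_integral_Ioi 0 (integrableOn_wave_kernel c le_rfl hz)
    tendsto_id
  rw [← cauchyPow_halfWave] at t1
  have t2 := ((t1.add ((tendsto_wave_kernel c one_ne_zero z).add_const (1 / z)))).const_mul
    (Complex.I * c)⁻¹
  rw [zero_add] at t2
  refine t2.congr fun b => ?_
  have hcont : ∀ n : ℕ, Continuous fun s : ℝ =>
      Complex.exp (Complex.I * c * s) / ((s : ℂ) - z) ^ n := fun n =>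
    Continuous.div (by fun_prop) (by fun_prop) fun s => pow_ne_zero n (ofReal_sub_ne_zero hz s)
  have i1 : IntervalIntegrable (fun s : ℝ => Complex.I * c *
      (Complex.exp (Complex.I * c * s) / ((s : ℂ) - z) ^ 1)) volume 0 b :=
    (continuous_const.mul (hcont 1)).intervalIntegrable _ _
  have i2 : IntervalIntegrable (fun s : ℝ => ((1 : ℕ) : ℂ) *
      (Complex.exp (Complex.I * c * s) / ((s : ℂ) - z) ^ (1 + 1))) volume 0 b :=
    (continuous_const.mul (hcont 2)).intervalIntegrable _ _
  have h := intervalIntegral.integral_eq_sub_of_hasDerivAt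
    (fun s _ => hasDerivAt_wave_kernel c 1 hz s) (i1.sub i2)
  rw [intervalIntegral.integral_sub i1 i2, intervalIntegral.integral_const_mul,
    intervalIntegral.integral_const_mul] at h
  simp only [Complex.ofReal_zero, mul_zero, Complex.exp_zero, zero_sub, pow_one, Nat.cast_one,
    one_mul, div_neg, sub_neg_eq_add, Nat.reduceAdd] at h
  have hIc : Complex.I * (c : ℂ) ≠ 0 :=
    mul_ne_zero Complex.I_ne_zero (by exact_mod_cast hc.ne')
  simp only [id, pow_one]
  rw [inv_mul_eq_iff_eq_mul₀ hIc]
  linear_combination -h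

lemma re_wave_kernel (c x s : ℝ) :
    (-(Complex.exp (Complex.I * c * s) / ((s : ℂ) - (x + Complex.I)) ^ 1)).re
      = Real.sin (c * s) * (1 / ((x - s) ^ 2 + 1))
        + Real.cos (c * s) * ((x - s) / ((x - s) ^ 2 + 1)) := by
  have h1 : (-(Complex.exp (Complex.I * c * s) / ((s : ℂ) - (x + Complex.I)) ^ 1))
      = Complex.exp (Complex.I * c * s) * (((x - s : ℝ) : ℂ) + Complex.I)⁻¹ := by
    rw [pow_one, ← div_neg, div_eq_mul_inv]
    congr 2
    push_cast
    ring
  rw [h1, show Complex.I * c * s = ((c * s : ℝ) : ℂ) * Complex.I by push_cast; ring, Complex.mul_re,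
    Complex.exp_ofReal_mul_I_re, Complex.exp_ofReal_mul_I_im, Complex.inv_re, Complex.inv_im,
    Complex.normSq_apply]
  simp only [Complex.add_re, Complex.ofReal_re, Complex.I_re, add_zero, Complex.add_im,
    Complex.ofReal_im, Complex.I_im, zero_add, mul_one]
  ring

/-- The causal solution as a convergent improper integral over the upstream half-line. -/
lemma tendsto_integral_solution {F : ℝ} (hF : 0 < F) (x : ℝ) : Tendsto
    (fun b : ℝ => (1 / (Real.pi * F ^ 2)) * ∫ s in (0 : ℝ)..b,
      (Real.sin (s / F ^ 2) * (1 / ((x - s) ^ 2 + 1))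
        + Real.cos (s / F ^ 2) * ((x - s) / ((x - s) ^ 2 + 1))))
    atTop (𝓝 (solution (1 / F ^ 2) 0 x)) := by
  set c := 1 / F ^ 2 with hc
  have hc0 : 0 < c := by positivity
  have h1 := (Complex.continuous_re.tendsto _).comp
    ((tendsto_wave_integral hc0 x).const_mul (-(c / Real.pi : ℂ)))
  have hval : (-(c / Real.pi : ℂ) * ((Complex.I * c)⁻¹ * (cauchyPow (halfWave c) 2 (x + Complex.I)
        + 1 / (x + Complex.I)))) = solutionExt c 0 x := by
    have hcc : (c : ℂ) ≠ 0 := by exact_mod_cast hc0.ne'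
    have hp : (Real.pi : ℂ) ≠ 0 := by exact_mod_cast Real.pi_ne_zero
    rw [solutionExt, particularExt, mul_inv, Complex.inv_I]
    field_simp
    ring
  rw [hval] at h1
  refine h1.congr fun b => ?_
  have hcont : Continuous fun s : ℝ =>
      -(Complex.exp (Complex.I * c * s) / ((s : ℂ) - (x + Complex.I)) ^ 1) :=
    (Continuous.div (by fun_prop) (by fun_prop) fun s =>
      pow_ne_zero 1 (ofReal_sub_ne_zero (by simp) s)).neg
  have hre := Complex.reCLM.intervalIntegral_comp_comm (hcont.intervalIntegrable (μ := volume) 0 b)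
  simp only [Complex.reCLM_apply, re_wave_kernel] at hre
  have e : ∀ s : ℝ, s / F ^ 2 = c * s := fun s => by rw [hc]; ring
  simp only [e, hre, Function.comp_apply]
  rw [intervalIntegral.integral_neg, show (-(c / Real.pi : ℂ)) = ((-(c / Real.pi) : ℝ) : ℂ) by
    push_cast; ring, Complex.re_ofReal_mul, Complex.neg_re, hc]
  field_simp

/-- The causal solution in terms of the forcing and its Hilbert transform. -/
lemma tendsto_integral_forcing_solution {F : ℝ} (hF : 0 < F) (x : ℝ) : Tendsto
    (fun a : ℝ => (1 / F ^ 2) * ∫ t in a..x,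
      (Real.sin ((x - t) / F ^ 2) * forcing t
        - Real.cos ((x - t) / F ^ 2) * hilbertTransform forcing t))
    atBot (𝓝 (solution (1 / F ^ 2) 0 x)) := by
  have hsub : Tendsto (fun a : ℝ => x - a) atBot atTop :=
    tendsto_atTop_add_const_left _ x tendsto_neg_atBot_atTop
  refine ((tendsto_integral_solution hF x).comp hsub).congr fun a => ?_
  have h := intervalIntegral.integral_comp_sub_left (a := (0 : ℝ)) (b := x - a)
    (fun t => Real.sin ((x - t) / F ^ 2) * forcing t
        - Real.cos ((x - t) / F ^ 2) * hilbertTransform forcing t) x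
  rw [sub_zero, sub_sub_cancel] at h
  simp only [Function.comp_apply]
  rw [← h, one_div_mul_eq_div, one_div_mul_eq_div, mul_comm Real.pi, ← div_div, div_right_comm,
    ← intervalIntegral.integral_div]
  congr 1
  refine intervalIntegral.integral_congr fun s _ => ?_
  simp only [sub_sub_cancel, (hasHilbertTransformAt_forcing _).hilbertTransform_eq, forcing]
  have hp := Real.pi_ne_zero
  have hx : (x - s) ^ 2 + 1 ≠ 0 := by positivity
  field_simp
  ring

/-! ### Growth estimates from convergence of the tails -/

lemma exists_bound_of_tendsto {f : ℝ → ℝ} (hf : Continuous f) {R : ℝ}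
    (h : Tendsto f atTop (𝓝 R)) : ∃ B, 0 ≤ B ∧ ∀ y, 1 ≤ y → |f y| ≤ B := by
  have h1 : ∀ᶠ y in atTop, |f y| ≤ |R| + 1 :=
    (h.abs.eventually (gt_mem_nhds (lt_add_one |R|))).mono fun _ h => h.le
  obtain ⟨X, hX⟩ := eventually_atTop.1 h1
  obtain ⟨M, hM⟩ := (isCompact_Icc (a := (1 : ℝ)) (b := X)).exists_bound_of_continuousOn
    hf.continuousOn
  refine ⟨max M (|R| + 1), le_max_of_le_right (by positivity), fun y hy => ?_⟩
  rcases le_total y X with hyX | hyX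
  · exact (hM y ⟨hy, hyX⟩).trans (le_max_left _ _)
  · exact (hX y hyX).trans (le_max_right _ _)

lemma norm_integral_le_of_norm_le_div_sq {E : Type*} [NormedAddCommGroup E] [NormedSpace ℝ E]
    {f : ℝ → E} {B S : ℝ} (hB : 0 ≤ B) (hS : 1 ≤ S)
    (hf : ∀ s, 1 ≤ s → ‖f s‖ ≤ B * (s ^ 2)⁻¹) : ‖∫ s in (1 : ℝ)..S, f s‖ ≤ B := by
  have hpos : ∀ s ∈ Set.uIcc 1 S, (0 : ℝ) < s := fun s hs => by
    rw [Set.uIcc_of_le hS] at hs; linarith [hs.1]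
  have hInt : IntervalIntegrable (fun s : ℝ => (s ^ 2)⁻¹) volume 1 S :=
    ContinuousOn.intervalIntegrable (ContinuousOn.inv₀ (by fun_prop) fun s hs =>
      (pow_pos (hpos s hs) 2).ne')
  have hval : ∫ s in (1 : ℝ)..S, (s ^ 2)⁻¹ = 1 - S⁻¹ := by
    have := intervalIntegral.integral_eq_sub_of_hasDerivAt (f := fun s : ℝ => -s⁻¹)
      (f' := fun s => (s ^ 2)⁻¹) (a := 1) (b := S)
      (fun s hs => (hasDerivAt_inv (hpos s hs).ne').neg.congr_deriv (neg_neg _)) hInt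
    rw [this]; norm_num; ring
  have h1 := intervalIntegral.norm_integral_le_of_norm_le (g := fun s => B * (s ^ 2)⁻¹) hS
    (Eventually.of_forall fun s hs => hf s hs.1.le) (hInt.const_mul B)
  refine h1.trans ?_
  rw [intervalIntegral.integral_const_mul, hval]
  have : 0 ≤ S⁻¹ := by positivity
  nlinarith

lemma continuous_div_max {g : ℝ → ℝ} (hg : Continuous g) : Continuous fun s => g s / max s 1 :=
  hg.div (by fun_prop) fun s => (lt_of_lt_of_le one_pos (le_max_right s 1)).ne'

lemma integral_div_max (g : ℝ → ℝ) {b : ℝ} (hb : 1 ≤ b) :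
    ∫ s in (1 : ℝ)..b, g s / max s 1 = ∫ s in (1 : ℝ)..b, g s / s := by
  refine intervalIntegral.integral_congr fun s hs => ?_
  rw [Set.uIcc_of_le hb] at hs
  rw [max_eq_left hs.1]

lemma tendsto_integral_div_max {g : ℝ → ℝ} {R : ℝ}
    (hR : Tendsto (fun b => ∫ s in (1 : ℝ)..b, g s / s) atTop (𝓝 R)) :
    Tendsto (fun b => ∫ s in (1 : ℝ)..b, g s / max s 1) atTop (𝓝 R) := by
  refine hR.congr' ?_
  filter_upwards [eventually_ge_atTop 1] with b hb using (integral_div_max g hb).symm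

section OneSided

variable {g : ℝ → ℝ} (hg : Continuous g) {R : ℝ}
  (hR : Tendsto (fun b => ∫ s in (1 : ℝ)..b, g s / s) atTop (𝓝 R))

include hg hR

/-- Abel summation: the multiplier `u/(u + ei)` that replaces `1/u` by `1/(u + ei)` is bounded with
integrable derivative. The sign `e = -1` serves the other end of the line after reflection. -/
lemma exists_norm_integral_div_add_I_le : ∃ B, ∀ e : ℝ, |e| = 1 → ∀ y, 1 ≤ y →
    ‖∫ u in (1 : ℝ)..y, (g u : ℂ) / (u + e * Complex.I)‖ ≤ B := by
  -- The `max` only makes the integrand continuous on all of `ℝ`; on `[1, ∞)` it is `g s / s`.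
  set q : ℝ → ℝ := fun s => g s / max s 1 with hq
  have hqc : Continuous q := continuous_div_max hg
  set r : ℝ → ℝ := fun b => ∫ s in (1 : ℝ)..b, q s with hr
  have hrd : ∀ b, HasDerivAt r (q b) b := fun b => (hqc.integral_hasStrictDerivAt 1 b).hasDerivAt
  have hrc : Continuous r := continuous_iff_continuousAt.2 fun b => (hrd b).continuousAt
  obtain ⟨B, hB0, hB⟩ := exists_bound_of_tendsto hrc (tendsto_integral_div_max hR)
  refine ⟨B + B, fun e he y hy => ?_⟩
  have hlow : ∀ u : ℝ, |u| ≤ ‖(u : ℂ) + e * Complex.I‖ := fun u => by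
    calc |u| = |((u : ℂ) + e * Complex.I).re| := by simp
      _ ≤ _ := Complex.abs_re_le_norm _
  have hpos : ∀ s ∈ Set.uIcc 1 y, (1 : ℝ) ≤ s := fun s hs => by
    rw [Set.uIcc_of_le hy] at hs; exact hs.1
  have hne : ∀ u : ℝ, (u : ℂ) + e * Complex.I ≠ 0 := fun u h => by
    have := congrArg Complex.im h
    simp at this
    simp [this] at he
  have hm : ∀ u : ℝ, HasDerivAt (fun u : ℝ => (u : ℂ) / (u + e * Complex.I))
      (e * Complex.I / (u + e * Complex.I) ^ 2) u := fun u => by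
    have h1 := (hasDerivAt_id (u : ℂ)).div ((hasDerivAt_id (u : ℂ)).add_const (e * Complex.I))
      (hne u)
    exact h1.comp_ofReal.congr_deriv (by simp)
  have hparts := intervalIntegral.integral_mul_deriv_eq_deriv_mul (a := 1) (b := y)
    (fun u _ => hm u) (fun u _ => (hrd u).ofReal_comp)
    (Continuous.intervalIntegrable (Continuous.div (by fun_prop) (by fun_prop) fun u =>
      pow_ne_zero 2 (hne u)) _ _)
    (Continuous.intervalIntegrable (by fun_prop) _ _)
  have e1 : ∫ u in (1 : ℝ)..y, (g u : ℂ) / (u + e * Complex.I)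
      = ∫ u in (1 : ℝ)..y, (u : ℂ) / (u + e * Complex.I) * (q u : ℂ) := by
    refine intervalIntegral.integral_congr fun u hu => ?_
    have hu1 := hpos u hu
    have hu0 : (u : ℂ) ≠ 0 := by exact_mod_cast (by linarith : u ≠ 0)
    simp only [hq, max_eq_left hu1]
    push_cast
    field_simp
  have hr1 : r 1 = 0 := intervalIntegral.integral_same
  have hmle : ‖(y : ℂ) / (y + e * Complex.I)‖ ≤ 1 := by
    rw [norm_div, Complex.norm_real, Real.norm_eq_abs]
    exact div_le_one_of_le₀ (hlow y) (norm_nonneg _)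
  rw [e1, hparts, hr1, Complex.ofReal_zero, mul_zero, sub_zero]
  refine (norm_sub_le _ _).trans (add_le_add ?_ ?_)
  · rw [norm_mul, Complex.norm_real, Real.norm_eq_abs]
    calc _ ≤ 1 * B := mul_le_mul hmle (hB y hy) (abs_nonneg _) zero_le_one
      _ = B := one_mul B
  · refine norm_integral_le_of_norm_le_div_sq hB0 hy fun s hs => ?_
    rw [norm_mul, norm_div, norm_mul, Complex.norm_I, Complex.norm_real, Complex.norm_real,
      Real.norm_eq_abs, Real.norm_eq_abs, he, mul_one, norm_pow, one_div, mul_comm]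
    have h2 : s ≤ ‖(s : ℂ) + e * Complex.I‖ := (le_abs_self s).trans (hlow s)
    gcongr
    exact hB s hs

/-- Kronecker's lemma. If `r → 0` is a primitive of `g(s)/s` near infinity, then `∫₁ˣ g = x r(x) -
r(1) - ∫₁ˣ r`; after division by `x`, the last term is a Cesàro mean of `r`. -/
lemma tendsto_div_atTop_of_tail {w : ℝ → ℝ} (hw : ∀ y, HasDerivAt w (g y) y) :
    Tendsto (fun x => w x / x) atTop (𝓝 0) := by
  set q : ℝ → ℝ := fun s => g s / max s 1 with hq
  have hqc : Continuous q := continuous_div_max hg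
  set r : ℝ → ℝ := fun b => (∫ s in (1 : ℝ)..b, q s) - R with hr
  have hrd : ∀ b, HasDerivAt r (q b) b := fun b =>
    (hqc.integral_hasStrictDerivAt 1 b).hasDerivAt.sub_const R
  have hrc : Continuous r := continuous_iff_continuousAt.2 fun b => (hrd b).continuousAt
  have hr0 : Tendsto r atTop (𝓝 0) := by
    simpa using (tendsto_integral_div_max hR).sub_const R
  have hces : Tendsto (fun x => (∫ s in (1 : ℝ)..x, r s) / x) atTop (𝓝 0) := by
    rw [Metric.tendsto_nhds]
    intro ε hε
    have h1 : ∀ᶠ y in atTop, |r y| ≤ ε / 4 := by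
      have := (Metric.tendsto_nhds.1 hr0) (ε / 4) (by positivity)
      exact this.mono fun y hy => by simpa [Real.dist_eq] using hy.le
    obtain ⟨X, hX⟩ := eventually_atTop.1 h1
    have h2 : Tendsto (fun x : ℝ => |∫ s in (1 : ℝ)..X, r s| / x) atTop (𝓝 0) :=
      tendsto_const_nhds.div_atTop tendsto_id
    filter_upwards [eventually_ge_atTop X, eventually_gt_atTop 0, eventually_ge_atTop (-X),
      h2.eventually (gt_mem_nhds (by positivity : 0 < ε / 4))] with x hx hx0 hxX hlt
    rw [dist_zero_right, norm_div, Real.norm_eq_abs, Real.norm_eq_abs, abs_of_pos hx0,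
      div_lt_iff₀ hx0]
    rw [div_lt_iff₀ hx0] at hlt
    rw [← intervalIntegral.integral_add_adjacent_intervals (hrc.intervalIntegrable 1 X)
      (hrc.intervalIntegrable X x)]
    have h3 := intervalIntegral.norm_integral_le_of_norm_le_const (a := X) (b := x) (C := ε / 4)
      (f := r) (fun s hs => by
        rw [Set.uIoc_of_le hx] at hs
        exact hX s hs.1.le)
    rw [Real.norm_eq_abs, abs_of_nonneg (by linarith : 0 ≤ x - X)] at h3
    have h4 := abs_add_le (∫ s in (1 : ℝ)..X, r s) (∫ s in X..x, r s)
    nlinarith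
  have hlim := ((tendsto_const_nhds (x := w 1 - r 1)).div_atTop tendsto_id).add (hr0.sub hces)
  rw [sub_zero, add_zero] at hlim
  refine hlim.congr' ?_
  filter_upwards [eventually_ge_atTop 1] with x hx
  have hparts := intervalIntegral.integral_mul_deriv_eq_deriv_mul (a := 1) (b := x)
    (fun u _ => hasDerivAt_id u) (fun u _ => hrd u)
    (Continuous.intervalIntegrable (by fun_prop) _ _) (hqc.intervalIntegrable _ _)
  have e1 : ∫ u in (1 : ℝ)..x, id u * q u = ∫ u in (1 : ℝ)..x, g u := by
    refine intervalIntegral.integral_congr fun u hu => ?_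
    rw [Set.uIcc_of_le hx] at hu
    have hu0 : u ≠ 0 := by linarith [hu.1]
    simp only [hq, max_eq_left hu.1, id]
    field_simp
  have e2 := intervalIntegral.integral_eq_sub_of_hasDerivAt (a := 1) (b := x) (fun y _ => hw y)
    (hg.intervalIntegrable _ _)
  rw [e1, e2] at hparts
  simp only [id, one_mul] at hparts
  have hx0 : x ≠ 0 := by linarith
  simp only [id]
  field_simp
  linear_combination -hparts

end OneSided

section TwoSided

variable {g : ℝ → ℝ} (hg : Continuous g) {R R' : ℝ}
  (hR : Tendsto (fun b => ∫ s in (1 : ℝ)..b, g s / s) atTop (𝓝 R))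
  (hR' : Tendsto (fun b => ∫ s in (1 : ℝ)..b, g (-s) / s) atTop (𝓝 R'))

include hg hR hR'

/-- The weight `1/(u + i)` replaces `1/u` so that a single bounded primitive is available on the
whole line, with no singularity at `0`. It is the input for tail bounds at a moving centre. -/
lemma exists_norm_primitive_le :
    ∃ B, 0 ≤ B ∧ ∀ y, ‖∫ u in (0 : ℝ)..y, (g u : ℂ) / (u + Complex.I)‖ ≤ B := by
  have hc : Continuous fun u : ℝ => (g u : ℂ) / (u + Complex.I) :=
    Continuous.div (by fun_prop) (by fun_prop) ofReal_add_I_ne_zero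
  have hi := fun a b => hc.intervalIntegrable (μ := volume) a b
  have hσ : Continuous fun y => ∫ u in (0 : ℝ)..y, (g u : ℂ) / (u + Complex.I) :=
    intervalIntegral.continuous_primitive hi 0
  obtain ⟨M, hM⟩ := (isCompact_Icc (a := (-1 : ℝ)) (b := 1)).exists_bound_of_continuousOn
    hσ.continuousOn
  obtain ⟨B, hB⟩ := exists_norm_integral_div_add_I_le hg hR
  obtain ⟨B', hB'⟩ := exists_norm_integral_div_add_I_le (hg.comp continuous_neg) hR'
  have hM0 : 0 ≤ M := (norm_nonneg _).trans (hM 0 (by norm_num))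
  refine ⟨M + |B| + |B'|, by positivity, fun y => ?_⟩
  rcases le_total 1 y with hy | hy
  · rw [← intervalIntegral.integral_add_adjacent_intervals (hi 0 1) (hi 1 y)]
    have h1 := hM 1 (by norm_num)
    have h2 := hB 1 abs_one y hy
    rw [Complex.ofReal_one, one_mul] at h2
    refine (norm_add_le _ _).trans ?_
    linarith [le_abs_self B, abs_nonneg B']
  rcases le_total y (-1) with hy' | hy'
  · rw [← intervalIntegral.integral_add_adjacent_intervals (hi 0 (-1)) (hi (-1) y)]
    have h1 := hM (-1) (by norm_num)
    have h2 := hB' (-1) (by norm_num) (-y) (by linarith)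
    have e : ∫ u in (-1 : ℝ)..y, (g u : ℂ) / (u + Complex.I) = ∫ u in (1 : ℝ)..(-y),
        (((g ∘ fun a => -a) u : ℝ) : ℂ) / (u + ((-1 : ℝ) : ℂ) * Complex.I) := by
      have h3 := intervalIntegral.integral_comp_neg (a := 1) (b := -y)
        (fun u : ℝ => (g u : ℂ) / (u + Complex.I))
      rw [neg_neg] at h3
      rw [intervalIntegral.integral_symm, ← h3, ← intervalIntegral.integral_neg]
      refine intervalIntegral.integral_congr fun u _ => ?_
      simp only [Function.comp_apply]
      push_cast
      rw [← div_neg]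
      congr 1
      ring
    rw [e]
    refine (norm_add_le _ _).trans ?_
    linarith [le_abs_self B', abs_nonneg B]
  · have h1 := hM y ⟨hy', hy⟩
    linarith [abs_nonneg B', abs_nonneg B]

/-- Linear bound for the tails of the Hilbert transform, uniform in the truncation. -/
lemma exists_norm_integral_tail_le :
    ∃ C, 0 ≤ C ∧ ∀ t S, 1 ≤ S → |∫ s in (1 : ℝ)..S, g (t + s) / s| ≤ C * (1 + |t|) := by
  have hc : Continuous fun u : ℝ => (g u : ℂ) / (u + Complex.I) :=
    Continuous.div (by fun_prop) (by fun_prop) ofReal_add_I_ne_zero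
  obtain ⟨B, hB0, hB⟩ := exists_norm_primitive_le hg hR hR'
  set σ : ℝ → ℂ := fun y => ∫ u in (0 : ℝ)..y, (g u : ℂ) / (u + Complex.I) with hσ
  have hσd : ∀ y, HasDerivAt σ ((g y : ℂ) / (y + Complex.I)) y := fun y =>
    (hc.integral_hasStrictDerivAt 0 y).hasDerivAt
  refine ⟨5 * B, by positivity, fun t S hS => ?_⟩
  have hpos : ∀ s ∈ Set.uIcc 1 S, (0 : ℝ) < s := fun s hs => by
    rw [Set.uIcc_of_le hS] at hs; linarith [hs.1]
  have ht : ‖(t : ℂ) + Complex.I‖ ≤ |t| + 1 := by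
    refine (norm_add_le _ _).trans ?_
    simp
  have hu : ∀ s ∈ Set.uIcc 1 S, HasDerivAt (fun s : ℝ => 1 + (t + Complex.I) * (s : ℂ)⁻¹)
      ((t + Complex.I) * -((s : ℂ) ^ 2)⁻¹) s := fun s hs => by
    have hs0 : (s : ℂ) ≠ 0 := by exact_mod_cast (hpos s hs).ne'
    exact (((hasDerivAt_inv hs0).const_mul _).const_add 1).comp_ofReal
  have hparts := intervalIntegral.integral_mul_deriv_eq_deriv_mul (a := 1) (b := S) hu
    (fun s _ => (hσd (t + s)).comp_const_add t s)
    (ContinuousOn.intervalIntegrable (ContinuousOn.mul continuousOn_const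
      (ContinuousOn.neg (ContinuousOn.inv₀ (by fun_prop) fun s hs => pow_ne_zero 2
        (by exact_mod_cast (hpos s hs).ne')))))
    (Continuous.intervalIntegrable (hc.comp (continuous_const.add continuous_id)) _ _)
  -- Write `1/s = (1 + (t+i)/s) / (t+s+i)`: the centre `t` enters only through a smooth factor of
  -- size `O(1 + |t|)`, and the rest is the derivative of the bounded `σ`.
  have e1 : ((∫ s in (1 : ℝ)..S, g (t + s) / s : ℝ) : ℂ) = ∫ s in (1 : ℝ)..S,
      (1 + (t + Complex.I) * (s : ℂ)⁻¹) * ((g (t + s) : ℂ) / ((t + s : ℝ) + Complex.I)) := by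
    rw [← intervalIntegral.integral_ofReal]
    refine intervalIntegral.integral_congr fun s hs => ?_
    have hs0 : (s : ℂ) ≠ 0 := by exact_mod_cast (hpos s hs).ne'
    have hne := ofReal_add_I_ne_zero (t + s)
    push_cast at hne ⊢
    field_simp
    ring
  have b1 : ∀ s : ℝ, 1 ≤ s → ‖(1 + (t + Complex.I) * (s : ℂ)⁻¹)‖ ≤ 1 + (|t| + 1) := fun s hs => by
    refine (norm_add_le _ _).trans ?_
    rw [norm_one, norm_mul, norm_inv, Complex.norm_real, Real.norm_eq_abs, abs_of_pos (by linarith)]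
    have : s⁻¹ ≤ 1 := inv_le_one_of_one_le₀ hs
    have h2 : ‖(t : ℂ) + Complex.I‖ * s⁻¹ ≤ (|t| + 1) * 1 := by gcongr
    linarith
  have b2 : ∀ s : ℝ, 1 ≤ s → ‖(1 + (t + Complex.I) * (s : ℂ)⁻¹) * σ (t + s)‖
      ≤ (1 + (|t| + 1)) * B := fun s hs => by
    rw [norm_mul]
    exact mul_le_mul (b1 s hs) (hB _) (norm_nonneg _) (by positivity)
  have b3 : ‖∫ s in (1 : ℝ)..S, (t + Complex.I) * -((s : ℂ) ^ 2)⁻¹ * σ (t + s)‖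
      ≤ (|t| + 1) * B := by
    refine norm_integral_le_of_norm_le_div_sq (by positivity) hS fun s hs => ?_
    rw [norm_mul, norm_mul, norm_neg, norm_inv, norm_pow, Complex.norm_real, Real.norm_eq_abs,
      sq_abs, mul_right_comm]
    gcongr
    exact hB _
  rw [← Real.norm_eq_abs, ← Complex.norm_real, e1, hparts]
  refine (norm_sub_le _ _).trans ((add_le_add (norm_sub_le _ _) le_rfl).trans ?_)
  have := b2 S hS
  have := b2 1 le_rfl
  nlinarith [abs_nonneg t]

/-- A primitive of `g` is `o(|x|)`. -/
lemma exists_abs_le_mul_abs_add {w : ℝ → ℝ} (hw : ∀ y, HasDerivAt w (g y) y) {ε : ℝ} (hε : 0 < ε) :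
    ∃ C, 0 ≤ C ∧ ∀ x, |w x| ≤ ε * |x| + C := by
  have hwc : Continuous w := continuous_iff_continuousAt.2 fun y => (hw y).continuousAt
  have h1 := tendsto_div_atTop_of_tail hg hR hw
  have h2 := tendsto_div_atTop_of_tail (hg.comp continuous_neg) hR' (w := fun y => -w (-y))
    (fun y => ((hw (-y)).scomp y (hasDerivAt_neg y)).neg.congr_deriv (by simp))
  have key : ∀ {v : ℝ → ℝ}, Tendsto (fun x => v x / x) atTop (𝓝 0) →
      ∃ X, ∀ x ≥ X, |v x| ≤ ε * |x| := by
    intro v hv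
    have h3 := (Metric.tendsto_nhds.1 hv) ε hε
    obtain ⟨X, hX⟩ := eventually_atTop.1 (h3.and (eventually_gt_atTop 0))
    refine ⟨X, fun x hx => ?_⟩
    obtain ⟨h4, h5⟩ := hX x hx
    rw [dist_zero_right, norm_div, div_lt_iff₀ (by simpa using h5.ne')] at h4
    exact h4.le
  obtain ⟨X, hX⟩ := key h1
  obtain ⟨Y, hY⟩ := key h2
  obtain ⟨M, hM⟩ := (isCompact_Icc (a := -Y) (b := X)).exists_bound_of_continuousOn
    hwc.continuousOn
  refine ⟨|M|, abs_nonneg M, fun x => ?_⟩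
  rcases le_total X x with h | h
  · exact (hX x h).trans (by linarith [abs_nonneg M])
  rcases le_total x (-Y) with h' | h'
  · have := hY (-x) (by linarith)
    rw [neg_neg, abs_neg, abs_neg] at this
    exact this.trans (by linarith [abs_nonneg M])
  · have := (hM x ⟨h', h⟩).trans (le_abs_self M)
    rw [Real.norm_eq_abs] at this
    have : 0 ≤ ε * |x| := by positivity
    linarith

end TwoSided

/-! ### The homogeneous equation integrated twice -/

lemma intervalIntegral_swap_of_continuous {f : ℝ → ℝ → ℝ} (hf : Continuous (Function.uncurry f))
    (a b c d : ℝ) : ∫ x in a..b, ∫ y in c..d, f x y = ∫ y in c..d, ∫ x in a..b, f x y := by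
  refine intervalIntegral_intervalIntegral_swap ?_
  have h : IntegrableOn (Function.uncurry f) (Set.uIcc a b ×ˢ Set.uIcc c d) :=
    hf.continuousOn.integrableOn_compact (isCompact_uIcc.prod isCompact_uIcc)
  have h2 := h.mono_set (Set.prod_mono Set.uIoc_subset_uIcc Set.uIoc_subset_uIcc)
  exact h2

lemma taylor_two {w w' w'' : ℝ → ℝ} (hw : ∀ x, HasDerivAt w (w' x) x)
    (hw' : ∀ x, HasDerivAt w' (w'' x) x) (hc : Continuous w'') (x y : ℝ) :
    w (x + y) = w y + x * w' y + ∫ t in (0 : ℝ)..x, (x - t) * w'' (t + y) := by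
  have hc' : Continuous w' := continuous_iff_continuousAt.2 fun y => (hw' y).continuousAt
  have h1 := intervalIntegral.integral_mul_deriv_eq_deriv_mul (a := 0) (b := x)
    (u := fun t => x - t) (u' := fun _ => -1) (v := fun t => w' (t + y))
    (v' := fun t => w'' (t + y)) (fun t _ => (hasDerivAt_id t).const_sub x)
    (fun t _ => (hw' (t + y)).comp_add_const t y) (by simp)
    (Continuous.intervalIntegrable (by fun_prop) _ _)
  have h2 := intervalIntegral.integral_eq_sub_of_hasDerivAt (a := 0) (b := x)
    (f := fun t => w (t + y)) (fun t _ => (hw (t + y)).comp_add_const t y)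
    (Continuous.intervalIntegrable (by fun_prop) _ _)
  simp only [neg_mul, one_mul, intervalIntegral.integral_neg, h2, zero_add] at h1
  rw [h1]
  ring

lemma continuous_integral_mean {g : ℝ → ℝ} (hc : Continuous g) (a b : ℝ) : Continuous fun t => ∫ s in a..b, mean g t s :=
  intervalIntegral.continuous_parametric_intervalIntegral_of_continuous'
    (f := fun t s => mean g t s) (continuous_mean hc) _ _

lemma integral_mean_split {g : ℝ → ℝ} (hc : Continuous g) (t S : ℝ) : ∫ s in (0 : ℝ)..S, mean g t s
    = (∫ s in (0 : ℝ)..1, mean g t s) + ∫ s in (1 : ℝ)..S, mean g t s := by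
  have hm : Continuous fun s => mean g t s :=
    (continuous_mean hc).comp (continuous_const.prodMk continuous_id)
  exact (intervalIntegral.integral_add_adjacent_intervals (hm.intervalIntegrable _ _)
    (hm.intervalIntegrable _ _)).symm

lemma HasHilbertTransformAt.tendsto_integral_mean {g g' : ℝ → ℝ} (hg : ∀ x, HasDerivAt g (g' x) x)
    (hc : Continuous g') {x L : ℝ} (h : HasHilbertTransformAt g x L) :
    Tendsto (fun S => ∫ s in (0 : ℝ)..S, mean g' x s) atTop (𝓝 (Real.pi * L)) := by
  refine (h.tendsto_symm hg hc x).congr fun S => ?_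
  rw [integral_mean hg hc]
  simp only [smul_eq_mul, div_eq_inv_mul]

lemma exists_tails {g : ℝ → ℝ} (hg : Continuous g) {L : ℝ} (h : HasHilbertTransformAt g 0 L) :
    ∃ R R', Tendsto (fun b => ∫ s in (1 : ℝ)..b, g s / s) atTop (𝓝 R) ∧
    Tendsto (fun b => ∫ s in (1 : ℝ)..b, g (-s) / s) atTop (𝓝 R') := by
  obtain ⟨R, hR⟩ := h.exists_tendsto_right hg
  obtain ⟨R', hR'⟩ := h.exists_tendsto_left hg
  simp only [zero_add] at hR
  simp only [zero_sub] at hR'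
  exact ⟨R, R', hR, hR'⟩

section Taylor

variable {w w' w'' : ℝ → ℝ} (hw : ∀ x, HasDerivAt w (w' x) x)
    (hw' : ∀ x, HasDerivAt w' (w'' x) x) (hc : Continuous w'')

include hw hw' hc

lemma mean_taylor (x s : ℝ) : mean w x s = mean w 0 s + x * mean w' 0 s
    + ∫ t in (0 : ℝ)..x, (x - t) * mean w'' t s := by
  have cw' : Continuous w' := continuous_iff_continuousAt.2 fun y => (hw' y).continuousAt
  have cw : Continuous w := continuous_iff_continuousAt.2 fun y => (hw y).continuousAt
  have e1 : ∫ t in (0 : ℝ)..x, (x - t) * mean w'' t s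
      = ∫ τ in (-1 : ℝ)..1, ∫ t in (0 : ℝ)..x, (x - t) * w'' (t + s * τ) := by
    rw [intervalIntegral_swap_of_continuous (f := fun τ t => (x - t) * w'' (t + s * τ))
      (by fun_prop)]
    refine intervalIntegral.integral_congr fun t _ => ?_
    simp only [mean, intervalIntegral.integral_const_mul]
  have cT : Continuous fun τ : ℝ => ∫ t in (0 : ℝ)..x, (x - t) * w'' (t + s * τ) :=
    intervalIntegral.continuous_parametric_intervalIntegral_of_continuous'
      (f := fun τ t => (x - t) * w'' (t + s * τ)) (by fun_prop) _ _
  rw [e1]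
  simp only [mean, zero_add]
  rw [← intervalIntegral.integral_const_mul, ← intervalIntegral.integral_add
    (Continuous.intervalIntegrable (by fun_prop) _ _)
    (Continuous.intervalIntegrable (by fun_prop) _ _), ← intervalIntegral.integral_add
    (Continuous.intervalIntegrable (by fun_prop) _ _)
    (Continuous.intervalIntegrable (by fun_prop) _ _)]
  exact intervalIntegral.integral_congr fun τ _ => taylor_two hw hw' hc x (s * τ)

/-- Taylor's formula under the averages. Integrating twice replaces `w''` by `w`, whose growth is
controlled, at the cost of terms affine in `x`, which the power kernels will annihilate. -/
lemma integral_weight_mean (x a b : ℝ) :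
    ∫ t in (0 : ℝ)..x, (x - t) * ∫ s in a..b, mean w'' t s
      = ∫ s in a..b, (mean w x s - mean w 0 s - x * mean w' 0 s) := by
  have hm := continuous_mean hc
  have hm' : Continuous fun q : ℝ × ℝ => mean w'' q.2 q.1 := hm.comp continuous_swap
  simp only [← intervalIntegral.integral_const_mul]
  rw [intervalIntegral_swap_of_continuous (f := fun t s => (x - t) * mean w'' t s)
    (by exact (continuous_const.sub continuous_fst).mul hm)]
  refine intervalIntegral.integral_congr fun s _ => ?_
  rw [mean_taylor hw hw' hc x s]
  ring

end Taylor

lemma abs_mean_le {w : ℝ → ℝ} {C : ℝ} (hC0 : 0 ≤ C) (hC : ∀ x, |w x| ≤ C * (1 + |x|)) (x s : ℝ) :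
    |mean w x s| ≤ 2 * C * (1 + |x| + |s|) := by
  have := intervalIntegral.norm_integral_le_of_norm_le_const (a := (-1 : ℝ)) (b := 1)
    (f := fun τ => w (x + s * τ)) (C := C * (1 + |x| + |s|)) (fun τ hτ => by
      rw [Set.uIoc_of_le (by norm_num)] at hτ
      refine (hC _).trans ?_
      have h1 : |τ| ≤ 1 := abs_le.2 ⟨hτ.1.le, hτ.2⟩
      have h2 : |x + s * τ| ≤ |x| + |s| := by
        refine (abs_add_le _ _).trans ?_
        rw [abs_mul]
        nlinarith [abs_nonneg s]
      exact mul_le_mul_of_nonneg_left (by linarith) hC0)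
  rw [Real.norm_eq_abs] at this
  norm_num at this
  rw [mean]
  linarith

lemma abs_integral_weight_le {φ : ℝ → ℝ} {K x : ℝ} (hK : ∀ t, |t| ≤ |x| → |φ t| ≤ K) :
    |∫ t in (0 : ℝ)..x, (x - t) * φ t| ≤ |x| * K * |x| := by
  have hK0 : 0 ≤ K := (abs_nonneg _).trans (hK x le_rfl)
  have := intervalIntegral.norm_integral_le_of_norm_le_const (a := (0 : ℝ)) (b := x)
    (f := fun t => (x - t) * φ t) (C := |x| * K) (fun t ht => by
      have ht' := Set.uIoc_subset_uIcc ht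
      have h1 : |x - t| ≤ |x| := by
        simpa using Set.abs_sub_right_of_mem_uIcc ht'
      have h2 : |t| ≤ |x| := by
        simpa using Set.abs_sub_left_of_mem_uIcc ht'
      rw [norm_mul, Real.norm_eq_abs, Real.norm_eq_abs]
      exact mul_le_mul h1 (hK t h2) (abs_nonneg _) (abs_nonneg _))
  simpa using this

section Equation

variable {c : ℝ} {w w' w'' : ℝ → ℝ} (hw : ∀ x, HasDerivAt w (w' x) x)
    (hw' : ∀ x, HasDerivAt w' (w'' x) x) (hc : Continuous w'')
    (hH : ∀ x, HasHilbertTransformAt w' x (-c * w x))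

include hw hw' hc hH

-- Only the existence of the transform of `w'` at the single point `0` is used: it makes both tails
-- converge.
omit hc in
lemma sublinear_of_hilbert {ε : ℝ} (hε : 0 < ε) : ∃ C, 0 ≤ C ∧ ∀ x, |w x| ≤ ε * |x| + C := by
  have cw' : Continuous w' := continuous_iff_continuousAt.2 fun y => (hw' y).continuousAt
  obtain ⟨R, R', hR, hR'⟩ := exists_tails cw' (hH 0)
  exact exists_abs_le_mul_abs_add cw' hR hR' hw hε

omit hc in
lemma linear_bound_of_hilbert : ∃ C, 0 ≤ C ∧ ∀ x, |w x| ≤ C * (1 + |x|) := by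
  obtain ⟨C, hC0, hC⟩ := sublinear_of_hilbert hw hw' hH one_pos
  refine ⟨1 + C, by positivity, fun x => (hC x).trans ?_⟩
  nlinarith [abs_nonneg x]

-- Undoing the mean gives `(w'(t+s) - w'(t-s))/s`, so both one-sided tail bounds for `w'` apply,
-- uniformly in the truncation.
omit hw in
lemma exists_abs_integral_far_le :
    ∃ C, 0 ≤ C ∧ ∀ t S, 1 ≤ S → |∫ s in (1 : ℝ)..S, mean w'' t s| ≤ C * (1 + |t|) := by
  have cw' : Continuous w' := continuous_iff_continuousAt.2 fun y => (hw' y).continuousAt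
  obtain ⟨R, R', hR, hR'⟩ := exists_tails cw' (hH 0)
  obtain ⟨C, hC0, hC⟩ := exists_norm_integral_tail_le cw' hR hR'
  obtain ⟨C', hC0', hC'⟩ := exists_norm_integral_tail_le (g := fun s => w' (-s))
    (cw'.comp continuous_neg) hR' (by simpa using hR)
  refine ⟨C + C', by positivity, fun t S hS => ?_⟩
  have h1 := hC t S hS
  have h2 := hC' (-t) S hS
  rw [abs_neg] at h2
  simp only [neg_add, neg_neg, ← sub_eq_add_neg] at h2
  have e : ∫ s in (1 : ℝ)..S, mean w'' t s
      = (∫ s in (1 : ℝ)..S, w' (t + s) / s) - ∫ s in (1 : ℝ)..S, w' (t - s) / s := by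
    rw [integral_mean hw' hc, ← intervalIntegral.integral_sub
      (intervalIntegrable_comp_div cw' (by fun_prop) one_pos (by linarith))
      (intervalIntegrable_comp_div cw' (by fun_prop) one_pos (by linarith))]
    refine intervalIntegral.integral_congr fun s _ => ?_
    simp only [smul_eq_mul]
    ring
  rw [e]
  refine (abs_sub _ _).trans ?_
  linarith

omit hw in
/-- The equation integrated twice. -/
lemma tendsto_integral_weight_mean (x : ℝ) :
    Tendsto (fun S => ∫ t in (0 : ℝ)..x, (x - t) * ∫ s in (0 : ℝ)..S, mean w'' t s) atTop
      (𝓝 (Real.pi * -c * ∫ t in (0 : ℝ)..x, (x - t) * w t)) := by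
  obtain ⟨C, hC0, hC⟩ := exists_abs_integral_far_le hw' hc hH
  obtain ⟨M, hM⟩ := (isCompact_uIcc (a := (0 : ℝ)) (b := x)).exists_bound_of_continuousOn
    (continuous_integral_mean hc 0 1).continuousOn
  have hlim : Real.pi * -c * ∫ t in (0 : ℝ)..x, (x - t) * w t
      = ∫ t in (0 : ℝ)..x, (x - t) * (Real.pi * (-c * w t)) := by
    rw [← intervalIntegral.integral_const_mul]
    refine intervalIntegral.integral_congr fun t _ => ?_
    ring
  rw [hlim]
  -- The range `s ≤ 1` is bounded by compactness, the range `s ≥ 1` by the uniform linear tail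
  -- bound; the pointwise limit is the equation at `t`.
  refine intervalIntegral.tendsto_integral_filter_of_dominated_convergence
    (fun t => |x - t| * (M + C * (1 + |t|))) ?_ ?_ ?_ ?_
  · exact Eventually.of_forall fun S => ((continuous_const.sub continuous_id).mul
      (continuous_integral_mean hc 0 S)).aestronglyMeasurable
  · filter_upwards [eventually_ge_atTop 1] with S hS
    refine Eventually.of_forall fun t ht => ?_
    rw [norm_mul, integral_mean_split hc t S]
    refine mul_le_mul_of_nonneg_left ((norm_add_le _ _).trans (add_le_add ?_ (hC t S hS)))
      (norm_nonneg _)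
    exact hM t (Set.uIoc_subset_uIcc ht)
  · exact Continuous.intervalIntegrable (by fun_prop) _ _
  · exact Eventually.of_forall fun t _ =>
      ((hH t).tendsto_integral_mean hw' hc).const_mul (x - t)

/-- Supplies the domination, uniform in `S`, for integrating against `(x-z)⁻⁵`: cubic growth is what
leaves an integrable `(1+|x|)⁻²`. The near range is rewritten through `w` by `integral_weight_mean`;
the far range is the linear tail bound integrated twice. -/
lemma exists_abs_integral_weight_mean_le : ∃ K, ∀ x S, 1 ≤ S →
    |∫ t in (0 : ℝ)..x, (x - t) * ∫ s in (0 : ℝ)..S, mean w'' t s| ≤ K * (1 + |x|) ^ 3 := by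
  obtain ⟨C, hC0, hC⟩ := exists_abs_integral_far_le hw' hc hH
  obtain ⟨B, hB0, hB⟩ := linear_bound_of_hilbert hw hw' hH
  have cw' : Continuous w' := continuous_iff_continuousAt.2 fun y => (hw' y).continuousAt
  have cm : Continuous fun s => mean w' 0 s :=
    (continuous_mean cw').comp (continuous_const.prodMk continuous_id)
  obtain ⟨M, hM⟩ := (isCompact_Icc (a := (0 : ℝ)) (b := 1)).exists_bound_of_continuousOn
    cm.continuousOn
  have hM0 : 0 ≤ M := (norm_nonneg _).trans (hM 0 (by norm_num))
  refine ⟨(8 * B + M) + C, fun x S hS => ?_⟩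
  have hcm : ∀ a b, IntervalIntegrable (fun t => (x - t) * ∫ s in a..b, mean w'' t s)
      volume 0 x := fun a b => Continuous.intervalIntegrable
    (by exact (continuous_const.sub continuous_id).mul (continuous_integral_mean hc a b)) _ _
  have e : ∫ t in (0 : ℝ)..x, (x - t) * ∫ s in (0 : ℝ)..S, mean w'' t s
      = (∫ s in (0 : ℝ)..1, (mean w x s - mean w 0 s - x * mean w' 0 s))
        + ∫ t in (0 : ℝ)..x, (x - t) * ∫ s in (1 : ℝ)..S, mean w'' t s := by
    rw [← integral_weight_mean hw hw' hc, ← intervalIntegral.integral_add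
      (hcm 0 1) (hcm 1 S)]
    refine intervalIntegral.integral_congr fun t _ => ?_
    rw [integral_mean_split hc t S]
    ring
  have h1 : |∫ s in (0 : ℝ)..1, (mean w x s - mean w 0 s - x * mean w' 0 s)|
      ≤ (8 * B + M) * (1 + |x|) := by
    have := intervalIntegral.norm_integral_le_of_norm_le_const (a := (0 : ℝ)) (b := 1)
      (f := fun s => mean w x s - mean w 0 s - x * mean w' 0 s) (C := (8 * B + M) * (1 + |x|))
      (fun s hs => by
        rw [Set.uIoc_of_le zero_le_one] at hs
        have hs1 : |s| ≤ 1 := abs_le.2 ⟨by linarith [hs.1], hs.2⟩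
        have a1 := abs_mean_le hB0 hB x s
        have a2 := abs_mean_le hB0 hB 0 s
        have a3 := hM s ⟨hs.1.le, hs.2⟩
        rw [Real.norm_eq_abs] at a3 ⊢
        rw [abs_zero] at a2
        have a4 := abs_sub (mean w x s - mean w 0 s) (x * mean w' 0 s)
        have a5 := abs_sub (mean w x s) (mean w 0 s)
        rw [abs_mul] at a4
        have a6 : |x| * |mean w' 0 s| ≤ |x| * M := by gcongr
        nlinarith [abs_nonneg x, mul_le_mul_of_nonneg_left hs1 hB0, mul_nonneg hB0 (abs_nonneg x)])
    simpa using this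
  have h2 := abs_integral_weight_le (φ := fun t => ∫ s in (1 : ℝ)..S, mean w'' t s) (x := x)
    (K := C * (1 + |x|)) (fun t ht => (hC t S hS).trans (by gcongr))
  rw [e]
  refine (abs_add_le _ _).trans ((add_le_add h1 h2).trans ?_)
  have hx := abs_nonneg x
  rw [add_mul (8 * B + M) C]
  refine add_le_add ?_ ?_
  · refine mul_le_mul_of_nonneg_left ?_ (by positivity)
    exact le_self_pow₀ (by linarith) (by norm_num)
  · calc |x| * (C * (1 + |x|)) * |x| = C * (|x| * |x| * (1 + |x|)) := by ring
      _ ≤ C * ((1 + |x|) * (1 + |x|) * (1 + |x|)) := by gcongr <;> linarith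
      _ = C * (1 + |x|) ^ 3 := by ring

end Equation

/-! ### Power kernels against functions of polynomial growth -/

lemma integrable_weight_of_le {φ : ℝ → ℂ} (hφ : Continuous φ) {K : ℝ} {m n : ℕ} (hmn : m + 2 ≤ n)
    (hK : ∀ x, ‖φ x‖ ≤ K * (1 + |x|) ^ m) : Integrable fun x => ‖φ x‖ / (1 + |x|) ^ n := by
  have hK0 : 0 ≤ K := by simpa using (norm_nonneg _).trans (hK 0)
  have hpos : ∀ x : ℝ, 0 < 1 + |x| := fun x => by positivity
  refine ((integrable_one_add_abs_pow (n := n - m) (by omega)).const_mul K).mono' ?_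
    (Eventually.of_forall fun x => ?_)
  · exact (Continuous.div (by fun_prop) (by fun_prop) fun x =>
      (pow_pos (hpos x) n).ne').aestronglyMeasurable
  · rw [Real.norm_of_nonneg (by positivity), div_le_iff₀ (pow_pos (hpos x) n)]
    refine (hK x).trans (le_of_eq ?_)
    rw [show (1 + |x|) ^ n = (1 + |x|) ^ (n - m) * (1 + |x|) ^ m by rw [← pow_add]; congr 1; omega]
    have := (pow_pos (hpos x) (n - m)).ne'
    field_simp

lemma tendsto_kernel_zero {φ : ℝ → ℂ} {K : ℝ} {m n : ℕ} (hmn : m + 1 ≤ n)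
    (hK : ∀ x, ‖φ x‖ ≤ K * (1 + |x|) ^ m) {z : ℂ} (hz : 0 < z.im) {l : Filter ℝ}
    (hl : Tendsto (fun x : ℝ => |x|) l atTop) :
    Tendsto (fun x : ℝ => φ x / ((x : ℂ) - z) ^ n) l (𝓝 0) := by
  have hK0 : 0 ≤ K := by simpa using (norm_nonneg _).trans (hK 0)
  have hpos : ∀ x : ℝ, 0 < 1 + |x| := fun x => by positivity
  obtain ⟨c, hc, h⟩ := exists_mul_le_norm_ofReal_sub hz
  have h1 : Tendsto (fun x : ℝ => (c ^ n)⁻¹ * (K * (1 + |x|)⁻¹)) l (𝓝 0) := by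
    have := ((tendsto_inv_atTop_zero.comp (tendsto_atTop_add_const_left l 1 hl)).const_mul
      K).const_mul (c ^ n)⁻¹
    simpa using this
  refine squeeze_zero_norm (fun x => ?_) h1
  refine (norm_kernel_le hc n (h z (Metric.mem_ball_self (by positivity)) x)).trans ?_
  refine mul_le_mul_of_nonneg_left ?_ (by positivity)
  rw [div_le_iff₀ (pow_pos (hpos x) n), show (1 + |x|) ^ n = (1 + |x|) * (1 + |x|) ^ (n - 1) by
    rw [← pow_succ']; congr 1; omega, mul_assoc, inv_mul_cancel_left₀ (hpos x).ne']
  refine (hK x).trans (mul_le_mul_of_nonneg_left ?_ hK0)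
  exact pow_le_pow_right₀ (by linarith [abs_nonneg x]) (by omega)

lemma hasDerivAt_inv_pow_sub {z : ℂ} (hz : 0 < z.im) (n : ℕ) (x : ℝ) :
    HasDerivAt (fun x : ℝ => 1 / ((x : ℂ) - z) ^ n) (-(n * (1 / ((x : ℂ) - z) ^ (n + 1)))) x := by
  have h := hasDerivAt_wave_kernel 0 n hz x
  simpa using h

/-- The integrand is the derivative of a multiple of `(x-z)^{-(n-1)}`, which vanishes at both ends.
With the next lemma, this shows that affine terms are invisible to the kernel `(x-z)⁻⁵`. -/
lemma integral_kernel_eq_zero {n : ℕ} (hn : 2 ≤ n) {z : ℂ} (hz : 0 < z.im) :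
    ∫ x : ℝ, 1 / ((x : ℂ) - z) ^ n = 0 := by
  obtain ⟨m, rfl⟩ : ∃ m, n = m + 1 := ⟨n - 1, by omega⟩
  have hm : (m : ℂ) ≠ 0 := by exact_mod_cast (by omega : m ≠ 0)
  have hb : ∀ x : ℝ, ‖(1 : ℂ)‖ ≤ 1 * (1 + |x|) ^ 0 := fun x => by simp
  have hi := integrable_kernel (w := fun _ => (1 : ℂ)) continuous_const.aestronglyMeasurable
    (integrable_weight_of_le (n := m + 1) continuous_const (by omega) hb) hz
  have h := integral_of_hasDerivAt_of_tendsto (fun x => hasDerivAt_inv_pow_sub hz m x)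
    (hi.const_mul (m : ℂ)).neg
    (tendsto_kernel_zero (φ := fun _ => 1) (n := m) (by omega) hb hz tendsto_abs_atBot_atTop)
    (tendsto_kernel_zero (φ := fun _ => 1) (n := m) (by omega) hb hz tendsto_abs_atTop_atTop)
  rw [integral_neg, integral_const_mul, sub_zero, neg_eq_zero] at h
  exact (mul_eq_zero.1 h).resolve_left hm

lemma integral_kernel_mul_eq_zero {n : ℕ} (hn : 3 ≤ n) {z : ℂ} (hz : 0 < z.im) :
    ∫ x : ℝ, (x : ℂ) / ((x : ℂ) - z) ^ n = 0 := by
  obtain ⟨m, rfl⟩ : ∃ m, n = m + 1 := ⟨n - 1, by omega⟩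
  have hb : ∀ x : ℝ, ‖(1 : ℂ)‖ ≤ 1 * (1 + |x|) ^ 0 := fun x => by simp
  have hi : ∀ k, 2 ≤ k → Integrable fun x : ℝ => 1 / ((x : ℂ) - z) ^ k := fun k hk =>
    integrable_kernel (w := fun _ => (1 : ℂ)) continuous_const.aestronglyMeasurable
      (integrable_weight_of_le (n := k) continuous_const (by omega) hb) hz
  have e : ∀ x : ℝ, (x : ℂ) / ((x : ℂ) - z) ^ (m + 1)
      = 1 / ((x : ℂ) - z) ^ m + z * (1 / ((x : ℂ) - z) ^ (m + 1)) := fun x => by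
    have := ofReal_sub_ne_zero hz x
    field_simp
    ring
  simp only [e]
  rw [integral_add (hi m (by omega)) ((hi (m + 1) (by omega)).const_mul z), integral_const_mul,
    integral_kernel_eq_zero (by omega) hz, integral_kernel_eq_zero (by omega) hz]
  simp

lemma integral_kernel_swap {f : ℝ → ℝ → ℝ} (hf : Continuous (Function.uncurry f)) {K : ℝ}
    (hK : ∀ s x, |f s x| ≤ K * (1 + |s|) * (1 + |x|)) {z : ℂ} (hz : 0 < z.im) (a b : ℝ) :
    ∫ x : ℝ, ((∫ s in a..b, f s x : ℝ) : ℂ) / ((x : ℂ) - z) ^ 5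
      = ∫ s in a..b, ∫ x : ℝ, (f s x : ℂ) / ((x : ℂ) - z) ^ 5 := by
  obtain ⟨c, hc, h⟩ := exists_mul_le_norm_ofReal_sub hz
  have hpos : ∀ x : ℝ, 0 < 1 + |x| := fun x => by positivity
  have h1 : Integrable (fun s : ℝ => K * (1 + |s|)) (volume.restrict (Set.uIoc a b)) :=
    (intervalIntegrable_iff.1 (Continuous.intervalIntegrable (by fun_prop) a b))
  have h2 := (integrable_one_add_abs_pow (n := 4) (by norm_num)).const_mul (c ^ 5)⁻¹
  rw [intervalIntegral_integral_swap]
  · refine integral_congr_ae (Eventually.of_forall fun x => ?_)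
    simp only [div_eq_mul_inv]
    rw [intervalIntegral.integral_mul_const, intervalIntegral.integral_ofReal]
  · refine (h1.mul_prod h2).mono' (Continuous.aestronglyMeasurable ?_)
      (Eventually.of_forall fun p => ?_)
    · refine Continuous.div (Complex.continuous_ofReal.comp hf) (by fun_prop) fun p => ?_
      exact pow_ne_zero 5 (ofReal_sub_ne_zero hz p.2)
    · have h3 := norm_kernel_le (w := fun x => (f p.1 x : ℂ)) hc 5
        (h z (Metric.mem_ball_self (by positivity)) p.2)
      refine h3.trans ?_
      rw [Complex.norm_real, Real.norm_eq_abs, mul_left_comm]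
      refine mul_le_mul_of_nonneg_left ?_ (by positivity)
      rw [div_le_iff₀ (pow_pos (hpos _) 5)]
      refine (hK p.1 p.2).trans (le_of_eq ?_)
      have := (hpos p.2).ne'
      field_simp

/-- A shift of the density becomes a horizontal shift of `z`; this turns averages of `w` into
averages of its Cauchy-type integral. -/
lemma integral_comp_add_kernel (w : ℝ → ℝ) (n : ℕ) (z : ℂ) (a : ℝ) :
    ∫ x : ℝ, (w (x + a) : ℂ) / ((x : ℂ) - z) ^ n
      = cauchyPow (fun x => (w x : ℂ)) n (z + a) := by
  rw [cauchyPow, ← integral_add_right_eq_self (fun x : ℝ => (w x : ℂ) / ((x : ℂ) - (z + a)) ^ n) a]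
  refine integral_congr_ae (Eventually.of_forall fun x => ?_)
  simp only
  congr 2
  push_cast
  ring

lemma integral_mean_kernel {w : ℝ → ℝ} (hw : Continuous w) {C : ℝ} (hC0 : 0 ≤ C)
    (hC : ∀ x, |w x| ≤ C * (1 + |x|)) {z : ℂ} (hz : 0 < z.im) (S : ℝ) :
    ∫ x : ℝ, ((∫ s in (0 : ℝ)..S, mean w x s : ℝ) : ℂ) / ((x : ℂ) - z) ^ 5
      = ∫ s in (0 : ℝ)..S, ∫ τ in (-1 : ℝ)..1,
        cauchyPow (fun x => (w x : ℂ)) 5 (z + (s * τ : ℝ)) := by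
  have hm : Continuous fun p : ℝ × ℝ => mean w p.2 p.1 := (continuous_mean hw).comp continuous_swap
  rw [integral_kernel_swap (f := fun s x => mean w x s) hm (K := 2 * C) (fun s x => ?_) hz]
  · refine intervalIntegral.integral_congr fun s _ => ?_
    simp only [mean]
    rw [integral_kernel_swap (f := fun τ x => w (x + s * τ)) (by fun_prop) (K := C * (1 + |s|))
      (fun τ x => ?_) hz]
    · exact intervalIntegral.integral_congr fun τ _ => integral_comp_add_kernel w 5 z (s * τ)
    · refine (hC _).trans ?_
      rw [mul_assoc, mul_assoc]
      refine mul_le_mul_of_nonneg_left ?_ hC0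
      have h1 := abs_add_le x (s * τ)
      rw [abs_mul] at h1
      have := abs_nonneg x
      have := abs_nonneg s
      have := abs_nonneg τ
      have : 0 ≤ |s| * |x| := by positivity
      have : 0 ≤ |τ| * |x| := by positivity
      have : 0 ≤ |s| * |τ| * |x| := by positivity
      nlinarith
  · refine (abs_mean_le hC0 hC x s).trans ?_
    rw [mul_assoc (2 * C)]
    refine mul_le_mul_of_nonneg_left ?_ (by positivity)
    have : 0 ≤ |s| * |x| := by positivity
    nlinarith

section Derivatives

variable {w : ℝ → ℝ} (hw : Continuous w) {C : ℝ} (hC : ∀ x, |w x| ≤ C * (1 + |x|))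

include hw hC

lemma integrable_weight_real {n : ℕ} (hn : 3 ≤ n) :
    Integrable fun x => ‖(w x : ℂ)‖ / (1 + |x|) ^ n :=
  integrable_weight_of_le (m := 1) (K := C) (by fun_prop) hn fun x => by simpa using hC x

lemma hasDerivAt_cauchyPow_real {n : ℕ} (hn : 3 ≤ n) {z : ℂ} (hz : 0 < z.im) :
    HasDerivAt (cauchyPow (fun x => (w x : ℂ)) n)
      (n * cauchyPow (fun x => (w x : ℂ)) (n + 1) z) z :=
  hasDerivAt_cauchyPow (Continuous.aestronglyMeasurable (by fun_prop))
    (integrable_weight_real hw hC hn) hz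

lemma hasDerivAt_cauchyPow_line {n : ℕ} (hn : 3 ≤ n) {z : ℂ} (hz : 0 < z.im) (a : ℝ) :
    HasDerivAt (fun a : ℝ => cauchyPow (fun x => (w x : ℂ)) n (z + a))
      (n * cauchyPow (fun x => (w x : ℂ)) (n + 1) (z + a)) a := by
  have h := hasDerivAt_cauchyPow_real hw hC hn (z := z + a) (by simpa using hz)
  exact (h.comp_const_add z (a : ℂ)).comp_ofReal

lemma continuous_cauchyPow_line {n : ℕ} (hn : 3 ≤ n) {z : ℂ} (hz : 0 < z.im) :
    Continuous fun a : ℝ => cauchyPow (fun x => (w x : ℂ)) n (z + a) :=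
  continuous_iff_continuousAt.2 fun a => (hasDerivAt_cauchyPow_line hw hC hn hz a).continuousAt

end Derivatives

lemma norm_cauchyPow_three_le {w : ℝ → ℝ} {ε C η : ℝ} (hε : 0 ≤ ε) (hC0 : 0 ≤ C) (hη : 0 < η)
    (hC : ∀ x, |w x| ≤ ε * |x| + C) {z : ℂ} (hz : η ≤ z.im) :
    ‖cauchyPow (fun x => (w x : ℂ)) 3 z‖
      ≤ (ε + (ε * ‖z‖ + C) / η) * ∫ x : ℝ, (x ^ 2 + η ^ 2)⁻¹ := by
  have hInt : Integrable fun x : ℝ => (x ^ 2 + η ^ 2)⁻¹ := by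
    have h1 := (integrable_inv_one_add_sq.comp_div hη.ne').const_mul (η ^ 2)⁻¹
    refine h1.congr (Eventually.of_forall fun x => ?_)
    simp only
    field_simp
    ring
  have hK := integral_sub_right_eq_self (fun x : ℝ => (x ^ 2 + η ^ 2)⁻¹) (μ := volume) z.re
  rw [← hK, ← integral_const_mul]
  refine norm_integral_le_of_norm_le ((hInt.comp_sub_right z.re).const_mul _)
    (Eventually.of_forall fun x => ?_)
  set d := ‖(x : ℂ) - z‖ with hd
  have hdη : η ≤ d := hz.trans (im_le_norm_ofReal_sub z x)
  have hd0 : 0 < d := hη.trans_le hdη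
  have hx : |x| ≤ d + ‖z‖ := by
    have := norm_add_le ((x : ℂ) - z) z
    rwa [sub_add_cancel, Complex.norm_real, Real.norm_eq_abs] at this
  have hd2 : (x - z.re) ^ 2 + η ^ 2 ≤ d ^ 2 := by
    rw [hd, ← Complex.normSq_eq_norm_sq, Complex.normSq_apply]
    simp only [Complex.sub_re, Complex.ofReal_re, Complex.sub_im, Complex.ofReal_im]
    nlinarith
  rw [norm_div, norm_pow, Complex.norm_real, Real.norm_eq_abs, ← hd]
  -- The growth of `w` is absorbed by one power of `d = |x - z|`; the other two give an integral
  -- depending only on `η`. The coefficient has slope proportional to `ε` in `‖z‖`, which is what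
  -- yields sublinearity.
  have h1 : |w x| ≤ (ε + (ε * ‖z‖ + C) / η) * d := by
    refine (hC x).trans ?_
    have h2 : ε * |x| ≤ ε * (d + ‖z‖) := by gcongr
    have h3 : ε * ‖z‖ + C ≤ (ε * ‖z‖ + C) / η * d := by
      rw [div_mul_eq_mul_div, le_div_iff₀ hη]
      gcongr
    nlinarith
  calc |w x| / d ^ 3 ≤ (ε + (ε * ‖z‖ + C) / η) * d / d ^ 3 := by gcongr
    _ = (ε + (ε * ‖z‖ + C) / η) * (d ^ 2)⁻¹ := by field_simp
    _ ≤ _ := by gcongr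

/-- `z ↦ ∫ w(x) (x - z)⁻³ dx` is sublinear when `w` is. -/
lemma tendsto_cauchyPow_three_div {w : ℝ → ℝ}
    (hw : ∀ ε > 0, ∃ C, 0 ≤ C ∧ ∀ x, |w x| ≤ ε * |x| + C) {z : ℂ} (hz : 0 < z.im) :
    Tendsto (fun ζ => cauchyPow (fun x => (w x : ℂ)) 3 (z + ζ) / ζ) upperInfinity (𝓝 0) := by
  set η := z.im with hη
  set I := ∫ x : ℝ, (x ^ 2 + η ^ 2)⁻¹ with hI
  have hI0 : 0 ≤ I := integral_nonneg fun x => by positivity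
  have hinf : Tendsto (fun z : ℂ => z) upperInfinity (Bornology.cobounded ℂ) :=
    tendsto_id.mono_left inf_le_left
  have him : ∀ᶠ z in upperInfinity, z ∈ {z : ℂ | 0 ≤ z.im} :=
    eventually_inf_principal.2 (Eventually.of_forall fun _ h => h)
  have hn := tendsto_norm_atTop_iff_cobounded.2 hinf
  rw [Metric.tendsto_nhds]
  intro δ hδ
  -- Chosen so that `εI/η ≤ δ/2`; the `+ 1` avoids having to show `I > 0`.
  set ε := δ * η / (2 * (I + 1)) with hεdef
  have hε : 0 < ε := by positivity
  obtain ⟨C, hC0, hC⟩ := hw ε hε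
  have h1 : Tendsto (fun ζ : ℂ => (ε + (ε * ‖z‖ + C) / η) * I / ‖ζ‖) upperInfinity (𝓝 0) :=
    tendsto_const_nhds.div_atTop hn
  filter_upwards [him, hn.eventually (eventually_gt_atTop 0),
    h1.eventually (gt_mem_nhds (by positivity : 0 < δ / 2))] with ζ hζ hζ0 hlt
  have hζ' : 0 ≤ ζ.im := hζ
  have hb := norm_cauchyPow_three_le hε.le hC0 hz hC (z := z + ζ) (by simp; linarith)
  rw [dist_zero_right, norm_div, div_lt_iff₀ hζ0]
  refine hb.trans_lt ?_
  rw [div_lt_iff₀ hζ0] at hlt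
  have h2 : ‖z + ζ‖ ≤ ‖z‖ + ‖ζ‖ := norm_add_le _ _
  have h3 : (ε + (ε * ‖z + ζ‖ + C) / η) * I
      ≤ (ε + (ε * ‖z‖ + C) / η) * I + ε / η * I * ‖ζ‖ := by
    have : (ε * ‖z + ζ‖ + C) / η ≤ (ε * ‖z‖ + C) / η + ε / η * ‖ζ‖ := by
      rw [div_mul_eq_mul_div ε η, ← add_div]
      exact div_le_div_of_nonneg_right (by nlinarith) hz.le
    nlinarith
  have h4 : ε / η * I ≤ δ / 2 := by
    rw [hεdef]
    have : I / (I + 1) ≤ 1 := div_le_one_of_le₀ (by linarith) (by positivity)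
    calc δ * η / (2 * (I + 1)) / η * I = δ / 2 * (I / (I + 1)) := by field_simp
      _ ≤ δ / 2 * 1 := by gcongr
      _ = δ / 2 := mul_one _
  have h5 : ε / η * I * ‖ζ‖ ≤ δ / 2 * ‖ζ‖ := by gcongr
  change (ε + (ε * ‖z + ζ‖ + C) / η) * I < _
  linarith

/-- Integration by parts against the second primitive vanishing at `0`. -/
lemma integral_second_primitive_kernel {w : ℝ → ℝ} (hw : Continuous w) {C : ℝ} (hC0 : 0 ≤ C)
    (hC : ∀ x, |w x| ≤ C * (1 + |x|)) {z : ℂ} (hz : 0 < z.im) :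
    12 * ∫ x : ℝ, ((∫ t in (0 : ℝ)..x, (x - t) * w t : ℝ) : ℂ) / ((x : ℂ) - z) ^ 5
      = cauchyPow (fun x => (w x : ℂ)) 3 z := by
  set P : ℝ → ℝ := fun x => ∫ t in (0 : ℝ)..x, w t with hP
  set Y : ℝ → ℝ := fun x => ∫ t in (0 : ℝ)..x, (x - t) * w t with hY
  have hPd : ∀ x, HasDerivAt P (w x) x := fun x => (hw.integral_hasStrictDerivAt 0 x).hasDerivAt
  have hPc : Continuous P := continuous_iff_continuousAt.2 fun x => (hPd x).continuousAt
  have hYP : Y = fun x => ∫ t in (0 : ℝ)..x, P t := by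
    ext x
    have := intervalIntegral.integral_mul_deriv_eq_deriv_mul (a := 0) (b := x)
      (u := fun t => x - t) (u' := fun _ => -1) (fun t _ => (hasDerivAt_id t).const_sub x)
      (fun t _ => hPd t) (by simp) (hw.intervalIntegrable _ _)
    simp only [hY, this, sub_self, zero_mul, neg_mul, one_mul, intervalIntegral.integral_neg, hP,
      intervalIntegral.integral_same, mul_zero, sub_neg_eq_add, zero_add]
  have hYd : ∀ x, HasDerivAt Y (P x) x := fun x => by
    rw [hYP]; exact (hPc.integral_hasStrictDerivAt 0 x).hasDerivAt
  have hYc : Continuous Y := continuous_iff_continuousAt.2 fun x => (hYd x).continuousAt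
  have hle : ∀ x t : ℝ, |t| ≤ |x| → |w t| ≤ C * (1 + |x|) := fun x t h =>
    (hC t).trans (by gcongr)
  have hPb : ∀ x, ‖(P x : ℂ)‖ ≤ C * (1 + |x|) ^ 2 := fun x => by
    rw [Complex.norm_real]
    have := intervalIntegral.norm_integral_le_of_norm_le_const (a := (0 : ℝ)) (b := x)
      (f := w) (C := C * (1 + |x|)) (fun t ht => hle x t (by
        simpa using Set.abs_sub_left_of_mem_uIcc (Set.uIoc_subset_uIcc ht)))
    rw [sub_zero] at this
    refine this.trans ?_
    rw [mul_assoc, sq]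
    gcongr
    linarith
  have hYb : ∀ x, ‖(Y x : ℂ)‖ ≤ C * (1 + |x|) ^ 3 := fun x => by
    rw [Complex.norm_real]
    refine (abs_integral_weight_le (hle x)).trans ?_
    have hx := abs_nonneg x
    calc |x| * (C * (1 + |x|)) * |x| = C * (|x| * |x| * (1 + |x|)) := by ring
      _ ≤ C * ((1 + |x|) * (1 + |x|) * (1 + |x|)) := by gcongr <;> linarith
      _ = C * (1 + |x|) ^ 3 := by ring
  have i1 : Integrable fun x : ℝ => (Y x : ℂ) / ((x : ℂ) - z) ^ 5 :=
    integrable_kernel (w := fun x => (Y x : ℂ)) (Continuous.aestronglyMeasurable (by fun_prop))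
      (integrable_weight_of_le (by fun_prop) le_rfl hYb) hz
  have i2 : Integrable fun x : ℝ => (w x : ℂ) / ((x : ℂ) - z) ^ 3 :=
    integrable_kernel (w := fun x => (w x : ℂ)) (Continuous.aestronglyMeasurable (by fun_prop))
      (integrable_weight_real hw hC le_rfl) hz
  -- Here `Y'' = w`, and two integrations by parts lower the exponent from `5` to `3`, producing the
  -- factor `4 · 3 = 12`. The boundary terms vanish because `P` and `Y` grow at most like `|x|²` and
  -- `|x|³`.
  have hder : ∀ x : ℝ, HasDerivAt
      (fun x : ℝ => -(3 * ((Y x : ℂ) / ((x : ℂ) - z) ^ 4) + (P x : ℂ) / ((x : ℂ) - z) ^ 3))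
      (12 * ((Y x : ℂ) / ((x : ℂ) - z) ^ 5) - (w x : ℂ) / ((x : ℂ) - z) ^ 3) x := fun x => by
    have h4 := ((hYd x).ofReal_comp.mul (hasDerivAt_inv_pow_sub hz 4 x)).const_mul 3
    have h3 := (hPd x).ofReal_comp.mul (hasDerivAt_inv_pow_sub hz 3 x)
    refine ((h4.add h3).neg.congr_deriv ?_).congr_of_eventuallyEq
      (Eventually.of_forall fun y => ?_)
    · push_cast; ring
    · simp [div_eq_mul_inv]
  have hlim : ∀ {l : Filter ℝ}, Tendsto (fun x : ℝ => |x|) l atTop → Tendsto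
      (fun x : ℝ => -(3 * ((Y x : ℂ) / ((x : ℂ) - z) ^ 4) + (P x : ℂ) / ((x : ℂ) - z) ^ 3)) l
      (𝓝 0) := fun hl => by
    simpa using (((tendsto_kernel_zero (φ := fun x => (Y x : ℂ)) (n := 4) le_rfl hYb hz
      hl).const_mul 3).add
      (tendsto_kernel_zero (φ := fun x => (P x : ℂ)) (n := 3) le_rfl hPb hz hl)).neg
  have h := integral_of_hasDerivAt_of_tendsto hder ((i1.const_mul 12).sub i2)
    (hlim tendsto_abs_atBot_atTop) (hlim tendsto_abs_atTop_atTop)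
  rw [integral_sub (i1.const_mul 12) i2, integral_const_mul, sub_zero, sub_eq_zero] at h
  exact h

/-! ### The homogeneous equation transferred to the upper half-plane -/

section Equation

variable {c : ℝ} {w w' w'' : ℝ → ℝ} (hw : ∀ x, HasDerivAt w (w' x) x)
    (hw' : ∀ x, HasDerivAt w' (w'' x) x) (hc : Continuous w'')
    (hH : ∀ x, HasHilbertTransformAt w' x (-c * w x))

include hw hw' hc hH

/-- After the affine terms drop out, the pairing is an average of horizontal translates of `12 ∫
w(x)(x-z)⁻⁵ dx`, the second derivative of `B(z) = ∫ w(x)(x-z)⁻³ dx`. Averaging `B''` over a segment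
gives the symmetric slope of `B'`. -/
lemma integral_weight_mean_kernel {z : ℂ} (hz : 0 < z.im) (S : ℝ) :
    12 * ∫ x : ℝ, ((∫ t in (0 : ℝ)..x, (x - t) * ∫ s in (0 : ℝ)..S, mean w'' t s : ℝ) : ℂ)
        / ((x : ℂ) - z) ^ 5
      = ∫ s in (0 : ℝ)..S, (deriv (fun ζ => cauchyPow (fun x => (w x : ℂ)) 3 (z + ζ)) s
        - deriv (fun ζ => cauchyPow (fun x => (w x : ℂ)) 3 (z + ζ)) (-s)) / s := by
  have cw : Continuous w := continuous_iff_continuousAt.2 fun y => (hw y).continuousAt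
  have cw' : Continuous w' := continuous_iff_continuousAt.2 fun y => (hw' y).continuousAt
  obtain ⟨C, hC0, hC⟩ := linear_bound_of_hilbert hw hw' hH
  have hm1 : ∀ x, Continuous fun s => mean w x s := fun x =>
    (continuous_mean cw).comp (continuous_const.prodMk continuous_id)
  have hm2 : Continuous fun s => mean w' 0 s :=
    (continuous_mean cw').comp (continuous_const.prodMk continuous_id)
  set a := ∫ s in (0 : ℝ)..S, mean w 0 s with ha
  set b := ∫ s in (0 : ℝ)..S, mean w' 0 s with hb
  have hE : ∀ x, ∫ t in (0 : ℝ)..x, (x - t) * ∫ s in (0 : ℝ)..S, mean w'' t s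
      = (∫ s in (0 : ℝ)..S, mean w x s) - a - x * b := fun x => by
    rw [integral_weight_mean hw hw' hc, intervalIntegral.integral_sub
      (Continuous.intervalIntegrable (by exact (hm1 x).sub (hm1 0)) _ _)
      (Continuous.intervalIntegrable (by exact continuous_const.mul hm2) _ _), intervalIntegral.integral_sub
      ((hm1 x).intervalIntegrable _ _) ((hm1 0).intervalIntegrable _ _),
      intervalIntegral.integral_const_mul]
  have hone : Integrable fun x : ℝ => 1 / ((x : ℂ) - z) ^ 5 :=
    integrable_kernel (w := fun _ => (1 : ℂ)) continuous_const.aestronglyMeasurable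
      (integrable_weight_of_le (m := 0) (K := 1) continuous_const (by norm_num)
        fun x => by simp) hz
  have hid : Integrable fun x : ℝ => (x : ℂ) / ((x : ℂ) - z) ^ 5 :=
    integrable_kernel (w := fun x => (x : ℂ)) (by fun_prop)
      (integrable_weight_of_le (m := 1) (K := 1) (by fun_prop) (by norm_num)
        fun x => by simp) hz
  have hmS : Continuous fun x => ∫ s in (0 : ℝ)..S, mean w x s := continuous_integral_mean cw 0 S
  have hmb : ∀ x, ‖((∫ s in (0 : ℝ)..S, mean w x s : ℝ) : ℂ)‖
      ≤ 2 * C * (1 + |S|) * |S| * (1 + |x|) ^ 1 := fun x => by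
    rw [Complex.norm_real]
    have := intervalIntegral.norm_integral_le_of_norm_le_const (a := (0 : ℝ)) (b := S)
      (f := fun s => mean w x s) (C := 2 * C * ((1 + |S|) * (1 + |x|))) (fun s hs => by
        have hs' : |s| ≤ |S| := by
          simpa using Set.abs_sub_left_of_mem_uIcc (Set.uIoc_subset_uIcc hs)
        refine (abs_mean_le hC0 hC x s).trans (mul_le_mul_of_nonneg_left ?_ (by positivity))
        nlinarith [mul_nonneg (abs_nonneg S) (abs_nonneg x)])
    rw [sub_zero] at this
    refine this.trans (le_of_eq ?_)
    ring
  have hmi : Integrable fun x : ℝ => ((∫ s in (0 : ℝ)..S, mean w x s : ℝ) : ℂ)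
      / ((x : ℂ) - z) ^ 5 :=
    integrable_kernel (w := fun x => ((∫ s in (0 : ℝ)..S, mean w x s : ℝ) : ℂ))
      (Complex.continuous_ofReal.comp hmS).aestronglyMeasurable
      (integrable_weight_of_le (m := 1) (Complex.continuous_ofReal.comp hmS) (by norm_num) hmb) hz
  have e1 : ∫ x : ℝ, ((∫ t in (0 : ℝ)..x, (x - t) * ∫ s in (0 : ℝ)..S, mean w'' t s : ℝ) : ℂ)
        / ((x : ℂ) - z) ^ 5
      = ∫ x : ℝ, ((∫ s in (0 : ℝ)..S, mean w x s : ℝ) : ℂ) / ((x : ℂ) - z) ^ 5 := by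
    have e2 : ∀ x : ℝ, ((∫ t in (0 : ℝ)..x, (x - t) * ∫ s in (0 : ℝ)..S, mean w'' t s : ℝ) : ℂ)
        / ((x : ℂ) - z) ^ 5 = ((∫ s in (0 : ℝ)..S, mean w x s : ℝ) : ℂ) / ((x : ℂ) - z) ^ 5
        - a * (1 / ((x : ℂ) - z) ^ 5) - b * ((x : ℂ) / ((x : ℂ) - z) ^ 5) := fun x => by
      rw [hE]
      push_cast
      ring
    simp only [e2]
    rw [integral_sub (by exact hmi.sub (hone.const_mul _)) (hid.const_mul _),
      integral_sub hmi (hone.const_mul _), integral_const_mul, integral_const_mul,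
      integral_kernel_eq_zero (by norm_num) hz, integral_kernel_mul_eq_zero (by norm_num) hz]
    simp
  have hd : ∀ ζ : ℂ, 0 ≤ ζ.im → deriv (fun ζ => cauchyPow (fun x => (w x : ℂ)) 3 (z + ζ)) ζ
      = 3 * cauchyPow (fun x => (w x : ℂ)) 4 (z + ζ) := fun ζ hζ => by
    have h := hasDerivAt_cauchyPow_real cw hC (n := 3) le_rfl (z := z + ζ) (by simp; linarith)
    exact_mod_cast (h.comp_const_add z ζ).deriv
  have hline : ∀ y : ℝ, HasDerivAt (fun a : ℝ => 3 * cauchyPow (fun x => (w x : ℂ)) 4 (z + a))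
      (12 * cauchyPow (fun x => (w x : ℂ)) 5 (z + y)) y := fun y =>
    ((hasDerivAt_cauchyPow_line cw hC (n := 4) (by norm_num) hz y).const_mul 3).congr_deriv
      (by push_cast; ring)
  have hmean := integral_mean hline
    (continuous_const.mul (continuous_cauchyPow_line cw hC (by norm_num) hz)) 0 0 S
  rw [e1, integral_mean_kernel cw hC0 hC hz, ← intervalIntegral.integral_const_mul]
  simp only [mean, zero_add, intervalIntegral.integral_const_mul, zero_sub] at hmean ⊢
  rw [hmean]
  refine intervalIntegral.integral_congr fun s _ => ?_
  rw [hd s (by simp), hd (-s) (by simp), Complex.real_smul]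
  push_cast
  ring

/-- On the upper half-plane the transform of a homogeneous solution satisfies `B' = i c B`. -/
lemma hasDerivAt_cauchyPow_of_hilbert {z : ℂ} (hz : 0 < z.im) :
    HasDerivAt (cauchyPow (fun x => (w x : ℂ)) 3)
      (Complex.I * c * cauchyPow (fun x => (w x : ℂ)) 3 z) z := by
  have cw : Continuous w := continuous_iff_continuousAt.2 fun y => (hw y).continuousAt
  obtain ⟨C, hC0, hC⟩ := linear_bound_of_hilbert hw hw' hH
  obtain ⟨K, hK⟩ := exists_abs_integral_weight_mean_le hw hw' hc hH
  obtain ⟨κ, hκ, hκz⟩ := exists_mul_le_norm_ofReal_sub hz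
  set B := cauchyPow (fun x => (w x : ℂ)) 3 with hB
  have hBd : ∀ {ζ : ℂ}, 0 < ζ.im → HasDerivAt B (deriv B ζ) ζ := fun hζ =>
    (hasDerivAt_cauchyPow_real cw hC le_rfl hζ).differentiableAt.hasDerivAt
  have hU : DifferentiableOn ℂ (fun ζ => B (z + ζ)) (halfPlane z.im) := fun ζ hζ => by
    have hζ' : -z.im < ζ.im := hζ
    exact ((hBd (ζ := z + ζ) (by simp; linarith)).comp_const_add z
      ζ).differentiableAt.differentiableWithinAt
  have hsub := tendsto_cauchyPow_three_div
    (fun ε hε => sublinear_of_hilbert hw hw' hH hε) hz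
  have t1 := tendsto_integral_symm_deriv hz hU hsub
  have t2 : Tendsto (fun S => 12 * ∫ x : ℝ, ((∫ t in (0 : ℝ)..x,
      (x - t) * ∫ s in (0 : ℝ)..S, mean w'' t s : ℝ) : ℂ) / ((x : ℂ) - z) ^ 5) atTop
      (𝓝 (12 * ∫ x : ℝ, ((Real.pi * -c * ∫ t in (0 : ℝ)..x, (x - t) * w t : ℝ) : ℂ)
        / ((x : ℂ) - z) ^ 5)) := by
    refine Tendsto.const_mul _ (tendsto_integral_filter_of_dominated_convergence
      (fun x => (κ ^ 5)⁻¹ * (K * (1 / (1 + |x|) ^ 2))) ?_ ?_ ?_ ?_)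
    · refine Eventually.of_forall fun S => ?_
      refine aestronglyMeasurable_kernel (w := fun x => ((∫ t in (0 : ℝ)..x,
        (x - t) * ∫ s in (0 : ℝ)..S, mean w'' t s : ℝ) : ℂ)) ?_ 5 z
      refine (Complex.continuous_ofReal.comp ?_).aestronglyMeasurable
      have cφ := continuous_integral_mean hc 0 S
      exact intervalIntegral.continuous_parametric_intervalIntegral_of_continuous
        (f := fun x t => (x - t) * ∫ s in (0 : ℝ)..S, mean w'' t s)
        (by exact (continuous_fst.sub continuous_snd).mul (cφ.comp continuous_snd)) continuous_id
    · filter_upwards [eventually_ge_atTop 1] with S hS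
      refine Eventually.of_forall fun x => ?_
      have h1 := norm_kernel_le (w := fun x => ((∫ t in (0 : ℝ)..x,
        (x - t) * ∫ s in (0 : ℝ)..S, mean w'' t s : ℝ) : ℂ)) hκ 5
        (hκz z (Metric.mem_ball_self (by positivity)) x)
      refine h1.trans (mul_le_mul_of_nonneg_left ?_ (by positivity))
      have hpos : 0 < 1 + |x| := by positivity
      rw [div_le_iff₀ (by positivity), Complex.norm_real]
      refine (hK x S hS).trans (le_of_eq ?_)
      field_simp
    · exact ((integrable_one_add_abs_pow le_rfl).const_mul K).const_mul _
    · refine Eventually.of_forall fun x => ?_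
      exact ((Complex.continuous_ofReal.tendsto _).comp
        (tendsto_integral_weight_mean hw' hc hH x)).div_const _
  have e : (12 * ∫ x : ℝ, ((Real.pi * -c * ∫ t in (0 : ℝ)..x, (x - t) * w t : ℝ) : ℂ)
        / ((x : ℂ) - z) ^ 5) = Real.pi * -c * B z := by
    rw [hB, ← integral_second_primitive_kernel cw hC0 hC hz, mul_left_comm,
      ← integral_const_mul ((Real.pi : ℂ) * -c)]
    refine congrArg (fun v : ℂ => 12 * v) (integral_congr_ae (Eventually.of_forall fun x => ?_))
    simp only
    push_cast
    ring
  rw [e] at t2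
  -- Two evaluations of the same limit: Cauchy's theorem gives `iπB'(z)`, the real-line equation
  -- gives `-πcB(z)`.
  have huniq := tendsto_nhds_unique (t1.congr fun S =>
    (integral_weight_mean_kernel hw hw' hc hH hz S).symm) t2
  rw [deriv_comp_const_add B z 0, add_zero] at huniq
  have hp : (Real.pi : ℂ) ≠ 0 := by exact_mod_cast Real.pi_ne_zero
  have h1 : Complex.I * deriv B z = -c * B z := by
    refine mul_left_cancel₀ hp ?_
    linear_combination huniq
  refine (hBd hz).congr_deriv ?_
  linear_combination (-Complex.I) * h1 + (deriv B z) * Complex.I_mul_I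

/-- By `B' = icB`, the product `B(z) e^{-icz}` has zero derivative on the connected half-plane. -/
lemma exists_cauchyPow_eq_exp : ∃ A : ℂ, ∀ z : ℂ, 0 < z.im →
    cauchyPow (fun x => (w x : ℂ)) 3 z = A * Complex.exp (Complex.I * c * z) := by
  set B := cauchyPow (fun x => (w x : ℂ)) 3 with hB
  set s : Set ℂ := {z | 0 < z.im} with hs
  have hso : IsOpen s := isOpen_lt continuous_const Complex.continuous_im
  have hsc : IsPreconnected s := (convex_halfSpace_im_gt 0).isPreconnected
  have hd : ∀ z ∈ s, HasDerivAt (fun z => B z * Complex.exp (-(Complex.I * c * z))) 0 z := by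
    intro z hz
    have h1 : HasDerivAt (fun z : ℂ => Complex.exp (-(Complex.I * c * z)))
        (Complex.exp (-(Complex.I * c * z)) * -(Complex.I * c)) z := by
      simpa using ((hasDerivAt_id z).const_mul (Complex.I * c)).neg.cexp
    refine ((hasDerivAt_cauchyPow_of_hilbert hw hw' hc hH hz).mul h1).congr_deriv ?_
    ring
  obtain ⟨A, hA⟩ := hso.exists_is_const_of_deriv_eq_zero hsc
    (fun z hz => (hd z hz).differentiableAt.differentiableWithinAt) (fun z hz => (hd z hz).deriv)
  refine ⟨A, fun z hz => ?_⟩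
  rw [← hA z hz, mul_assoc, ← Complex.exp_add, neg_add_cancel, Complex.exp_zero, mul_one]

end Equation

/-! ### Recovering the second derivative from boundary values -/

/-- Since `Im (y-iη)⁻¹` is the Poisson kernel `η/(y²+η²)`, the rational function on the right is its
second derivative in `y`. -/
lemma im_kernel_three (v y η : ℝ) (hη : 0 < η) :
    2 * ((v : ℂ) / ((y : ℂ) - η * Complex.I) ^ 3).im
      = v * ((6 * y ^ 2 * η - 2 * η ^ 3) / (y ^ 2 + η ^ 2) ^ 3) := by
  have hne : (y : ℂ) - η * Complex.I ≠ 0 := fun h => by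
    have := congrArg Complex.im h
    simp at this
    exact hη.ne' this
  have hpos : y ^ 2 + η ^ 2 ≠ 0 := by positivity
  have hposc : ((y : ℂ) ^ 2 + (η : ℂ) ^ 2) ≠ 0 := by exact_mod_cast hpos
  have e : (v : ℂ) / ((y : ℂ) - η * Complex.I) ^ 3
      = ((v * (y ^ 3 - 3 * y * η ^ 2) / (y ^ 2 + η ^ 2) ^ 3 : ℝ) : ℂ)
        + ((v * (3 * y ^ 2 * η - η ^ 3) / (y ^ 2 + η ^ 2) ^ 3 : ℝ) : ℂ) * Complex.I := by
    have h1 : ((y : ℂ) ^ 2 + (η : ℂ) ^ 2) = (y - η * Complex.I) * (y + η * Complex.I) := by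
      linear_combination ((η : ℂ) ^ 2) * Complex.I_sq
    have h2 : ((y : ℂ) + η * Complex.I) ^ 3
        = (y ^ 3 - 3 * y * η ^ 2) + (3 * y ^ 2 * η - η ^ 3) * Complex.I := by
      linear_combination (3 * (y : ℂ) * η ^ 2 + η ^ 3 * Complex.I) * Complex.I_sq
    have h3 : (v : ℂ) / ((y : ℂ) - η * Complex.I) ^ 3
        = v * ((y : ℂ) + η * Complex.I) ^ 3 / ((y : ℂ) ^ 2 + (η : ℂ) ^ 2) ^ 3 := by
      rw [div_eq_div_iff (pow_ne_zero 3 hne) (pow_ne_zero 3 hposc), h1]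
      ring
    rw [h3, h2]
    push_cast
    ring
  rw [e, Complex.add_im, Complex.im_ofReal_mul, Complex.ofReal_im, Complex.I_im]
  ring

lemma hasDerivAt_poisson {η : ℝ} (hη : 0 < η) (y : ℝ) :
    HasDerivAt (fun y => η / (y ^ 2 + η ^ 2)) (-(2 * y * η) / (y ^ 2 + η ^ 2) ^ 2) y := by
  have hpos : y ^ 2 + η ^ 2 ≠ 0 := by positivity
  have h1 : HasDerivAt (fun y : ℝ => y ^ 2 + η ^ 2) (2 * y) y := by
    simpa using ((hasDerivAt_pow 2 y).add_const (η ^ 2))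
  refine ((hasDerivAt_const y η).div h1 hpos).congr_deriv ?_
  ring

lemma hasDerivAt_deriv_poisson {η : ℝ} (hη : 0 < η) (y : ℝ) :
    HasDerivAt (fun y => -(2 * y * η) / (y ^ 2 + η ^ 2) ^ 2)
      ((6 * y ^ 2 * η - 2 * η ^ 3) / (y ^ 2 + η ^ 2) ^ 3) y := by
  have hpos : y ^ 2 + η ^ 2 ≠ 0 := by positivity
  have h1 : HasDerivAt (fun y : ℝ => (y ^ 2 + η ^ 2) ^ 2) (2 * (y ^ 2 + η ^ 2) * (2 * y)) y := by
    have h2 : HasDerivAt (fun y : ℝ => y ^ 2 + η ^ 2) (2 * y) y := by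
      simpa using ((hasDerivAt_pow 2 y).add_const (η ^ 2))
    exact (h2.pow 2).congr_deriv (by simp)
  have h3 : HasDerivAt (fun y : ℝ => -(2 * y * η)) (-(2 * η)) y := by
    exact (((hasDerivAt_id y).const_mul 2).mul_const η).neg.congr_deriv (by simp)
  refine (h3.div h1 (pow_ne_zero 2 hpos)).congr_deriv ?_
  field_simp
  ring

lemma tendsto_poisson {φ : ℝ → ℝ} (hφ : Continuous φ) :
    Tendsto (fun η : ℝ => ∫ y in (-1 : ℝ)..1, φ y * (η / (y ^ 2 + η ^ 2))) (𝓝[>] 0)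
      (𝓝 (Real.pi * φ 0)) := by
  -- Cutting off to `(-1, 1]` makes the function integrable while keeping it continuous at `0`, so
  -- the approximate identity theorem applies without growth conditions on `φ`.
  set g : ℝ → ℝ := (Set.Ioc (-1 : ℝ) 1).indicator φ with hg
  have hgi : Integrable g :=
    (integrable_indicator_iff measurableSet_Ioc).2 (hφ.integrableOn_Ioc)
  have hg0 : ContinuousAt g 0 := by
    refine hφ.continuousAt.congr ?_
    filter_upwards [Ioo_mem_nhds (by norm_num : (-1 : ℝ) < 0) (by norm_num : (0 : ℝ) < 1)] with y hy
    rw [hg, Set.indicator_of_mem (Set.Ioo_subset_Ioc_self hy)]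
  have hψ : Tendsto (fun x : ℝ => ‖x‖ ^ Module.finrank ℝ ℝ * (Real.pi⁻¹ * (1 + x ^ 2)⁻¹))
      (Bornology.cobounded ℝ) (𝓝 0) := by
    have h1 : Tendsto (fun x : ℝ => Real.pi⁻¹ * ‖x⁻¹‖) (Bornology.cobounded ℝ) (𝓝 0) := by
      simpa using (tendsto_inv₀_cobounded (α := ℝ)).norm.const_mul Real.pi⁻¹
    refine squeeze_zero_norm' ?_ h1
    filter_upwards [Bornology.eventually_ne_cobounded (0 : ℝ)] with x hx
    have hx' : 0 < |x| := abs_pos.2 hx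
    rw [Module.finrank_self, pow_one, Real.norm_of_nonneg (by positivity), norm_inv,
      Real.norm_eq_abs, mul_left_comm]
    refine mul_le_mul_of_nonneg_left ?_ (by positivity)
    rw [← div_eq_mul_inv, div_le_iff₀ (by positivity), ← sq_abs x]
    field_simp
    nlinarith
  have h := tendsto_integral_comp_smul_smul_of_integrable (μ := (volume : Measure ℝ))
    (φ := fun x => Real.pi⁻¹ * (1 + x ^ 2)⁻¹) (fun x => by positivity)
    (by rw [integral_const_mul, integral_univ_inv_one_add_sq,
      inv_mul_cancel₀ Real.pi_ne_zero]) hψ hgi hg0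
  have h2 := (h.comp tendsto_inv_nhdsGT_zero).const_mul Real.pi
  have hg00 : g 0 = φ 0 := by rw [hg, Set.indicator_of_mem (by norm_num)]
  rw [hg00] at h2
  refine h2.congr' ?_
  filter_upwards [self_mem_nhdsWithin] with η hη
  have hη0 : (0 : ℝ) < η := hη
  rw [Function.comp_apply, intervalIntegral.integral_of_le (by norm_num),
    ← integral_indicator measurableSet_Ioc, ← integral_const_mul]
  refine integral_congr_ae (Eventually.of_forall fun y => ?_)
  by_cases hy : y ∈ Set.Ioc (-1 : ℝ) 1
  · simp only [hg, Set.indicator_of_mem hy, Module.finrank_self, pow_one, smul_eq_mul]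
    have := Real.pi_ne_zero
    field_simp
    ring
  · simp [hg, Set.indicator_of_notMem hy]

/-- The second derivative as a boundary value of the transform with kernel `(x - z)⁻³`, at `0`. -/
lemma tendsto_integral_deriv_poisson {v v' v'' : ℝ → ℝ} (hv : ∀ x, HasDerivAt v (v' x) x)
    (hv' : ∀ x, HasDerivAt v' (v'' x) x) (hc : Continuous v'') {C : ℝ}
    (hC : ∀ x, |v x| ≤ C * (1 + |x|)) :
    Tendsto (fun η : ℝ => ∫ y : ℝ, v y * ((6 * y ^ 2 * η - 2 * η ^ 3) / (y ^ 2 + η ^ 2) ^ 3))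
      (𝓝[>] 0) (𝓝 (Real.pi * v'' 0)) := by
  have hC0 : 0 ≤ C := by simpa using (abs_nonneg _).trans (hC 0)
  have cv : Continuous v := continuous_iff_continuousAt.2 fun y => (hv y).continuousAt
  have cv' : Continuous v' := continuous_iff_continuousAt.2 fun y => (hv' y).continuousAt
  set k : ℝ → ℝ → ℝ := fun η y => (6 * y ^ 2 * η - 2 * η ^ 3) / (y ^ 2 + η ^ 2) ^ 3 with hk
  have hkc : ∀ η : ℝ, 0 < η → Continuous (k η) := fun η hη =>
    Continuous.div (by fun_prop) (by fun_prop) fun y => by positivity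
  -- Away from the origin the kernel is `O(η |y|⁻⁴)`, which beats the linear growth of `v` and
  -- vanishes with `η`.
  have hkb : ∀ η y : ℝ, 0 < η → y ∉ Set.Ioc (-1 : ℝ) 1 →
      ‖v y * k η y‖ ≤ η * (96 * C * (1 / (1 + |y|) ^ 3)) := by
    intro η y hη hy
    have hy1 : 1 ≤ |y| := by
      by_contra! hlt
      exact hy ⟨(abs_lt.1 hlt).1, (abs_lt.1 hlt).2.le⟩
    have h1 : |k η y| ≤ 6 * η / (y ^ 2 + η ^ 2) ^ 2 := by
      rw [hk, abs_div, abs_of_pos (a := (y ^ 2 + η ^ 2) ^ 3) (by positivity),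
        div_le_div_iff₀ (by positivity) (by positivity)]
      have h2 : |6 * y ^ 2 * η - 2 * η ^ 3| ≤ 6 * η * (y ^ 2 + η ^ 2) := by
        have h3 : 0 < η ^ 3 := by positivity
        have h4 : 0 ≤ y ^ 2 * η := by positivity
        rw [abs_le]
        constructor <;> nlinarith
      calc _ ≤ 6 * η * (y ^ 2 + η ^ 2) * (y ^ 2 + η ^ 2) ^ 2 := by gcongr
        _ = _ := by ring
    have h5 : (1 + |y|) ^ 4 ≤ 16 * (y ^ 2 + η ^ 2) ^ 2 := by
      have h6 : (1 + |y|) ^ 2 ≤ 4 * (y ^ 2 + η ^ 2) := by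
        have := sq_abs y
        nlinarith [sq_nonneg η]
      calc (1 + |y|) ^ 4 = ((1 + |y|) ^ 2) ^ 2 := by ring
        _ ≤ (4 * (y ^ 2 + η ^ 2)) ^ 2 := by gcongr
        _ = _ := by ring
    have hy0 : 0 < 1 + |y| := by positivity
    have h7 : 6 * η / (y ^ 2 + η ^ 2) ^ 2 ≤ 96 * η / (1 + |y|) ^ 4 := by
      rw [div_le_div_iff₀ (by positivity) (by positivity)]
      nlinarith
    rw [norm_mul, Real.norm_eq_abs, Real.norm_eq_abs]
    calc |v y| * |k η y| ≤ (C * (1 + |y|)) * (96 * η / (1 + |y|) ^ 4) :=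
          mul_le_mul (hC y) (h1.trans h7) (abs_nonneg _) (by positivity)
      _ = _ := by field_simp
  have hdom : Integrable fun y : ℝ => 96 * C * (1 / (1 + |y|) ^ 3) :=
    (integrable_one_add_abs_pow (by norm_num)).const_mul _
  have hms : MeasurableSet (Set.Ioc (-1 : ℝ) 1) := measurableSet_Ioc
  have hout : ∀ η : ℝ, 0 < η → IntegrableOn (fun y => v y * k η y) (Set.Ioc (-1 : ℝ) 1)ᶜ :=
    fun η hη => ((hdom.const_mul η).integrableOn).mono'
      (cv.mul (hkc η hη)).aestronglyMeasurable
      ((ae_restrict_mem hms.compl).mono fun y hy => hkb η y hη hy)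
  have hsplit : ∀ η : ℝ, 0 < η → ∫ y, v y * k η y
      = (∫ y in (Set.Ioc (-1 : ℝ) 1)ᶜ, v y * k η y) + ∫ y in (-1 : ℝ)..1, v y * k η y := by
    intro η hη
    have hin : IntegrableOn (fun y => v y * k η y) (Set.Ioc (-1 : ℝ) 1) :=
      (cv.mul (hkc η hη)).integrableOn_Ioc
    have hi : Integrable fun y => v y * k η y := by
      rw [← integrableOn_univ, ← Set.union_compl_self (Set.Ioc (-1 : ℝ) 1)]
      exact hin.union (hout η hη)
    rw [intervalIntegral.integral_of_le (by norm_num), add_comm,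
      integral_add_compl hms hi]
  have hfar : Tendsto (fun η : ℝ => ∫ y in (Set.Ioc (-1 : ℝ) 1)ᶜ, v y * k η y) (𝓝[>] 0)
      (𝓝 0) := by
    have h1 : Tendsto (fun η : ℝ => η * ∫ y in (Set.Ioc (-1 : ℝ) 1)ᶜ, 96 * C * (1 / (1 + |y|) ^ 3))
        (𝓝[>] 0) (𝓝 0) := by
      have : Tendsto (fun η : ℝ => η) (𝓝[>] 0) (𝓝 0) := nhdsWithin_le_nhds
      simpa only [zero_mul] using
        this.mul_const (∫ y in (Set.Ioc (-1 : ℝ) 1)ᶜ, 96 * C * (1 / (1 + |y|) ^ 3))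
    refine squeeze_zero_norm' ?_ h1
    filter_upwards [self_mem_nhdsWithin] with η hη
    rw [← integral_const_mul]
    exact norm_integral_le_of_norm_le (hdom.const_mul η).integrableOn
      ((ae_restrict_mem hms.compl).mono fun y hy => hkb η y hη hy)
  have hbd : Tendsto (fun η : ℝ => v 1 * (-(2 * 1 * η) / (1 ^ 2 + η ^ 2) ^ 2)
      - v (-1) * (-(2 * (-1) * η) / ((-1) ^ 2 + η ^ 2) ^ 2)
      - (v' 1 * (η / (1 ^ 2 + η ^ 2)) - v' (-1) * (η / ((-1) ^ 2 + η ^ 2)))) (𝓝[>] 0) (𝓝 0) := by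
    have : ContinuousAt (fun η : ℝ => v 1 * (-(2 * 1 * η) / (1 ^ 2 + η ^ 2) ^ 2)
      - v (-1) * (-(2 * (-1) * η) / ((-1) ^ 2 + η ^ 2) ^ 2)
      - (v' 1 * (η / (1 ^ 2 + η ^ 2)) - v' (-1) * (η / ((-1) ^ 2 + η ^ 2)))) 0 := by
      refine Continuous.continuousAt ?_
      have e1 : ∀ η : ℝ, (1 ^ 2 + η ^ 2 : ℝ) ≠ 0 := fun η => by positivity
      have e2 : ∀ η : ℝ, ((-1) ^ 2 + η ^ 2 : ℝ) ≠ 0 := fun η => by positivity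
      have e3 : ∀ η : ℝ, (1 ^ 2 + η ^ 2 : ℝ) ^ 2 ≠ 0 := fun η => by positivity
      have e4 : ∀ η : ℝ, ((-1) ^ 2 + η ^ 2 : ℝ) ^ 2 ≠ 0 := fun η => by positivity
      fun_prop (disch := assumption)
    have h := this.tendsto.mono_left (nhdsWithin_le_nhds (s := Set.Ioi 0))
    simpa using h
  have hlim := hfar.add (hbd.add (tendsto_poisson hc))
  rw [zero_add, zero_add] at hlim
  refine hlim.congr' ?_
  filter_upwards [self_mem_nhdsWithin] with η hη
  have hη0 : (0 : ℝ) < η := hη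
  have c1 : Continuous fun y : ℝ => -(2 * y * η) / (y ^ 2 + η ^ 2) ^ 2 :=
    Continuous.div (by fun_prop) (by fun_prop) fun y => by positivity
  -- On `[-1, 1]`, two integrations by parts move both derivatives from the Poisson kernel to `v`;
  -- the boundary terms at `±1` are the expression in `hbd`, which tends to `0`.
  have p1 := intervalIntegral.integral_mul_deriv_eq_deriv_mul (a := -1) (b := 1)
    (fun y _ => hv y) (fun y _ => hasDerivAt_deriv_poisson hη0 y)
    (cv'.intervalIntegrable _ _) ((hkc η hη0).intervalIntegrable _ _)
  have p2 := intervalIntegral.integral_mul_deriv_eq_deriv_mul (a := -1) (b := 1)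
    (fun y _ => hv' y) (fun y _ => hasDerivAt_poisson hη0 y)
    (hc.intervalIntegrable _ _) (c1.intervalIntegrable _ _)
  rw [hsplit η hη0, add_right_inj]
  change _ = ∫ y in (-1 : ℝ)..1, v y * ((6 * y ^ 2 * η - 2 * η ^ 3) / (y ^ 2 + η ^ 2) ^ 3)
  rw [p1, p2]
  ring

lemma tendsto_im_cauchyPow_three {w w' w'' : ℝ → ℝ} (hw : ∀ x, HasDerivAt w (w' x) x)
    (hw' : ∀ x, HasDerivAt w' (w'' x) x) (hc : Continuous w'') {C : ℝ}
    (hC : ∀ x, |w x| ≤ C * (1 + |x|)) (x : ℝ) :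
    Tendsto (fun η : ℝ => 2 * (cauchyPow (fun x => (w x : ℂ)) 3 (x + η * Complex.I)).im) (𝓝[>] 0)
      (𝓝 (Real.pi * w'' x)) := by
  have hC0 : 0 ≤ C := by simpa using (abs_nonneg _).trans (hC 0)
  have cw : Continuous w := continuous_iff_continuousAt.2 fun y => (hw y).continuousAt
  have hC' : ∀ y, |w (y + x)| ≤ C * (1 + |x|) * (1 + |y|) := fun y => by
    refine (hC _).trans ?_
    rw [mul_assoc]
    refine mul_le_mul_of_nonneg_left ?_ hC0
    nlinarith [abs_add_le y x, mul_nonneg (abs_nonneg x) (abs_nonneg y)]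
  have h := tendsto_integral_deriv_poisson (v := fun y => w (y + x)) (v' := fun y => w' (y + x))
    (v'' := fun y => w'' (y + x)) (fun y => (hw (y + x)).comp_add_const y x)
    (fun y => (hw' (y + x)).comp_add_const y x) (by fun_prop) hC'
  rw [zero_add] at h
  refine h.congr' ?_
  filter_upwards [self_mem_nhdsWithin] with η hη
  have hη0 : (0 : ℝ) < η := hη
  have hz : 0 < (η * Complex.I : ℂ).im := by simpa using hη0
  have hi : Integrable fun y : ℝ => (w (y + x) : ℂ) / ((y : ℂ) - η * Complex.I) ^ 3 :=
    integrable_kernel (w := fun y => (w (y + x) : ℂ))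
      (Continuous.aestronglyMeasurable (by fun_prop))
      (integrable_weight_real (w := fun y => w (y + x)) (by fun_prop) hC' le_rfl) hz
  have him := Complex.imCLM.integral_comp_comm hi
  simp only [Complex.imCLM_apply] at him
  rw [add_comm (x : ℂ), ← integral_comp_add_kernel, ← him, ← integral_const_mul]
  refine integral_congr_ae (Eventually.of_forall fun y => ?_)
  simp only
  rw [im_kernel_three _ _ _ hη0]

/-! ### Classification of the solutions of the integrodifferential equation -/

/-- Solutions of the homogeneous equation `w + c⁻¹ H w' = 0` are trigonometric. -/
lemma exists_eq_trig_of_hilbert {c : ℝ} (hc0 : 0 < c) {w w' w'' : ℝ → ℝ}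
    (hw : ∀ x, HasDerivAt w (w' x) x) (hw' : ∀ x, HasDerivAt w' (w'' x) x) (hc : Continuous w'')
    (hH : ∀ x, HasHilbertTransformAt w' x (-c * w x)) :
    ∃ A : ℂ, ∀ x, w x = A.re * Real.cos (c * x) - A.im * Real.sin (c * x) := by
  obtain ⟨C, hC0, hC⟩ := linear_bound_of_hilbert hw hw' hH
  obtain ⟨A, hA⟩ := exists_cauchyPow_eq_exp hw hw' hc hH
  have hw2 : ∀ x : ℝ, Real.pi * w'' x = 2 * (A * Complex.exp (Complex.I * c * x)).im := by
    intro x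
    refine tendsto_nhds_unique (tendsto_im_cauchyPow_three hw hw' hc hC x) ?_
    have hcont : Continuous fun η : ℝ =>
        2 * (A * Complex.exp (Complex.I * c * (x + η * Complex.I))).im := by fun_prop
    have h1 := (hcont.tendsto 0).mono_left (nhdsWithin_le_nhds (s := Set.Ioi 0))
    rw [Complex.ofReal_zero, zero_mul, add_zero] at h1
    refine h1.congr' ?_
    filter_upwards [self_mem_nhdsWithin] with η hη
    have hη0 : (0 : ℝ) < η := hη
    rw [hA _ (by simpa using hη0)]
  -- Chosen so that `T(x) = Re(D e^{icx})` satisfies `T'' = (2/π) Im(A e^{icx}) = w''`.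
  set D : ℂ := 2 / (Real.pi * c ^ 2 : ℝ) * (Complex.I * A) with hD
  -- Writing the sinusoid as a difference of two explicit solutions makes its derivatives and its
  -- Hilbert transform available at once.
  set T : ℝ → ℝ := fun x => solution c D x - solution c 0 x with hT
  have hTeq : ∀ x, T x = D.re * Real.cos (c * x) - D.im * Real.sin (c * x) := fun x => by
    rw [hT]; simp only; rw [solution_eq c D]; ring
  set T' : ℝ → ℝ := fun x => deriv (solution c D) x - deriv (solution c 0) x with hT'
  have hTd : ∀ x, HasDerivAt T (T' x) x := fun x =>
    (hasDerivAt_solution c D x).differentiableAt.hasDerivAt.sub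
      (hasDerivAt_solution c 0 x).differentiableAt.hasDerivAt
  have hTd' : ∀ x, HasDerivAt T' (w'' x) x := fun x => by
    refine ((hasDerivAt_deriv_solution c D x).sub
      (hasDerivAt_deriv_solution c 0 x)).congr_deriv ?_
    have h1 : w'' x = -c ^ 2 * T x := by
      have h2 := hw2 x
      have h3 : T x = (D * Complex.exp (Complex.I * c * x)).re := by rw [re_mul_exp, hTeq]
      rw [h3, hD, show 2 / ((Real.pi * c ^ 2 : ℝ) : ℂ) * (Complex.I * A)
        * Complex.exp (Complex.I * c * x) = ((2 / (Real.pi * c ^ 2) : ℝ) : ℂ)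
          * (Complex.I * (A * Complex.exp (Complex.I * c * x))) by push_cast; ring,
        Complex.re_ofReal_mul, Complex.I_mul_re]
      have hp := Real.pi_ne_zero
      field_simp
      linear_combination h2
    rw [h1, hT]
    ring
  have cont : ∀ A, Continuous (deriv (solution c A)) := fun A =>
    continuous_iff_continuousAt.2 fun x => (hasDerivAt_deriv_solution c A x).continuousAt
  have hTH : ∀ x, HasHilbertTransformAt T' x (-c * T x) := fun x => by
    have h := (hasHilbertTransformAt_deriv_solution hc0.le D x).sub (cont D) (cont 0)
      (hasHilbertTransformAt_deriv_solution hc0.le 0 x)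
    convert h using 1
    rw [hT]
    ring
  -- `w - T` is affine, and sublinear growth makes it constant.
  obtain ⟨b, hb⟩ : ∃ b, ∀ x, w' x - T' x = b := by
    have hd : ∀ x, HasDerivAt (fun x => w' x - T' x) 0 x := fun x =>
      ((hw' x).sub (hTd' x)).congr_deriv (sub_self _)
    exact ⟨_, fun x => is_const_of_deriv_eq_zero (fun x => (hd x).differentiableAt)
      (fun x => (hd x).deriv) x 0⟩
  have haff : ∀ x, w x - T x = w 0 - T 0 + b * x := by
    have hd : ∀ x, HasDerivAt (fun x => w x - T x - b * x) 0 x := fun x =>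
      (((hw x).sub (hTd x)).sub ((hasDerivAt_id x).const_mul b)).congr_deriv (by
        rw [hb]; ring)
    intro x
    have := is_const_of_deriv_eq_zero (fun x => (hd x).differentiableAt)
      (fun x => (hd x).deriv) x 0
    simp only [mul_zero, sub_zero] at this
    linarith
  have hb0 : b = 0 := by
    have cT' : Continuous T' := (cont D).sub (cont 0)
    obtain ⟨R, -, hR, -⟩ := exists_tails (g := w')
      (continuous_iff_continuousAt.2 fun y => (hw' y).continuousAt) (hH 0)
    obtain ⟨R', -, hR', -⟩ := exists_tails cT' (hTH 0)
    have h1 := tendsto_div_atTop_of_tail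
      (continuous_iff_continuousAt.2 fun y => (hw' y).continuousAt) hR hw
    have h2 := tendsto_div_atTop_of_tail cT' hR' hTd
    have h3 := h1.sub h2
    rw [sub_zero] at h3
    have h4 : Tendsto (fun x : ℝ => (w 0 - T 0) / x + b) atTop (𝓝 (0 + b)) :=
      (tendsto_const_nhds.div_atTop tendsto_id).add_const b
    rw [zero_add] at h4
    refine tendsto_nhds_unique h4 (h3.congr' ?_)
    filter_upwards [eventually_ne_atTop 0] with x hx
    rw [← sub_div, haff]
    field_simp
  -- The additive constant is excluded by the equation itself: equal derivatives have equal
  -- transforms, so `-c w = -c T` with `c ≠ 0`.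
  have hww : w' = T' := funext fun x => by have := hb x; rw [hb0] at this; linarith
  refine ⟨D, fun x => ?_⟩
  have h1 := (hH x).hilbertTransform_eq
  rw [hww, (hTH x).hilbertTransform_eq] at h1
  rw [← hTeq]
  exact (mul_left_cancel₀ (neg_ne_zero.2 hc0.ne') h1).symm

/-- Subtracting the particular solution leaves a function `w` with `H w' = -c w`. Its sinusoid is
absorbed into the free amplitude `A`. -/
lemma SolvesIntegrodifferential.exists_eq_solution {F : ℝ} (hF : 0 < F) {u : ℝ → ℝ}
    (hu : ContDiff ℝ 2 u) (h : SolvesIntegrodifferential F u) :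
    ∃ A, u = solution (1 / F ^ 2) A := by
  set c := 1 / F ^ 2 with hc
  have hc0 : 0 < c := by positivity
  obtain ⟨d1, d2, d3⟩ := hasDerivAt_of_contDiff_two hu
  obtain ⟨e1, e2, e3⟩ := hasDerivAt_of_contDiff_two (contDiff_solution c 0)
  have cu' : Continuous (deriv u) := continuous_iff_continuousAt.2 fun x => (d2 x).continuousAt
  have cs' : Continuous (deriv (solution c 0)) :=
    continuous_iff_continuousAt.2 fun x => (e2 x).continuousAt
  obtain ⟨A, hA⟩ := exists_eq_trig_of_hilbert hc0 (w := fun x => u x - solution c 0 x)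
    (w' := fun x => deriv u x - deriv (solution c 0) x) (fun x => (d1 x).sub (e1 x))
    (fun x => (d2 x).sub (e2 x)) (d3.sub e3) (fun x => by
      obtain ⟨⟨L, hL⟩, heq⟩ := h x
      have hs := hL.sub cu' cs' (hasHilbertTransformAt_deriv_solution hc0.le 0 x)
      convert hs using 1
      rw [hL.hilbertTransform_eq] at heq
      have hcF : c * F ^ 2 = 1 := by rw [hc]; field_simp
      linear_combination (-c) * heq + L * hcF)
  refine ⟨A, funext fun x => ?_⟩
  rw [solution_eq, ← hA]
  ring

end SurfaceWave

end

theorem mainTheorem1 (F : ℝ) (hF : 0 < F) :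
    -- the Hilbert transforms of `f` and of `f'` exist, and the former is explicit
    (∀ t : ℝ, SurfaceWave.HasHilbertTransformAt SurfaceWave.forcing t
        (-t / (Real.pi * (t ^ 2 + 1)))) ∧
    (∀ t : ℝ, ∃ L : ℝ, SurfaceWave.HasHilbertTransformAt (deriv SurfaceWave.forcing) t L) ∧
    -- the integrodifferential equation is equivalent to the differential equation
    (∀ u : ℝ → ℝ, ContDiff ℝ 2 u →
      (SurfaceWave.SolvesIntegrodifferential F u ↔ SurfaceWave.SolvesODE F u)) ∧
    -- the unique solution vanishing at `-∞`, and its two integral representations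
    (∃ u : ℝ → ℝ,
      (∀ v : ℝ → ℝ,
        (ContDiff ℝ 2 v ∧ SurfaceWave.SolvesIntegrodifferential F v ∧
          Tendsto v atBot (𝓝 0)) ↔ v = u) ∧
      (∀ x : ℝ, Tendsto
        (fun a : ℝ => (1 / F ^ 2) * ∫ t in a..x,
          (Real.sin ((x - t) / F ^ 2) * SurfaceWave.forcing t
            - Real.cos ((x - t) / F ^ 2) *
              SurfaceWave.hilbertTransform SurfaceWave.forcing t))
        atBot (𝓝 (u x))) ∧
      (∀ x : ℝ, Tendsto
        (fun b : ℝ => (1 / (Real.pi * F ^ 2)) * ∫ s in (0 : ℝ)..b,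
          (Real.sin (s / F ^ 2) * (1 / ((x - s) ^ 2 + 1))
            + Real.cos (s / F ^ 2) * ((x - s) / ((x - s) ^ 2 + 1))))
        atTop (𝓝 (u x)))) := by
  have hc : 0 < 1 / F ^ 2 := by positivity
  refine ⟨SurfaceWave.hasHilbertTransformAt_forcing,
    fun t => ⟨_, SurfaceWave.hasHilbertTransformAt_deriv_forcing t⟩,
    fun u hu => ⟨fun h => ?_, fun h => ?_⟩,
    SurfaceWave.solution (1 / F ^ 2) 0, fun v => ⟨?_, ?_⟩,
    SurfaceWave.tendsto_integral_forcing_solution hF, SurfaceWave.tendsto_integral_solution hF⟩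
  · obtain ⟨A, rfl⟩ := h.exists_eq_solution hF hu
    exact SurfaceWave.solvesODE_solution hF A
  · obtain ⟨A, rfl⟩ := h.exists_eq_solution hF hu
    exact SurfaceWave.solvesIntegrodifferential_solution hF A
  · rintro ⟨hv, hs, ht⟩
    obtain ⟨A, rfl⟩ := hs.exists_eq_solution hF hv
    rw [SurfaceWave.eq_zero_of_tendsto_solution hc ht]
  · rintro rfl
    exact ⟨SurfaceWave.contDiff_solution _ _, SurfaceWave.solvesIntegrodifferential_solution hF 0,
      SurfaceWave.tendsto_solution_zero_atBot _⟩
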